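/- Let $\mathbb K$ be $\mathbb R$ or $\mathbb C$, let $1\le k\le d-1$ and $d_k=\binom dk$. Identify $\wedge^k\mathbb K^d$ with $\mathbb K^{d_k}$ through the basis $e_{i_1}\wedge\dots\wedge e_{i_k}$ ($i_1<\dots<i_k$) in lexicographic order. **Notation.** For $g\in\mathsf{PSL}(d,\mathbb K)$ let $\kappa(g)=\mathrm{diag}(\log\sigma_1(g),\dots,\log\sigma_d(g))$ be its Cartan projection ($\sigma_1\ge\dots\ge\sigma_d$ the singular values of a lift to $\mathsf{SL}(d,\mathbb K)$), and let $\alpha_j(A)=A_j-A_{j+1}$. If $\theta\subset\{1,\dots,d-1\}$ and $\alpha_j(\kappa(g))>0$ for all $j\in\theta$, let $U_\theta(g)$ be the partial flag $(m_1\langle e_1,\dots,e_j\rangle)_{j\in\theta}$, where $g=m_1e^{\kappa(g)}m_2$ is a singular value decomposition. A subgroup $\Gamma$ is $\mathsf P_\theta$-divergent if $\alpha_j(\kappa(\gamma_i))\to\infty$ for all $j\in\theta$ and all sequences $(\gamma_i)$ of distinct elements of $\Gamma$; its limit set $\Lambda_\theta(\Gamma)$ is the set of all limits of $U_\theta(\gamma_i)$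 along such sequences, and $\Lambda_j:=\Lambda_{\{j\}}\subset\mathrm{Gr}_j(\mathbb K^d)$. For $\theta=d-\theta$, $\Gamma$ is $\mathsf P_\theta$-Anosov if it is $\mathsf P_\theta$-divergent, distinct $x,y\in\Lambda_\theta(\Gamma)$ are transverse ($x^j+y^{d-j}=\mathbb K^d$ for all $j\in\theta$), and every $x\in\Lambda_\theta(\Gamma)$ is conical: there are $\gamma_i\in\Gamma$ and $a\ne b$ in $\Lambda_\theta(\Gamma)$ with $\gamma_ix\to a$ and $\gamma_iy\to b$ for all $y\in\Lambda_\theta(\Gamma)\smallsetminus\{x\}$. Let $\theta_k=\{k-1,k,k+1,d-k-1,d-k,d-k+1\}\cap\{1,\dots,d-1\}$. $\Gamma$ is $(d-k)$-hyperconvex if it is $\mathsf P_{\theta_k}$-Anosov and for all mutually distinct $x,y,z\in\Lambda_{\theta_k}(\Gamma)$, with $z^0=0$ and $z^d=\mathbb K^d$, $$\big((x^k\cap z^{d-k+1})+z^{d-k-1}\big)\cap\big((y^k\cap z^{d-k+1})+z^{d-k-1}\big)=z^{d-k-1}.$$ Let $\delta^{\alpha_k}(\Gamma)\in[0,\infty]$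 be the critical exponent of $\sum_{\gamma\in\Gamma}e^{-s\alpha_k(\kappa(\gamma))}$. If $\delta=\delta^{\alpha_k}(\Gamma)<\infty$, an $\alpha_k$-Patterson--Sullivan measure for $\Gamma$ on $\Lambda_{\theta_k}(\Gamma)$ is a Borel probability measure $\mu$ on it such that for all $\gamma\in\Gamma$ the measures $\gamma_*\mu$ and $\mu$ are mutually absolutely continuous and $\frac{d\gamma_*\mu}{d\mu}(x)=e^{-\delta\,\alpha_k(B(\gamma^{-1},\hat x))}$ for $\mu$-almost every $x$. Here $\hat x$ is any full flag refining $x$ and $B$ is the Iwasawa cocycle: $B(g,hF_0)=A$ if $F_0$ is the standard full flag, $h$ is special unitary and $gh=me^An$ is the Iwasawa decomposition. An $\alpha_k$-Patterson--Sullivan measure on $\Lambda_k(\Gamma)$ is the push-forward of such a $\mu$ under $x\mapsto x^k$. **Claim.** The $k$-th exterior power $g(v_1\wedge\dots\wedge v_k)=gv_1\wedge\dots\wedge gv_k$ induces a well-defined continuous homomorphism $\eta_k:\mathsf{PSL}(d,\mathbb K)\to\mathsf{PSL}(d_k,\mathbb K)$. The Plücker map $E_k:\mathrm{Gr}_k(\mathbb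 K^d)\to\mathbb P(\mathbb K^{d_k})$, $\langle v_1,\dots,v_k\rangle\mapsto[v_1\wedge\dots\wedge v_k]$, is a well-defined smooth embedding, holomorphic when $\mathbb K=\mathbb C$. Moreover $\alpha_1(\kappa(\eta_k(g)))=\alpha_k(\kappa(g))$ for all $g\in\mathsf{PSL}(d,\mathbb K)$, and for every $(d-k)$-hyperconvex subgroup $\Gamma\subset\mathsf{PSL}(d,\mathbb K)$: 1. $\eta_k(\Gamma)\subset\mathsf{PSL}(d_k,\mathbb K)$ is $(d_k-1)$-hyperconvex, and $\Lambda_1(\eta_k(\Gamma))=E_k(\Lambda_k(\Gamma))$; 2. $\delta^{\alpha_1}(\eta_k(\Gamma))=\delta^{\alpha_k}(\Gamma)$; 3. if $\mu$ is an $\alpha_k$-Patterson--Sullivan measure for $\Gamma$ on $\Lambda_k(\Gamma)$, then $(E_k)_*\mu$ is an $\alpha_1$-Patterson--Sullivan measure for $\eta_k(\Gamma)$ on $\Lambda_1(\eta_k(\Gamma))$, and every $\alpha_1$-Patterson--Sullivan measure for $\eta_k(\Gamma)$ on $\Lambda_1(\eta_k(\Gamma))$ arises in this way. -/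

import Mathlib

open Filter Topology MeasureTheory
open scoped ENNReal NNReal MatrixGroups

noncomputable section

namespace HyperconvexWedge

/-! ### Linear algebra, `SL`, `PSL` -/

/-- `K^d` with its standard inner product. -/
abbrev Vec (K : Type*) [RCLike K] (d : ℕ) : Type _ := EuclideanSpace K (Fin d)

/-- The linear automorphism of `K^d` given by a matrix of determinant one. -/
def slEquiv {K : Type*} [RCLike K] {d : ℕ} (g : SL(d, K)) : Vec K d ≃ₗ[K] Vec K d :=
  (WithLp.linearEquiv 2 K (Fin d → K)).trans
    ((Matrix.SpecialLinearGroup.toLin' g).trans (WithLp.linearEquiv 2 K (Fin d → K)).symm)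

/-- A lift of `g ∈ PSL(d, K)` to `SL(d, K)`; two lifts differ by a scalar of modulus one, so
nothing below depends on the choice. -/
def pslLift {K : Type*} [RCLike K] {d : ℕ} (g : PSL(d, K)) : SL(d, K) := Quotient.out g

/-- `A ∈ SU(d)` (which is `SO(d)` when `K = ℝ`), as a condition on an element of `SL(d, K)`. -/
def IsSU {K : Type*} [RCLike K] {d : ℕ} (m : SL(d, K)) : Prop :=
  (m : Matrix (Fin d) (Fin d) K) ∈ Matrix.unitaryGroup (Fin d) K

/-- Unipotent upper triangular elements of `SL(d, K)`. -/
def IsUpperUnipotent {K : Type*} [RCLike K] {d : ℕ} (n : SL(d, K)) : Prop :=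
  (∀ i, (n : Matrix (Fin d) (Fin d) K) i i = 1) ∧
    ∀ i j, j < i → (n : Matrix (Fin d) (Fin d) K) i j = 0

/-- The matrix `exp(diag(A_1, …, A_d))` for a real vector `A`. -/
def expDiag (K : Type*) [RCLike K] {d : ℕ} (A : Fin d → ℝ) : Matrix (Fin d) (Fin d) K :=
  Matrix.diagonal fun i => ((Real.exp (A i) : ℝ) : K)

/-- The span of the first `j` standard basis vectors of `K^d`. -/
def stdSpace (K : Type*) [RCLike K] (d j : ℕ) : Submodule K (Vec K d) :=
  Submodule.span K {v | ∃ i : Fin d, (i : ℕ) < j ∧ v = EuclideanSpace.single i (1 : K)}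

/-! ### Cartan projection and simple roots

Elements of the Cartan subspace (real traceless diagonal matrices) are written as
vectors `Fin d → ℝ`. -/

/-- The `j`-th diagonal entry, `1 ≤ j ≤ d`, as a linear form. -/
def entry (d j : ℕ) : (Fin d → ℝ) →ₗ[ℝ] ℝ :=
  if h : 1 ≤ j ∧ j ≤ d then LinearMap.proj (⟨j - 1, by omega⟩ : Fin d) else 0

/-- The simple root `α_k(A) = A_k - A_{k+1}`, for `1 ≤ k ≤ d - 1`. -/
def simpleRoot (d k : ℕ) : (Fin d → ℝ) →ₗ[ℝ] ℝ := entry d k - entry d (k + 1)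

/-- The Cartan projection: the logarithms of the singular values, in decreasing order. -/
def cartan {K : Type*} [RCLike K] {d : ℕ} (g : PSL(d, K)) : Fin d → ℝ := fun i =>
  Real.log ((slEquiv (pslLift g)).toLinearMap.singularValues (i : ℕ))

/-! ### Grassmannians -/

/-- The Grassmannian `Gr_j(K^d)`. For `j = 1` this is the projective space of `K^d`. -/
@[ext]
structure Gr (K : Type*) [RCLike K] (d j : ℕ) where
  carrier : Submodule K (Vec K d)
  finrank_eq : Module.finrank K carrier = j

/-- The usual topology, induced by the operator-norm distance between orthogonal projections. -/
instance {K : Type*} [RCLike K] {d j : ℕ} : TopologicalSpace (Gr K d j) :=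
  TopologicalSpace.induced (fun W => W.carrier.starProjection) inferInstance

instance {K : Type*} [RCLike K] {d j : ℕ} : MeasurableSpace (Gr K d j) := borel _

instance {K : Type*} [RCLike K] {d j : ℕ} : BorelSpace (Gr K d j) := ⟨rfl⟩

/-- The action of `PSL(d, K)` on `Gr_j(K^d)`. -/
def Gr.act {K : Type*} [RCLike K] {d j : ℕ} (g : PSL(d, K)) (W : Gr K d j) : Gr K d j where
  carrier := W.carrier.map (slEquiv (pslLift g)).toLinearMap
  finrank_eq := by
    rw [LinearEquiv.finrank_map_eq]; exact W.finrank_eq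

/-- The standard affine chart of the Grassmannian centered at `W`, written as a parametrization:
a linear map `T : W → Wᗮ` is sent to its graph `{w + T w}`. -/
def Gr.graph {K : Type*} [RCLike K] {d j : ℕ} (W : Gr K d j)
    (T : W.carrier →L[K] W.carrierᗮ) : Gr K d j where
  carrier := LinearMap.range
    (W.carrier.subtype + W.carrierᗮ.subtype ∘ₗ (T : W.carrier →ₗ[K] W.carrierᗮ))
  finrank_eq := by
    rw [LinearMap.finrank_range_of_inj, W.finrank_eq]
    rw [← LinearMap.ker_eq_bot, LinearMap.ker_eq_bot']
    intro w hw
    have h : (w : Vec K d) = -((T w : W.carrierᗮ) : Vec K d) :=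
      eq_neg_of_add_eq_zero_left (by simpa using hw)
    have h2 : (w : Vec K d) ∈ W.carrierᗮ := by
      rw [h]; exact neg_mem (T w).2
    have h3 : (w : Vec K d) ∈ W.carrier ⊓ W.carrierᗮ := ⟨w.2, h2⟩
    rw [Submodule.inf_orthogonal_eq_bot] at h3
    exact Subtype.ext ((Submodule.mem_bot K).1 h3)

/-- A map of Grassmannians is a `K`-smooth embedding: it is a topological embedding, and in the
affine charts centered at every point and at its image it is smooth over `K` with injective
derivative. Over `ℂ`, smoothness over `K` is holomorphy; over `ℝ` it is real smoothness. -/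
def IsGrSmoothEmbedding {K : Type*} [RCLike K] {d j d' j' : ℕ} (f : Gr K d j → Gr K d' j') :
    Prop :=
  IsEmbedding f ∧ ∀ W : Gr K d j,
    ∃ F : (W.carrier →L[K] W.carrierᗮ) → ((f W).carrier →L[K] (f W).carrierᗮ),
      (∀ᶠ T in 𝓝 0, f (W.graph T) = (f W).graph (F T)) ∧
      ContDiffAt K (⊤ : ℕ∞) F 0 ∧ Function.Injective (fderiv K F 0)

/-! ### Flags -/

/-- The partial flag manifold `F_θ(K^d)`. -/
@[ext]
structure Flag (K : Type*) [RCLike K] (d : ℕ) (θ : Finset ℕ) where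
  proj : (j : θ) → Gr K d (j : ℕ)
  mono : ∀ i j : θ, i ≤ j → (proj i).carrier ≤ (proj j).carrier

instance {K : Type*} [RCLike K] {d : ℕ} {θ : Finset ℕ} : TopologicalSpace (Flag K d θ) :=
  TopologicalSpace.induced Flag.proj inferInstance

instance {K : Type*} [RCLike K] {d : ℕ} {θ : Finset ℕ} : MeasurableSpace (Flag K d θ) := borel _

instance {K : Type*} [RCLike K] {d : ℕ} {θ : Finset ℕ} : BorelSpace (Flag K d θ) := ⟨rfl⟩

/-- The subspace `x^j` of a flag, with the conventions `x^0 = 0` and `x^d = K^d`. It is only used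
for `j ∈ θ ∪ {0, d}`. -/
def Flag.space {K : Type*} [RCLike K] {d : ℕ} {θ : Finset ℕ} (x : Flag K d θ) (j : ℕ) :
    Submodule K (Vec K d) :=
  if h : j ∈ θ then (x.proj ⟨j, h⟩).carrier else if j = 0 then ⊥ else ⊤

/-- The action of `PSL(d, K)` on flags. -/
def Flag.act {K : Type*} [RCLike K] {d : ℕ} {θ : Finset ℕ} (g : PSL(d, K)) (x : Flag K d θ) :
    Flag K d θ where
  proj j := (x.proj j).act g
  mono i j h := Submodule.map_mono (x.mono i j h)

/-- Transversality of flags, for a symmetric `θ`. -/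
def Flag.Transverse {K : Type*} [RCLike K] {d : ℕ} {θ : Finset ℕ} (x y : Flag K d θ) : Prop :=
  ∀ j ∈ θ, x.space j ⊔ y.space (d - j) = ⊤

/-- `x = U_θ(g)`: all `α_k(κ(g))`, `k ∈ θ`, are positive, and `x^k = m₁⟨e_1, …, e_k⟩` for a
singular value decomposition `g = m₁ exp(κ(g)) m₂`. -/
def IsCartanFlag {K : Type*} [RCLike K] {d : ℕ} {θ : Finset ℕ} (g : PSL(d, K))
    (x : Flag K d θ) : Prop :=
  (∀ k ∈ θ, 0 < simpleRoot d k (cartan g)) ∧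
  ∃ g' m₁ m₂ : SL(d, K), (g' : PSL(d, K)) = g ∧ IsSU m₁ ∧ IsSU m₂ ∧
    (g' : Matrix (Fin d) (Fin d) K) = m₁ * expDiag K (cartan g) * m₂ ∧
    ∀ j : θ, (x.proj j).carrier = (stdSpace K d j).map (slEquiv m₁).toLinearMap

/-! ### Divergent, transverse, Anosov and hyperconvex subgroups -/

/-- `P_θ`-divergence; infinite sequences are sequences of pairwise distinct elements. -/
def IsDivergent {K : Type*} [RCLike K] {d : ℕ} (θ : Finset ℕ) (Γ : Subgroup PSL(d, K)) : Prop :=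
  ∀ k ∈ θ, ∀ γ : ℕ → PSL(d, K), Function.Injective γ → (∀ i, γ i ∈ Γ) →
    Tendsto (fun i => simpleRoot d k (cartan (γ i))) atTop atTop

/-- The limit set `Λ_θ(Γ)`: the limits of `U_θ(γ_i)` along infinite sequences in `Γ`. -/
def limitSet {K : Type*} [RCLike K] {d : ℕ} (θ : Finset ℕ) (Γ : Subgroup PSL(d, K)) :
    Set (Flag K d θ) :=
  {x | ∃ γ : ℕ → PSL(d, K), Function.Injective γ ∧ (∀ i, γ i ∈ Γ) ∧
    ∃ u : ℕ → Flag K d θ, (∀ᶠ i in atTop, IsCartanFlag (γ i) (u i)) ∧ Tendsto u atTop (𝓝 x)}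

/-- The limit set `Λ_k(Γ)` in `Gr_k(K^d)`, the latter being the flag manifold with `θ = {k}`. -/
def limitSetGr {K : Type*} [RCLike K] {d : ℕ} (k : ℕ) (Γ : Subgroup PSL(d, K)) :
    Set (Gr K d k) :=
  (fun x : Flag K d {k} => x.proj ⟨k, Finset.mem_singleton_self k⟩) '' limitSet {k} Γ

/-- `P_θ`-transverse subgroups. -/
def IsTransverse {K : Type*} [RCLike K] {d : ℕ} (θ : Finset ℕ) (Γ : Subgroup PSL(d, K)) : Prop :=
  (∀ j ∈ θ, d - j ∈ θ) ∧ IsDivergent θ Γ ∧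
    ∀ x ∈ limitSet θ Γ, ∀ y ∈ limitSet θ Γ, x ≠ y → x.Transverse y

/-- Conical points for the action of `Γ` on `Λ_θ(Γ)`. -/
def IsConical {K : Type*} [RCLike K] {d : ℕ} {θ : Finset ℕ} (Γ : Subgroup PSL(d, K))
    (x : Flag K d θ) : Prop :=
  ∃ γ : ℕ → PSL(d, K), (∀ i, γ i ∈ Γ) ∧
    ∃ a ∈ limitSet θ Γ, ∃ b ∈ limitSet θ Γ, a ≠ b ∧
      Tendsto (fun i => x.act (γ i)) atTop (𝓝 a) ∧
      ∀ y ∈ limitSet θ Γ, y ≠ x → Tendsto (fun i => y.act (γ i)) atTop (𝓝 b)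

/-- `P_θ`-Anosov subgroups. -/
def IsAnosov {K : Type*} [RCLike K] {d : ℕ} (θ : Finset ℕ) (Γ : Subgroup PSL(d, K)) : Prop :=
  IsTransverse θ Γ ∧ ∀ x ∈ limitSet θ Γ, IsConical Γ x

/-- `θ_k = {k-1, k, k+1, d-k-1, d-k, d-k+1} ∩ {1, …, d-1}`, for `1 ≤ k ≤ d - 1`. -/
def theta (d k : ℕ) : Finset ℕ :=
  {k - 1, k, k + 1, d - k - 1, d - k, d - k + 1} ∩ Finset.Icc 1 (d - 1)

/-- `Γ` is **`(d - k)`-hyperconvex**, for `1 ≤ k ≤ d - 1`. The parameter is `k`, not `d - k`. -/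
def IsCoHyperconvex {K : Type*} [RCLike K] {d : ℕ} (k : ℕ) (Γ : Subgroup PSL(d, K)) : Prop :=
  IsAnosov (theta d k) Γ ∧
    ∀ x ∈ limitSet (theta d k) Γ, ∀ y ∈ limitSet (theta d k) Γ, ∀ z ∈ limitSet (theta d k) Γ,
      x ≠ y → y ≠ z → x ≠ z →
      ((x.space k ⊓ z.space (d - k + 1)) ⊔ z.space (d - k - 1)) ⊓
        ((y.space k ⊓ z.space (d - k + 1)) ⊔ z.space (d - k - 1)) = z.space (d - k - 1)

/-! ### Critical exponents and Patterson–Sullivan measures -/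

/-- The Poincaré series `∑_{γ ∈ Γ} exp(-s φ(κ(γ)))`. -/
def poincareSeries {K : Type*} [RCLike K] {d : ℕ} (φ : (Fin d → ℝ) →ₗ[ℝ] ℝ)
    (Γ : Subgroup PSL(d, K)) (s : ℝ) : ℝ≥0∞ :=
  ∑' γ : Γ, ENNReal.ofReal (Real.exp (-(s * φ (cartan (γ : PSL(d, K))))))

/-- The critical exponent `δ^φ(Γ) ∈ [0, ∞]`. -/
def critExp {K : Type*} [RCLike K] {d : ℕ} (φ : (Fin d → ℝ) →ₗ[ℝ] ℝ)
    (Γ : Subgroup PSL(d, K)) : ℝ≥0∞ :=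
  ⨅ (s : ℝ≥0) (_ : poincareSeries φ Γ s < ⊤), (s : ℝ≥0∞)

/-- `A = B(g, y)` for the Iwasawa cocycle `B` and some full flag `y = h P_Δ` that refines `x`:
here `h ∈ SU(d)` and `g h = m exp(A) n` is the Iwasawa decomposition. -/
def IsIwasawa {K : Type*} [RCLike K] {d : ℕ} {θ : Finset ℕ} (g : PSL(d, K)) (x : Flag K d θ)
    (A : Fin d → ℝ) : Prop :=
  ∃ g' h m n : SL(d, K), (g' : PSL(d, K)) = g ∧ IsSU h ∧ IsSU m ∧ IsUpperUnipotent n ∧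
    (∀ j : θ, (x.proj j).carrier = (stdSpace K d j).map (slEquiv h).toLinearMap) ∧
    (g' : Matrix (Fin d) (Fin d) K) * h = m * expDiag K A * n

/-- `B(g, σ(x))`, where `σ(x)` is some full flag refining `x`. If `φ` is a combination of the
fundamental weights `ω_k`, `k ∈ θ`, then `φ(B(g, σ(x)))` does not depend on the choice
and is the value of `φ` on the `θ`-partial Iwasawa cocycle. -/
def iwasawa {K : Type*} [RCLike K] {d : ℕ} {θ : Finset ℕ} (g : PSL(d, K)) (x : Flag K d θ) :
    Fin d → ℝ :=
  Classical.epsilon (IsIwasawa g x)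

/-- `μ` is a `φ`-Patterson–Sullivan measure for `Γ` on `Λ_θ(Γ)`, of dimension `δ^φ(Γ) < ∞`, where
`φ` is a combination of the fundamental weights `ω_k`, `k ∈ θ`. -/
def IsPattersonSullivan {K : Type*} [RCLike K] {d : ℕ} (θ : Finset ℕ)
    (φ : (Fin d → ℝ) →ₗ[ℝ] ℝ) (Γ : Subgroup PSL(d, K)) (μ : Measure (Flag K d θ)) : Prop :=
  critExp φ Γ ≠ ⊤ ∧ IsProbabilityMeasure μ ∧ (∀ᵐ x ∂μ, x ∈ limitSet θ Γ) ∧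
  ∀ γ ∈ Γ, (μ.map (Flag.act γ) ≪ μ) ∧ (μ ≪ μ.map (Flag.act γ)) ∧
    (μ.map (Flag.act γ)).rnDeriv μ =ᵐ[μ] fun x =>
      ENNReal.ofReal (Real.exp (-((critExp φ Γ).toReal * φ (iwasawa γ⁻¹ x))))

/-- `μ` is a `φ`-Patterson–Sullivan measure for `Γ` on `Λ_k(Γ)`: the push-forward of one on
`Λ_θ(Γ)` under the forgetful map `F_θ → Gr_k`, where `k ∈ θ`. -/
def IsPattersonSullivanGr {K : Type*} [RCLike K] {d : ℕ} (θ : Finset ℕ) (k : ℕ)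
    (φ : (Fin d → ℝ) →ₗ[ℝ] ℝ) (Γ : Subgroup PSL(d, K)) (μ : Measure (Gr K d k)) : Prop :=
  ∃ hk : k ∈ θ, ∃ μ' : Measure (Flag K d θ),
    IsPattersonSullivan θ φ Γ μ' ∧ μ = μ'.map fun x => x.proj ⟨k, hk⟩

/-- `μ` is an `α_k`-Patterson–Sullivan measure for `Γ` on `Λ_k(Γ)`. The root
`α_k = 2 ω_k - ω_{k-1} - ω_{k+1}` is a combination of the `ω_j` with `j ∈ θ_k`. -/
def IsRootPattersonSullivan {K : Type*} [RCLike K] {d : ℕ} (k : ℕ) (Γ : Subgroup PSL(d, K))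
    (μ : Measure (Gr K d k)) : Prop :=
  IsPattersonSullivanGr (theta d k) k (simpleRoot d k) Γ μ

/-! ### Exterior powers -/

/-- Increasing `k`-tuples in `Fin d`, in lexicographic order. -/
abbrev IncTuple (d k : ℕ) : Type := {f : Lex (Fin k → Fin d) // StrictMono (ofLex f)}

/-- Increasing `k`-tuples in `Fin d` are the same as `k`-element subsets. -/
def incTupleEquiv (d k : ℕ) : IncTuple d k ≃ Set.powersetCard (Fin d) k :=
  (show IncTuple d k ≃ (Fin k ↪o Fin d) from
    { toFun := fun f => OrderEmbedding.ofStrictMono (ofLex f.1) f.2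
      invFun := fun f => ⟨toLex f, f.strictMono⟩
      left_inv := fun _ => rfl
      right_inv := fun _ => rfl }).trans Set.powersetCard.ofFinEmbEquiv

instance (d k : ℕ) : Finite (IncTuple d k) := Finite.of_equiv _ (incTupleEquiv d k).symm

instance (d k : ℕ) : Fintype (IncTuple d k) := Fintype.ofFinite _

theorem card_incTuple (d k : ℕ) : Fintype.card (IncTuple d k) = d.choose k := by
  rw [← Nat.card_eq_fintype_card, Nat.card_congr (incTupleEquiv d k), Set.powersetCard.card,
    Nat.card_eq_fintype_card, Fintype.card_fin]

/-- The lexicographic enumeration of the `k`-element subsets of `{1, …, d}`. -/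
def lexEnum (d k : ℕ) : Fin (d.choose k) ≃ Set.powersetCard (Fin d) k :=
  (Fintype.orderIsoFinOfCardEq (IncTuple d k) (card_incTuple d k)).toEquiv.trans
    (incTupleEquiv d k)

/-- The identification `⋀^k K^d = K^(d choose k)` through the basis `e_{i_1} ∧ ⋯ ∧ e_{i_k}`,
`i_1 < ⋯ < i_k`, in lexicographic order. -/
def wedgeCoord (K : Type*) [RCLike K] (d k : ℕ) :
    (⋀[K]^k (Vec K d)) ≃ₗ[K] Vec K (d.choose k) :=
  ((((EuclideanSpace.basisFun (Fin d) K).toBasis.exteriorPower k).reindex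
    (lexEnum d k).symm).equivFun).trans (WithLp.linearEquiv 2 K (Fin (d.choose k) → K)).symm

/-- `η : PSL(d, K) → PSL(d choose k, K)` is induced by the `k`-th exterior power
`v_1 ∧ ⋯ ∧ v_k ↦ g v_1 ∧ ⋯ ∧ g v_k`. -/
def IsExteriorPowerRep {K : Type*} [RCLike K] {d k : ℕ} (η : PSL(d, K) →* PSL(d.choose k, K)) :
    Prop :=
  ∀ g : SL(d, K), ∃ h : SL(d.choose k, K), η (g : PSL(d, K)) = (h : PSL(d.choose k, K)) ∧
    ∀ w : ⋀[K]^k (Vec K d), slEquiv h (wedgeCoord K d k w) =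
      wedgeCoord K d k (exteriorPower.map k (slEquiv g).toLinearMap w)

/-- `E : Gr_k(K^d) → P(⋀^k K^d) = P(K^(d choose k))` is the Plücker map
`⟨v_1, …, v_k⟩ ↦ [v_1 ∧ ⋯ ∧ v_k]`. -/
def IsPluckerMap {K : Type*} [RCLike K] {d k : ℕ} (E : Gr K d k → Gr K (d.choose k) 1) : Prop :=
  ∀ (W : Gr K d k) (v : Fin k → Vec K d), LinearIndependent K v →
    Submodule.span K (Set.range v) = W.carrier →
    (E W).carrier = Submodule.span K {wedgeCoord K d k (exteriorPower.ιMulti K k v)}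

end HyperconvexWedge

end

open HyperconvexWedge

namespace HyperconvexWedge

open Matrix

variable {K : Type*} [RCLike K] {d k j : ℕ} {θ θ' : Finset ℕ}

/-! ### The action of matrices on `K^d` -/

/-! In the lexicographic basis, `⋀^k g` is the `compound` matrix of `k × k` minors of `g`. Compounds
of unitary, positive diagonal and unitriangular matrices are again of these kinds, so singular value
and Iwasawa decompositions of `g` pass to `⋀^k g`, the exponents becoming sums over `k`-tuples. For
decreasing `A`, the two largest sums are `A_1 + ⋯ + A_k` and `A_1 + ⋯ + A_{k-1} + A_{k+1}`. They
differ by `α_k`, which gives `simpleRoot_one_compoundPSL`.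

The bridge between the two groups is the map of flags `g F_0 ↦ (⋀^k g) F_0` (`wedgeFlag`). It is
well defined when the compound of a matrix that is block triangular for `θ` is block triangular for
`θ'`. Put `D = d choose k`, so that `θ_1 = {1, 2, D-2, D-1}` in dimension `D`. The first two tuples
differ only in their last entry, the last two only in their first, and `θ_k` contains exactly the
dimensions needed to separate them from the remaining tuples (`subordinate_theta`). Conversely,
block triangularity of `⋀^k p` for `θ_1` forces that of `p` for `θ_k` (`block_of_compound`). By
compactness `thetaFlag` is therefore an equivariant closed embedding, and its line component is the
Plücker map.

This embedding carries Cartan flags to Cartan flags. As `η` is injective, sequences of distinct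
elements correspond on both sides, so limit sets correspond (`limitSet_map_compoundPSL`) and
Poincaré series agree term by term (`critExp_map`). Conical points are transported by equivariance.
Transversality is a statement about vanishing minors, in a frame adapted to a pair of opposite flags
(`Flag.Transverse.wedgeFlag`).

For hyperconvexity in dimension `D`, take a frame adapted to `x` and `z`. The second coordinate of
`⋀^k K^d` kills the line of `x` and the space `z^{D-2}`, so it suffices that it does not kill the
line of `y`. That coordinate is the minor with rows `1, …, k-1, k+1`. If it vanished, `y^k` would
contain a nonzero vector which the hyperconvexity condition for `Γ` places in `z^{d-k-1}`, against
transversality of `y` and `z` (`compound_second_ne_zero`).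

For measures, `α_k = 2ω_k - ω_{k-1} - ω_{k+1}`, and each `ω_j` of the Iwasawa cocycle is the
logarithm of a norm on `⋀^j`. So the density depends only on the `θ_k`-flag and agrees with the one
in dimension `D` (`simpleRoot_iwasawa_thetaFlag`). Pushing forward along the embedding gives one
direction of the correspondence, and pulling back gives the other because the measures live on the
limit set. -/

theorem slEquiv_eq_toLp (g : SL(d, K)) (v : Vec K d) :
    slEquiv g v = WithLp.toLp 2 ((g : Matrix (Fin d) (Fin d) K) *ᵥ v.ofLp) := rfl

theorem slEquiv_apply_apply (g : SL(d, K)) (v : Vec K d) (i : Fin d) :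
    slEquiv g v i = ∑ j, (g : Matrix (Fin d) (Fin d) K) i j * v j := rfl

theorem slEquiv_single (g : SL(d, K)) (j i : Fin d) :
    slEquiv g (EuclideanSpace.single j (1 : K)) i = (g : Matrix (Fin d) (Fin d) K) i j := by
  rw [slEquiv_apply_apply]
  simp

theorem slEquiv_mul (g h : SL(d, K)) (v : Vec K d) :
    slEquiv (g * h) v = slEquiv g (slEquiv h v) := by
  simp [slEquiv_eq_toLp, Matrix.mulVec_mulVec]

@[simp]
theorem slEquiv_one (v : Vec K d) : slEquiv (1 : SL(d, K)) v = v := by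
  simp [slEquiv_eq_toLp]

theorem slEquiv_inv_apply_self (g : SL(d, K)) (v : Vec K d) : slEquiv g⁻¹ (slEquiv g v) = v := by
  rw [← slEquiv_mul]; simp

theorem slEquiv_apply_inv_self (g : SL(d, K)) (v : Vec K d) : slEquiv g (slEquiv g⁻¹ v) = v := by
  rw [← slEquiv_mul]; simp

theorem slEquiv_eq_toEuclideanLin (g : SL(d, K)) :
    (slEquiv g).toLinearMap = Matrix.toEuclideanLin (g : Matrix (Fin d) (Fin d) K) := rfl

theorem map_slEquiv_mul (g h : SL(d, K)) (W : Submodule K (Vec K d)) :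
    W.map (slEquiv (g * h)).toLinearMap =
      (W.map (slEquiv h).toLinearMap).map (slEquiv g).toLinearMap := by
  rw [← Submodule.map_comp]
  congr 1
  ext1 v
  exact slEquiv_mul g h v

@[simp]
theorem map_slEquiv_one (W : Submodule K (Vec K d)) :
    W.map (slEquiv (1 : SL(d, K))).toLinearMap = W := by
  convert Submodule.map_id W
  ext1 v
  simp

/-! ### Increasing tuples in lexicographic order -/

/-- The `I`-th increasing `k`-tuple in `Fin d`, in lexicographic order. -/
noncomputable def tuple (d k : ℕ) (I : Fin (d.choose k)) : Fin k ↪o Fin d :=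
  Set.powersetCard.ofFinEmbEquiv.symm (lexEnum d k I)

/-- The enumeration of increasing tuples as a bijection. -/
noncomputable def tupleEquiv (d k : ℕ) : Fin (d.choose k) ≃ (Fin k ↪o Fin d) :=
  (lexEnum d k).trans Set.powersetCard.ofFinEmbEquiv.symm

theorem tuple_injective : Function.Injective (tuple d k) := (tupleEquiv d k).injective

theorem exists_tuple_eq (f : Fin k ↪o Fin d) : ∃ I, tuple d k I = f := (tupleEquiv d k).surjective f

/-- The enumeration is an order isomorphism onto increasing tuples, so comparing indices means
comparing the first differing entries. Later arguments about the order of the basis go through this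
criterion. -/
theorem tuple_lt_iff (I J : Fin (d.choose k)) :
    I < J ↔ ∃ s, (∀ t, t < s → tuple d k I t = tuple d k J t) ∧ tuple d k I s < tuple d k J s := by
  have h : ∀ I, toLex (⇑(tuple d k I)) =
      (Fintype.orderIsoFinOfCardEq (IncTuple d k) (card_incTuple d k) I).1 := by
    intro I
    simp only [tuple, lexEnum, incTupleEquiv, Equiv.trans_apply]
    simp only [Equiv.symm_apply_apply]
    rfl
  rw [← (Fintype.orderIsoFinOfCardEq (IncTuple d k) (card_incTuple d k)).lt_iff_lt,
    ← Subtype.coe_lt_coe, ← h, ← h]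
  rfl

/-! ### Coordinates of decomposable vectors -/

/-- The coordinates of `v_1 ∧ ⋯ ∧ v_k`. -/
noncomputable def wedge (v : Fin k → Vec K d) : Vec K (d.choose k) :=
  wedgeCoord K d k (exteriorPower.ιMulti K k v)

theorem wedgeCoord_apply (w : ⋀[K]^k (Vec K d)) (I : Fin (d.choose k)) :
    wedgeCoord K d k w I =
      ((EuclideanSpace.basisFun (Fin d) K).toBasis.exteriorPower k).repr w (lexEnum d k I) := by
  simp only [wedgeCoord, LinearEquiv.trans_apply]
  rw [Module.Basis.equivFun_apply]
  exact Module.Basis.repr_reindex_apply _ _ _ _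

theorem wedge_apply (v : Fin k → Vec K d) (I : Fin (d.choose k)) :
    wedge v I = Matrix.det (Matrix.of fun a b => v b (tuple d k I a)) := by
  rw [wedge, wedgeCoord_apply, exteriorPower.basis_repr_apply,
    exteriorPower.ιMultiDual_apply_ιMulti, ← Matrix.det_transpose]
  rfl

theorem wedge_single (J : Fin (d.choose k)) :
    wedge (fun a => EuclideanSpace.single (tuple d k J a) (1 : K)) =
      EuclideanSpace.single J (1 : K) := by
  have h : exteriorPower.ιMulti K k (fun a => EuclideanSpace.single (tuple d k J a) (1 : K)) =
      exteriorPower.ιMulti_family K k (EuclideanSpace.basisFun (Fin d) K).toBasis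
        (lexEnum d k J) := by
    rw [exteriorPower.ιMulti_family]
    congr 1
    ext a : 1
    simp [tuple]
  ext I
  rw [wedge, wedgeCoord_apply, h, exteriorPower.basis_repr, Finsupp.single_apply]
  simp [eq_comm]

/-- The matrix of `k × k` minors of a square matrix. -/
noncomputable def compound (k : ℕ) (M : Matrix (Fin d) (Fin d) K) :
    Matrix (Fin (d.choose k)) (Fin (d.choose k)) K :=
  Matrix.of fun I J => (M.submatrix (tuple d k I) (tuple d k J)).det

theorem compound_apply (M : Matrix (Fin d) (Fin d) K) (I J : Fin (d.choose k)) :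
    compound k M I J = (M.submatrix (tuple d k I) (tuple d k J)).det := rfl

theorem wedgeCoord_map (M : Matrix (Fin d) (Fin d) K) (w : ⋀[K]^k (Vec K d)) :
    wedgeCoord K d k (exteriorPower.map k (Matrix.toEuclideanLin M) w) =
      Matrix.toEuclideanLin (compound k M) (wedgeCoord K d k w) := by
  have key : (wedgeCoord K d k).toLinearMap ∘ₗ exteriorPower.map k (Matrix.toEuclideanLin M) ∘ₗ
      (wedgeCoord K d k).symm.toLinearMap = Matrix.toEuclideanLin (compound k M) := by
    refine (EuclideanSpace.basisFun _ K).toBasis.ext fun J => ?_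
    have h1 : (wedgeCoord K d k).symm (EuclideanSpace.single J (1 : K)) =
        exteriorPower.ιMulti K k (fun a => EuclideanSpace.single (tuple d k J a) (1 : K)) := by
      rw [LinearEquiv.symm_apply_eq, ← wedge_single]; rfl
    simp only [OrthonormalBasis.coe_toBasis, EuclideanSpace.basisFun_apply, LinearMap.comp_apply,
      LinearEquiv.coe_coe, h1, exteriorPower.map_apply_ιMulti]
    ext I
    refine (wedge_apply _ I).trans ?_
    simp [Matrix.toLpLin_apply, compound_apply, Matrix.submatrix, Matrix.mulVec_single]
  rw [← key]
  simp

theorem wedge_toEuclideanLin (M : Matrix (Fin d) (Fin d) K) (v : Fin k → Vec K d) :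
    wedge (fun a => Matrix.toEuclideanLin M (v a)) =
      Matrix.toEuclideanLin (compound k M) (wedge v) := by
  rw [wedge, wedge, ← wedgeCoord_map, exteriorPower.map_apply_ιMulti]
  rfl

/-- Cauchy–Binet, obtained from functoriality of the exterior power rather than by expanding minors.
-/
theorem compound_mul (M N : Matrix (Fin d) (Fin d) K) :
    compound k (M * N) = compound k M * compound k N := by
  apply Matrix.toEuclideanLin.injective
  refine LinearMap.ext fun w => ?_
  obtain ⟨w, rfl⟩ := (wedgeCoord K d k).surjective w
  have h : ∀ (n : ℕ) (A B : Matrix (Fin n) (Fin n) K), Matrix.toEuclideanLin (A * B) =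
      Matrix.toEuclideanLin A ∘ₗ Matrix.toEuclideanLin B := fun n A B =>
    Matrix.toLpLin_mul_same 2 A B
  rw [← wedgeCoord_map, h, h, LinearMap.comp_apply, ← wedgeCoord_map, ← wedgeCoord_map,
    exteriorPower.map_comp]
  rfl

theorem compound_transpose (M : Matrix (Fin d) (Fin d) K) :
    compound k Mᵀ = (compound k M)ᵀ := by
  ext I J
  simp only [compound_apply, Matrix.transpose_apply]
  rw [← Matrix.det_transpose]
  rfl

theorem compound_conjTranspose (M : Matrix (Fin d) (Fin d) K) :
    compound k Mᴴ = (compound k M)ᴴ := by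
  ext I J
  simp only [compound_apply, Matrix.conjTranspose_apply]
  rw [← Matrix.det_conjTranspose]
  rfl

theorem compound_diagonal (a : Fin d → K) :
    compound k (Matrix.diagonal a) = Matrix.diagonal fun I => ∏ s, a (tuple d k I s) := by
  apply Matrix.toEuclideanLin.injective
  refine (EuclideanSpace.basisFun _ K).toBasis.ext fun J => ?_
  simp only [OrthonormalBasis.coe_toBasis, EuclideanSpace.basisFun_apply]
  rw [← wedge_single, ← wedge_toEuclideanLin]
  have : (fun b => Matrix.toEuclideanLin (Matrix.diagonal a)
      (EuclideanSpace.single (tuple d k J b) (1 : K))) =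
      fun b => a (tuple d k J b) • EuclideanSpace.single (tuple d k J b) (1 : K) := by
    ext b i
    simp [Matrix.toLpLin_apply]
  rw [this, wedge, AlternatingMap.map_smul_univ, map_smul, ← wedge, wedge_single]
  ext i
  simp [Matrix.toLpLin_apply]

@[simp]
theorem compound_one : compound k (1 : Matrix (Fin d) (Fin d) K) = 1 := by
  rw [← Matrix.diagonal_one, compound_diagonal]
  simp

/-! ### Vanishing and evaluation of minors -/

/-- Pigeonhole in the Leibniz expansion: a nonvanishing term would inject the `s + 1` columns up to
`s` into the `s` rows before `s`. -/
theorem det_eq_zero_of_lower_left_block (N : Matrix (Fin k) (Fin k) K) (s : Fin k)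
    (h : ∀ a b, s ≤ a → b ≤ s → N a b = 0) : N.det = 0 := by
  rw [Matrix.det_apply]
  refine Finset.sum_eq_zero fun σ _ => ?_
  have hex : ∃ b, b ≤ s ∧ s ≤ σ b := by
    by_contra! hcon
    have hc := Finset.card_le_card_of_injOn σ (s := Finset.Iic s) (t := Finset.Iio s)
      (fun b hb => by simpa using hcon b (by simpa using hb)) σ.injective.injOn
    simp at hc
  obtain ⟨b, hb, hb'⟩ := hex
  have h0 : ∏ i, N (σ i) i = 0 := Finset.prod_eq_zero (Finset.mem_univ b) (h _ _ hb' hb)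
  rw [h0, smul_zero]

theorem det_eq_zero_of_upper_left_block (N : Matrix (Fin k) (Fin k) K) (s : Fin k)
    (h : ∀ a b, a ≤ s → b ≤ s.rev → N a b = 0) : N.det = 0 := by
  have h2 : (N.submatrix (Fin.revPerm : Equiv.Perm (Fin k)) id).det = 0 := by
    refine det_eq_zero_of_lower_left_block _ s.rev fun a b ha hb => ?_
    exact h _ _ (by simpa using Fin.rev_le_rev.2 ha) hb
  rw [Matrix.det_permute] at h2
  rcases mul_eq_zero.1 h2 with h3 | h3
  · rcases Int.units_eq_one_or (Equiv.Perm.sign (Fin.revPerm : Equiv.Perm (Fin k))) with h4 | h4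
      <;> simp [h4] at h3
  · exact h3

/-- Where the tuples first differ, `J` has the smaller entry. By monotonicity the rows from there on
lie strictly below the columns up to there, which is a zero block too large for the minor. This is
why the lexicographic order preserves triangularity. -/
theorem compound_eq_zero_of_lt {M : Matrix (Fin d) (Fin d) K} (hM : ∀ i j, j < i → M i j = 0)
    {I J : Fin (d.choose k)} (h : J < I) : compound k M I J = 0 := by
  obtain ⟨s, -, hs⟩ := (tuple_lt_iff J I).1 h
  refine det_eq_zero_of_lower_left_block _ s fun a b ha hb => hM _ _ ?_
  exact ((tuple d k J).monotone hb).trans_lt (hs.trans_le ((tuple d k I).monotone ha))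

theorem compound_diag {M : Matrix (Fin d) (Fin d) K} (hM : ∀ i j, j < i → M i j = 0)
    (I : Fin (d.choose k)) : compound k M I I = ∏ s, M (tuple d k I s) (tuple d k I s) := by
  rw [compound_apply, Matrix.det_of_isUpperTriangular]
  · rfl
  · intro a b hab
    exact hM _ _ ((tuple d k I).strictMono hab)

theorem prod_tuple {M : Type*} [CommMonoid M] (a : Fin d → M) (I : Fin (d.choose k)) :
    ∏ s, a (tuple d k I s) = ∏ i ∈ (lexEnum d k I : Finset (Fin d)), a i := by
  have : (lexEnum d k I : Finset (Fin d)) = Finset.univ.map (tuple d k I).toEmbedding := by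
    ext i
    rw [Set.powersetCard.mem_coe_iff, ← Set.powersetCard.mem_range_ofFinEmbEquiv_symm_iff_mem]
    simp [tuple]
  rw [this, Finset.prod_map]
  rfl

/-- Double counting: each index lies in `(d - 1).choose (k - 1)` subsets of size `k`. -/
theorem prod_prod_tuple {M : Type*} [CommMonoid M] (hk : 1 ≤ k) (a : Fin d → M) :
    ∏ I, ∏ s, a (tuple d k I s) = (∏ i, a i) ^ (d - 1).choose (k - 1) := by
  simp_rw [prod_tuple]
  rw [(lexEnum d k).prod_comp (fun S : Set.powersetCard (Fin d) k => ∏ i ∈ (S : Finset (Fin d)), a i)]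
  have h1 : ∏ S : Set.powersetCard (Fin d) k, ∏ i ∈ (S : Finset (Fin d)), a i =
      ∏ S ∈ Finset.powersetCard k (Finset.univ : Finset (Fin d)), ∏ i ∈ S, a i := by
    refine Finset.prod_bij (fun S _ => (S : Finset (Fin d))) ?_ ?_ ?_ ?_
    · intro S _; simp
    · intro S _ T _ h; exact Subtype.ext h
    · intro S hS; exact ⟨⟨S, by simpa using hS⟩, Finset.mem_univ _, rfl⟩
    · intro S _; rfl
  rw [h1, Finset.prod_comm' (t' := Finset.univ)
    (s' := fun i => (Finset.powersetCard k Finset.univ).filter ({i} ⊆ ·))]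
  · rw [← Finset.prod_pow]
    refine Finset.prod_congr rfl fun i _ => ?_
    rw [Finset.prod_const, Finset.card_filter_powersetCard_subset _ _ _ (Finset.subset_univ _)]
    · simp
    · simpa using hk
  · intro S i
    simp

theorem det_compound_of_upper {M : Matrix (Fin d) (Fin d) K} (hM : ∀ i j, j < i → M i j = 0)
    (h1 : ∀ i, M i i = 1) : (compound k M).det = 1 := by
  rw [Matrix.det_of_isUpperTriangular]
  · simp [compound_diag hM, h1]
  · intro I J hIJ
    exact compound_eq_zero_of_lt hM hIJ

/-- The Sylvester–Franke identity. Both sides are multiplicative, so diagonal matrices and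
transvections suffice. A transvection is unitriangular, possibly after transposing, and then so is
its compound. -/
theorem det_compound (hk : 1 ≤ k) (M : Matrix (Fin d) (Fin d) K) :
    (compound k M).det = M.det ^ (d - 1).choose (k - 1) := by
  refine Matrix.diagonal_transvection_induction
    (fun M => (compound k M).det = M.det ^ (d - 1).choose (k - 1)) M ?_ ?_ ?_
  · intro a _
    rw [compound_diagonal, Matrix.det_diagonal, Matrix.det_diagonal, prod_prod_tuple hk]
  · rintro ⟨i, j, hij, c⟩
    rw [TransvectionStruct.det, one_pow, TransvectionStruct.toMatrix_mk]
    rcases lt_or_gt_of_ne hij with h | h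
    · refine det_compound_of_upper ?_ ?_
      · intro a b hab
        rw [transvection, Matrix.add_apply, Matrix.one_apply_ne hab.ne', zero_add,
          Matrix.single_apply_of_ne]
        rintro ⟨rfl, rfl⟩
        exact absurd h hab.not_gt
      · intro a
        rw [transvection, Matrix.add_apply, Matrix.one_apply_eq, Matrix.single_apply_of_ne,
          add_zero]
        rintro ⟨rfl, rfl⟩
        exact hij rfl
    · rw [← Matrix.det_transpose, ← compound_transpose]
      refine det_compound_of_upper ?_ ?_
      · intro a b hab
        rw [Matrix.transpose_apply, transvection, Matrix.add_apply, Matrix.one_apply_ne hab.ne,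
          zero_add, Matrix.single_apply_of_ne]
        rintro ⟨rfl, rfl⟩
        exact absurd h hab.not_gt
      · intro a
        rw [Matrix.transpose_apply, transvection, Matrix.add_apply, Matrix.one_apply_eq,
          Matrix.single_apply_of_ne, add_zero]
        rintro ⟨rfl, rfl⟩
        exact hij rfl
  · intro A B hA hB
    rw [compound_mul, Matrix.det_mul, Matrix.det_mul, mul_pow, hA, hB]

/-- The `k`-th exterior power as a homomorphism of special linear groups. -/
noncomputable def compoundSL (hk : 1 ≤ k) : SL(d, K) →* SL(d.choose k, K) where
  toFun g := ⟨compound k g, by rw [det_compound hk, g.2, one_pow]⟩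
  map_one' := Subtype.ext compound_one
  map_mul' g h := Subtype.ext (compound_mul _ _)

@[simp]
theorem coe_compoundSL (hk : 1 ≤ k) (g : SL(d, K)) :
    (compoundSL hk g : Matrix _ _ K) = compound k (g : Matrix (Fin d) (Fin d) K) := rfl

theorem slEquiv_compoundSL (hk : 1 ≤ k) (g : SL(d, K)) (w : ⋀[K]^k (Vec K d)) :
    slEquiv (compoundSL hk g) (wedgeCoord K d k w) =
      wedgeCoord K d k (exteriorPower.map k (slEquiv g).toLinearMap w) :=
  (wedgeCoord_map (g : Matrix (Fin d) (Fin d) K) w).symm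

theorem slEquiv_compoundSL_wedge (hk : 1 ≤ k) (g : SL(d, K)) (v : Fin k → Vec K d) :
    slEquiv (compoundSL hk g) (wedge v) = wedge fun a => slEquiv g (v a) :=
  (wedge_toEuclideanLin (g : Matrix (Fin d) (Fin d) K) v).symm

theorem continuous_compoundSL (hk : 1 ≤ k) :
    Continuous (compoundSL hk : SL(d, K) → SL(d.choose k, K)) := by
  refine Continuous.subtype_mk ?_ _
  refine continuous_matrix fun I J => ?_
  exact (continuous_subtype_val.matrix_submatrix _ _).matrix_det

theorem isSU_compoundSL (hk : 1 ≤ k) {m : SL(d, K)} (hm : IsSU m) : IsSU (compoundSL hk m) := by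
  rw [IsSU, Matrix.mem_unitaryGroup_iff] at hm ⊢
  rw [coe_compoundSL, Matrix.star_eq_conjTranspose, ← compound_conjTranspose, ← compound_mul,
    ← Matrix.star_eq_conjTranspose, hm, compound_one]

theorem isUpperUnipotent_compoundSL (hk : 1 ≤ k) {n : SL(d, K)} (hn : IsUpperUnipotent n) :
    IsUpperUnipotent (compoundSL hk n) :=
  ⟨fun I => by simp [compound_diag hn.2, hn.1], fun _ _ h => compound_eq_zero_of_lt hn.2 h⟩

/-- The sums of `k`-tuples of entries, in lexicographic order of the tuples. -/
noncomputable def tupleSum (k : ℕ) (A : Fin d → ℝ) : Fin (d.choose k) → ℝ :=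
  fun I => ∑ s, A (tuple d k I s)

theorem compound_expDiag (A : Fin d → ℝ) :
    compound k (expDiag K A) = expDiag K (tupleSum k A) := by
  rw [expDiag, compound_diagonal, expDiag]
  congr 1
  ext I
  rw [tupleSum, Real.exp_sum]
  push_cast
  rfl

/-! ### The first and the last tuples -/

theorem le_tuple (I : Fin (d.choose k)) (s : Fin k) : (s : ℕ) ≤ tuple d k I s := by
  obtain ⟨s, hs⟩ := s
  induction s with
  | zero => simp
  | succ s ih =>
    have h1 := ih (by omega)
    have h2 : tuple d k I ⟨s, by omega⟩ < tuple d k I ⟨s + 1, hs⟩ :=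
      (tuple d k I).strictMono (by simp)
    simp only [Fin.lt_def] at h1 h2 ⊢
    omega

theorem tuple_add_le (I : Fin (d.choose k)) {s t : Fin k} (h : s ≤ t) :
    (tuple d k I s : ℕ) + (t - s) ≤ tuple d k I t := by
  obtain ⟨t, ht⟩ := t
  induction t with
  | zero =>
    have : s = ⟨0, ht⟩ := Fin.ext (by simpa [Fin.le_def] using h)
    subst this; simp
  | succ t ih =>
    rcases h.eq_or_lt with rfl | h
    · simp
    · have h1 := ih (by omega) (by simp [Fin.le_def, Fin.lt_def] at h ⊢; omega)
      have h2 : tuple d k I ⟨t, by omega⟩ < tuple d k I ⟨t + 1, ht⟩ :=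
        (tuple d k I).strictMono (by simp)
      simp only [Fin.lt_def] at h h1 h2 ⊢
      omega

theorem tuple_le (I : Fin (d.choose k)) (s : Fin k) : (tuple d k I s : ℕ) + k ≤ d + s := by
  have hs := s.2
  have h1 := tuple_add_le I (s := s) (t := ⟨k - 1, by omega⟩) (Fin.le_def.2 (by simp only; omega))
  have h2 := (tuple d k I ⟨k - 1, by omega⟩).2
  simp only at h1
  omega

theorem exists_tuple_coe_eq (f : Fin k → ℕ) (hf : StrictMono f) (hd : ∀ s, f s < d) :
    ∃ I, ∀ s, (tuple d k I s : ℕ) = f s := by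
  obtain ⟨I, hI⟩ := exists_tuple_eq (OrderEmbedding.ofStrictMono (fun s => (⟨f s, hd s⟩ : Fin d))
    (fun a b h => hf h))
  exact ⟨I, fun s => by rw [hI]; rfl⟩

theorem tuple_eq_of_coe_eq {I J : Fin (d.choose k)}
    (h : ∀ s, (tuple d k I s : ℕ) = tuple d k J s) : I = J :=
  tuple_injective (DFunLike.ext _ _ fun s => Fin.ext (h s))

/-- The first tuple is `(0, …, k - 1)`. -/
theorem lt_one_iff_tuple (hkd : k < d) (I : Fin (d.choose k)) :
    (I : ℕ) < 1 ↔ ∀ s, (tuple d k I s : ℕ) = s := by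
  obtain ⟨I₁, h₁⟩ := exists_tuple_coe_eq (d := d) (fun s : Fin k => (s : ℕ)) (fun _ _ h => h)
    (fun s => by omega)
  have hmin : ∀ J, ¬ J < I₁ := by
    intro J hJ
    obtain ⟨s, -, hs⟩ := (tuple_lt_iff _ _).1 hJ
    have := le_tuple J s
    rw [Fin.lt_def, h₁] at hs
    omega
  have h0 : (I₁ : ℕ) = 0 := by
    by_contra h
    exact hmin ⟨0, by omega⟩ (by rw [Fin.lt_def]; simp only; omega)
  constructor
  · intro h
    have : I = I₁ := Fin.ext (by omega)
    rw [this]; exact h₁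
  · intro h
    have : I = I₁ := tuple_eq_of_coe_eq fun s => by rw [h, h₁]
    rw [this]; omega

/-- The first two tuples are `(0, …, k - 2, k - 1)` and `(0, …, k - 2, k)`. -/
theorem lt_two_iff_tuple (hk : 1 ≤ k) (hkd : k < d) (I : Fin (d.choose k)) :
    (I : ℕ) < 2 ↔ (∀ s, (tuple d k I s : ℕ) = s) ∨
      ∀ s : Fin k, (tuple d k I s : ℕ) = if (s : ℕ) + 1 = k then k else s := by
  obtain ⟨I₁, h₁⟩ := exists_tuple_coe_eq (d := d) (fun s : Fin k => (s : ℕ)) (fun _ _ h => h)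
    (fun s => by omega)
  obtain ⟨I₂, h₂⟩ := exists_tuple_coe_eq (d := d)
    (fun s : Fin k => if (s : ℕ) + 1 = k then k else (s : ℕ))
    (fun a b h => by simp only [Fin.lt_def] at h ⊢; split_ifs <;> omega)
    (fun s => by split_ifs <;> omega)
  have h0 : (I₁ : ℕ) = 0 := by
    have := (lt_one_iff_tuple hkd I₁).2 h₁
    omega
  have h12 : I₁ < I₂ := by
    rw [tuple_lt_iff]
    refine ⟨⟨k - 1, by omega⟩, fun t ht => ?_, ?_⟩
    · apply Fin.ext
      rw [Fin.lt_def] at ht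
      rw [h₁, h₂, if_neg]
      simp only at ht
      omega
    · rw [Fin.lt_def, h₁, h₂, if_pos]
      · simp only; omega
      · simp only; omega
  -- All entries of `I₂` except the last are as small as possible, so an earlier tuple first differs
  -- in the last slot, where only `k - 1` is left.
  have hmin : ∀ J, J < I₂ → J = I₁ := by
    intro J hJ
    obtain ⟨s, hs', hs⟩ := (tuple_lt_iff _ _).1 hJ
    have h3 := le_tuple J s
    rw [Fin.lt_def, h₂] at hs
    split_ifs at hs with h4
    · refine tuple_eq_of_coe_eq fun t => ?_
      rw [h₁]
      by_cases ht : t < s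
      · rw [hs' t ht, h₂, if_neg]
        rw [Fin.lt_def] at ht
        omega
      · have : t = s := Fin.ext (by rw [Fin.lt_def] at ht; omega)
        rw [this]
        omega
    · omega
  have h1 : (I₂ : ℕ) = 1 := by
    rw [Fin.lt_def] at h12
    by_contra h
    have := hmin ⟨1, by omega⟩ (by rw [Fin.lt_def]; simp only; omega)
    rw [← this] at h0
    simp at h0
  constructor
  · intro h
    rcases (by omega : (I : ℕ) = 0 ∨ (I : ℕ) = 1) with h | h
    · left
      have : I = I₁ := Fin.ext (by omega)
      rw [this]; exact h₁
    · right
      have : I = I₂ := Fin.ext (by omega)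
      rw [this]; exact h₂
  · rintro (h | h)
    · have : I = I₁ := tuple_eq_of_coe_eq fun s => by rw [h, h₁]
      rw [this]; omega
    · have : I = I₂ := tuple_eq_of_coe_eq fun s => by rw [h, h₂]
      rw [this]; omega

/-- The last tuple is `(d - k, …, d - 1)`. -/
theorem last_iff_tuple (hkd : k < d) (I : Fin (d.choose k)) :
    d.choose k - 1 ≤ (I : ℕ) ↔ ∀ s, (tuple d k I s : ℕ) = d - k + s := by
  obtain ⟨I₁, h₁⟩ := exists_tuple_coe_eq (d := d) (fun s : Fin k => d - k + (s : ℕ))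
    (fun a b h => by simp only [Fin.lt_def] at h ⊢; omega) (fun s => by omega)
  have hmax : ∀ J, ¬ I₁ < J := by
    intro J hJ
    obtain ⟨s, -, hs⟩ := (tuple_lt_iff _ _).1 hJ
    have := tuple_le J s
    rw [Fin.lt_def, h₁] at hs
    omega
  have h0 : (I₁ : ℕ) = d.choose k - 1 := by
    by_contra h
    exact hmax ⟨d.choose k - 1, by omega⟩ (by rw [Fin.lt_def]; simp only; omega)
  constructor
  · intro h
    have : I = I₁ := Fin.ext (by omega)
    rw [this]; exact h₁
  · intro h
    have : I = I₁ := tuple_eq_of_coe_eq fun s => by rw [h, h₁]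
    rw [this]; omega

/-- The last two tuples are `(d - k - 1, d - k + 1, …, d - 1)` and
`(d - k, d - k + 1, …, d - 1)`. -/
theorem last_two_iff_tuple (hk : 1 ≤ k) (hkd : k < d) (I : Fin (d.choose k)) :
    d.choose k - 2 ≤ (I : ℕ) ↔ (∀ s, (tuple d k I s : ℕ) = d - k + s) ∨
      ∀ s : Fin k, (tuple d k I s : ℕ) = if (s : ℕ) = 0 then d - k - 1 else d - k + s := by
  obtain ⟨I₁, h₁⟩ := exists_tuple_coe_eq (d := d) (fun s : Fin k => d - k + (s : ℕ))
    (fun a b h => by simp only [Fin.lt_def] at h ⊢; omega) (fun s => by omega)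
  obtain ⟨I₂, h₂⟩ := exists_tuple_coe_eq (d := d)
    (fun s : Fin k => if (s : ℕ) = 0 then d - k - 1 else d - k + (s : ℕ))
    (fun a b h => by simp only [Fin.lt_def] at h ⊢; split_ifs <;> omega)
    (fun s => by split_ifs <;> omega)
  have h0 : (I₁ : ℕ) = d.choose k - 1 := by
    have := (last_iff_tuple hkd I₁).2 h₁
    omega
  have h12 : I₂ < I₁ := by
    rw [tuple_lt_iff]
    refine ⟨⟨0, by omega⟩, fun t ht => absurd ht (by simp [Fin.lt_def]), ?_⟩
    rw [Fin.lt_def, h₁, h₂, if_pos rfl]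
    simp only; omega
  -- Dually, all entries of `I₂` except the first are as large as possible, and a first entry `≥ d -
  -- k` forces the whole tuple.
  have hmax : ∀ J, I₂ < J → J = I₁ := by
    intro J hJ
    obtain ⟨s, hs', hs⟩ := (tuple_lt_iff _ _).1 hJ
    have h3 := tuple_le J s
    rw [Fin.lt_def, h₂] at hs
    split_ifs at hs with h4
    · refine tuple_eq_of_coe_eq fun t => ?_
      rw [h₁]
      have h5 := tuple_add_le J (s := s) (t := t) (by rw [Fin.le_def]; omega)
      have h6 := tuple_le J t
      omega
    · omega
  have h1 : (I₂ : ℕ) = d.choose k - 2 := by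
    rw [Fin.lt_def] at h12
    by_contra h
    have := hmax ⟨d.choose k - 2, by omega⟩ (by rw [Fin.lt_def]; simp only; omega)
    rw [← this] at h0
    simp only at h0
    omega
  have hlt := I.2
  have hlt₂ := I₂.2
  rw [Fin.lt_def] at h12
  constructor
  · intro h
    rcases (by omega : (I : ℕ) = d.choose k - 1 ∨ (I : ℕ) = d.choose k - 2) with h | h
    · left
      have : I = I₁ := Fin.ext (by omega)
      rw [this]; exact h₁
    · right
      have : I = I₂ := Fin.ext (by omega)
      rw [this]; exact h₂
  · rintro (h | h)
    · have : I = I₁ := tuple_eq_of_coe_eq fun s => by rw [h, h₁]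
      rw [this]; omega
    · have : I = I₂ := tuple_eq_of_coe_eq fun s => by rw [h, h₂]
      rw [this]; omega

/-! ### Compatible types of flags -/

/-- The span of the first `j` basis vectors of `⋀^k K^d` is determined by the subspaces `x^i`,
`i ∈ θ`, of a flag: each of the first `j` tuples precedes each of the others entrywise, and is
separated from it by an element of `θ`. -/
def Subordinate (d k : ℕ) (θ : Finset ℕ) (j : ℕ) : Prop :=
  ∀ I J : Fin (d.choose k), (I : ℕ) < j → j ≤ (J : ℕ) →
    (∀ s, tuple d k I s ≤ tuple d k J s) ∧
      ∃ s, ∃ i ∈ θ, (tuple d k I s : ℕ) < i ∧ i ≤ tuple d k J s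

/-- The combinatorial condition for a pair of `θ`-flags in opposite position to induce a
pair of opposite subspaces, of dimension `j` and codimension `j`, of `⋀^k K^d`. -/
def Opposable (d k : ℕ) (θ : Finset ℕ) (j : ℕ) : Prop :=
  ∀ I J : Fin (d.choose k), (I : ℕ) < j → (J : ℕ) < d.choose k - j →
    ∃ s : Fin k, ∃ i ∈ θ, (tuple d k I s.rev : ℕ) < i ∧ (tuple d k J s : ℕ) < d - i

theorem mem_theta {i : ℕ} : i ∈ theta d k ↔
    (i = k - 1 ∨ i = k ∨ i = k + 1 ∨ i = d - k - 1 ∨ i = d - k ∨ i = d - k + 1) ∧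
      1 ≤ i ∧ i ≤ d - 1 := by
  simp [theta]

theorem mem_theta_one {D j : ℕ} (hD : 2 ≤ D) : j ∈ theta D 1 ↔
    (j = 1 ∨ j = 2 ∨ j = D - 2 ∨ j = D - 1) ∧ 1 ≤ j ∧ j ≤ D - 1 := by
  rw [mem_theta]
  omega

theorem sub_mem_theta (hkd : k < d) {i : ℕ} (hi : i ∈ theta d k) :
    d - i ∈ theta d k := by
  rw [mem_theta] at hi ⊢
  omega

theorem two_le_choose (hk : 1 ≤ k) (hkd : k < d) : 2 ≤ d.choose k := by
  obtain ⟨d, rfl⟩ : ∃ e, d = e + 1 := ⟨d - 1, by omega⟩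
  obtain ⟨k, rfl⟩ : ∃ e, k = e + 1 := ⟨k - 1, by omega⟩
  rw [Nat.choose_succ_succ']
  have h1 := Nat.choose_pos (n := d) (k := k) (by omega)
  have h2 := Nat.choose_pos (n := d) (k := k + 1) (by omega)
  omega

theorem le_last_of_not_first (hk : 1 ≤ k) {J : Fin (d.choose k)}
    (h : ¬ ∀ s, (tuple d k J s : ℕ) = s) : k ≤ tuple d k J ⟨k - 1, by omega⟩ := by
  by_contra hcon
  refine h fun s => ?_
  have hs := s.2
  have h1 := tuple_add_le J (s := s) (t := ⟨k - 1, by omega⟩) (Fin.le_def.2 (by simp only; omega))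
  have h2 := le_tuple J s
  simp only at h1
  omega

theorem first_lt_of_not_last (hk : 1 ≤ k) {I : Fin (d.choose k)}
    (h : ¬ ∀ s, (tuple d k I s : ℕ) = d - k + s) :
    (tuple d k I ⟨0, by omega⟩ : ℕ) < d - k := by
  by_contra hcon
  refine h fun s => ?_
  have h1 := tuple_add_le I (s := ⟨0, by omega⟩) (t := s) (Fin.le_def.2 (by simp))
  have h2 := tuple_le I s
  simp only at h1
  omega

/-- A second entry `≥ d - k + 1` would force all later ones to be maximal. For `k = 1` the first
entry already determines the tuple, so `1 < k` comes as part of the conclusion and makes the second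
slot available. -/
theorem second_lt_of_not_last (hk : 1 ≤ k) {I : Fin (d.choose k)}
    (h : ¬ ∀ s : Fin k, (tuple d k I s : ℕ) = if (s : ℕ) = 0 then d - k - 1 else d - k + s)
    (h0 : (tuple d k I ⟨0, by omega⟩ : ℕ) = d - k - 1) :
    ∃ h2 : 1 < k, (tuple d k I ⟨1, h2⟩ : ℕ) < d - k + 1 := by
  rw [not_forall] at h
  obtain ⟨t, ht⟩ := h
  by_cases ht0 : (t : ℕ) = 0
  · rw [if_pos ht0] at ht
    have : t = ⟨0, by omega⟩ := Fin.ext ht0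
    rw [this] at ht
    exact absurd h0 ht
  · rw [if_neg ht0] at ht
    have h2 : 1 < k := by omega
    refine ⟨h2, ?_⟩
    have h1 := tuple_add_le I (s := ⟨1, by omega⟩) (t := t) (Fin.le_def.2 (by simp only; omega))
    have h3 := tuple_le I t
    simp only at h1
    omega

theorem le_penultimate_of_not_first (hk : 1 ≤ k) {J : Fin (d.choose k)}
    (h : ¬ ∀ s : Fin k, (tuple d k J s : ℕ) = if (s : ℕ) + 1 = k then k else s)
    (h0 : (tuple d k J ⟨k - 1, by omega⟩ : ℕ) = k) :
    ∃ h2 : 1 < k, k - 1 ≤ tuple d k J ⟨k - 2, by omega⟩ := by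
  rw [not_forall] at h
  obtain ⟨t, ht⟩ := h
  by_cases ht0 : (t : ℕ) + 1 = k
  · rw [if_pos ht0] at ht
    have : t = ⟨k - 1, by omega⟩ := Fin.ext (by simp only; omega)
    rw [this] at ht
    exact absurd h0 ht
  · rw [if_neg ht0] at ht
    have hts := t.2
    have h2 : 1 < k := by omega
    refine ⟨h2, ?_⟩
    have h1 := tuple_add_le J (s := t) (t := ⟨k - 2, by omega⟩) (Fin.le_def.2 (by simp only; omega))
    have h3 := le_tuple J t
    simp only at h1
    omega

/-- The first tuple lies below every other, and the last entry of any other is at least `k`.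
Geometrically, the line `⋀^k x^k` depends on `x^k` alone. -/
theorem subordinate_one (hk : 1 ≤ k) (hkd : k < d) {θ : Finset ℕ} (hθ : k ∈ θ) :
    Subordinate d k θ 1 := by
  intro I J hI hJ
  have hI' := (lt_one_iff_tuple hkd I).1 hI
  have hJ' := mt (lt_one_iff_tuple hkd J).2 (by omega)
  refine ⟨fun s => Fin.le_def.2 (by rw [hI']; exact le_tuple J s), ⟨k - 1, by omega⟩, k, hθ, ?_,
    le_last_of_not_first hk hJ'⟩
  rw [hI']; simp only; omega

/-- This is where the shape of `θ_k` comes from. A tuple after the first two has last entry beyond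
`k`, separated from the second tuple by `k + 1`, or last entry `k` and penultimate entry at least `k
- 1`, separated by `k - 1`. The last two tuples use `d - k` and `d - k ± 1` in the same way. -/
theorem subordinate_theta (hk : 1 ≤ k) (hkd : k < d) {j : ℕ} (hj : j ∈ theta (d.choose k) 1) :
    Subordinate d k (theta d k) j := by
  have hD := two_le_choose hk hkd
  rw [mem_theta_one hD] at hj
  obtain ⟨hj, hj1, hj2⟩ := hj
  have hkθ : k ∈ theta d k := by rw [mem_theta]; omega
  rcases hj with rfl | rfl | rfl | rfl
  · exact subordinate_one hk hkd hkθ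
  · intro I J hI hJ
    by_cases hI0 : (I : ℕ) < 1
    · exact subordinate_one hk hkd hkθ I J hI0 (by omega)
    have hI' := ((lt_two_iff_tuple hk hkd I).1 hI).resolve_left
      (mt (lt_one_iff_tuple hkd I).2 hI0)
    have hJ' := not_or.1 (mt (lt_two_iff_tuple hk hkd J).2 (by omega))
    have hlast := le_last_of_not_first hk hJ'.1
    have hup := (tuple d k J ⟨k - 1, by omega⟩).2
    constructor
    · intro s
      rw [Fin.le_def, hI']
      split_ifs with hs
      · have : s = ⟨k - 1, by omega⟩ := Fin.ext (by simp only; omega)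
        rw [this]; exact hlast
      · exact le_tuple J s
    · rcases hlast.eq_or_lt with h | h
      · obtain ⟨h2, h3⟩ := le_penultimate_of_not_first hk hJ'.2 h.symm
        refine ⟨⟨k - 2, by omega⟩, k - 1, by rw [mem_theta]; omega, ?_, h3⟩
        rw [hI', if_neg] <;> (try simp only) <;> omega
      · refine ⟨⟨k - 1, by omega⟩, k + 1, by rw [mem_theta]; omega, ?_, h⟩
        rw [hI', if_pos] <;> (try simp only) <;> omega
  · intro I J hI hJ
    have hI' := not_or.1 (mt (last_two_iff_tuple hk hkd I).2 (by omega))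
    have hfirst := first_lt_of_not_last hk hI'.1
    rcases (last_two_iff_tuple hk hkd J).1 hJ with hJ' | hJ'
    · refine ⟨fun s => Fin.le_def.2 (by have := tuple_le I s; rw [hJ']; omega), ⟨0, by omega⟩,
        d - k, by rw [mem_theta]; omega, hfirst, ?_⟩
      rw [hJ']; simp
    · constructor
      · intro s
        rw [Fin.le_def, hJ']
        split_ifs with hs
        · have : s = ⟨0, by omega⟩ := Fin.ext hs
          rw [this]; omega
        · have := tuple_le I s
          omega
      · by_cases h : (tuple d k I ⟨0, by omega⟩ : ℕ) = d - k - 1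
        · obtain ⟨h2, h3⟩ := second_lt_of_not_last hk hI'.2 h
          refine ⟨⟨1, h2⟩, d - k + 1, by rw [mem_theta]; omega, h3, ?_⟩
          rw [hJ', if_neg (by simp)]
        · refine ⟨⟨0, by omega⟩, d - k - 1, by rw [mem_theta]; omega, by omega, ?_⟩
          rw [hJ', if_pos rfl]
  · intro I J hI hJ
    have hI' := mt (last_iff_tuple hkd I).2 (by omega)
    have hfirst := first_lt_of_not_last hk hI'
    have hJ' := (last_iff_tuple hkd J).1 hJ
    refine ⟨fun s => Fin.le_def.2 (by have := tuple_le I s; rw [hJ']; omega), ⟨0, by omega⟩,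
        d - k, by rw [mem_theta]; omega, hfirst, ?_⟩
    rw [hJ']; simp

/-- The same case split, with initial tuples tested against tuples that are not final. For opposite
flags the zero blocks sit in the upper left corner, so late slots of one tuple are paired with early
slots of the other. -/
theorem opposable_theta (hk : 1 ≤ k) (hkd : k < d) {j : ℕ} (hj : j ∈ theta (d.choose k) 1) :
    Opposable d k (theta d k) j := by
  have hD := two_le_choose hk hkd
  rw [mem_theta_one hD] at hj
  obtain ⟨hj, hj1, hj2⟩ := hj
  have hfl : ∀ I J : Fin (d.choose k), (I : ℕ) < 1 → (J : ℕ) < d.choose k - 1 →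
      ∃ s : Fin k, ∃ i ∈ theta d k, (tuple d k I s.rev : ℕ) < i ∧ (tuple d k J s : ℕ) < d - i := by
    intro I J hI hJ
    have hI' := (lt_one_iff_tuple hkd I).1 hI
    have hJ' := mt (last_iff_tuple hkd J).2 (by omega)
    refine ⟨⟨0, by omega⟩, k, by rw [mem_theta]; omega, ?_, first_lt_of_not_last hk hJ'⟩
    rw [hI']; simp; omega
  have hlf : ∀ I J : Fin (d.choose k), (I : ℕ) < d.choose k - 1 → (J : ℕ) < 1 →
      ∃ s : Fin k, ∃ i ∈ theta d k, (tuple d k I s.rev : ℕ) < i ∧ (tuple d k J s : ℕ) < d - i := by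
    intro I J hI hJ
    have hJ' := (lt_one_iff_tuple hkd J).1 hJ
    have hI' := mt (last_iff_tuple hkd I).2 (by omega)
    refine ⟨⟨k - 1, by omega⟩, d - k, by rw [mem_theta]; omega, ?_, ?_⟩
    · have : (⟨k - 1, by omega⟩ : Fin k).rev = ⟨0, by omega⟩ := Fin.ext (by simp [Fin.rev]; omega)
      rw [this]
      exact first_lt_of_not_last hk hI'
    · rw [hJ']; simp only; omega
  rcases hj with rfl | rfl | rfl | rfl
  · exact hfl
  · intro I J hI hJ
    by_cases hI0 : (I : ℕ) < 1
    · exact hfl I J hI0 (by omega)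
    have hI' := ((lt_two_iff_tuple hk hkd I).1 hI).resolve_left
      (mt (lt_one_iff_tuple hkd I).2 hI0)
    have hJ' := not_or.1 (mt (last_two_iff_tuple hk hkd J).2 (by omega))
    have hfirst := first_lt_of_not_last hk hJ'.1
    by_cases h : (tuple d k J ⟨0, by omega⟩ : ℕ) = d - k - 1
    · obtain ⟨h2, h3⟩ := second_lt_of_not_last hk hJ'.2 h
      refine ⟨⟨1, h2⟩, k - 1, by rw [mem_theta]; omega, ?_, by omega⟩
      rw [hI', if_neg] <;> simp <;> omega
    · refine ⟨⟨0, by omega⟩, k + 1, by rw [mem_theta]; omega, ?_, by omega⟩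
      rw [hI', if_pos] <;> simp; omega
  · intro I J hI hJ
    by_cases hJ0 : (J : ℕ) < 1
    · exact hlf I J (by omega) hJ0
    have hJ' := ((lt_two_iff_tuple hk hkd J).1 (by omega)).resolve_left
      (mt (lt_one_iff_tuple hkd J).2 hJ0)
    have hI' := not_or.1 (mt (last_two_iff_tuple hk hkd I).2 (by omega))
    have hfirst := first_lt_of_not_last hk hI'.1
    by_cases h : (tuple d k I ⟨0, by omega⟩ : ℕ) = d - k - 1
    · obtain ⟨h2, h3⟩ := second_lt_of_not_last hk hI'.2 h
      refine ⟨⟨k - 2, by omega⟩, d - k + 1, by rw [mem_theta]; omega, ?_, ?_⟩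
      · have : (⟨k - 2, by omega⟩ : Fin k).rev = ⟨1, h2⟩ := Fin.ext (by simp [Fin.rev]; omega)
        rw [this]
        exact h3
      · rw [hJ', if_neg] <;> (try simp only) <;> omega
    · refine ⟨⟨k - 1, by omega⟩, d - k - 1, by rw [mem_theta]; omega, ?_, ?_⟩
      · have : (⟨k - 1, by omega⟩ : Fin k).rev = ⟨0, by omega⟩ := Fin.ext (by simp [Fin.rev]; omega)
        rw [this]
        omega
      · rw [hJ', if_pos] <;> (try simp only) <;> omega
  · intro I J hI hJ
    exact hlf I J hI (by omega)

/-! ### Standard subspaces -/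

theorem single_mem_stdSpace {i : Fin d} (h : (i : ℕ) < j) :
    EuclideanSpace.single i (1 : K) ∈ stdSpace K d j :=
  Submodule.subset_span ⟨i, h, rfl⟩

theorem mem_stdSpace_iff {v : Vec K d} :
    v ∈ stdSpace K d j ↔ ∀ i : Fin d, j ≤ (i : ℕ) → v i = 0 := by
  constructor
  · intro hv
    induction hv using Submodule.span_induction with
    | mem x hx =>
      obtain ⟨i, hi, rfl⟩ := hx
      intro l hl
      have : l ≠ i := by rintro rfl; omega
      simp [this]
    | zero => simp
    | add x y _ _ hx hy => intro l hl; simp [hx l hl, hy l hl]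
    | smul a x _ hx => intro l hl; simp [hx l hl]
  · intro hv
    have h1 : v = ∑ i, v i • EuclideanSpace.single i (1 : K) := by
      ext l
      simp [Pi.single_apply]
    rw [h1]
    refine Submodule.sum_mem _ fun i _ => ?_
    rcases lt_or_ge (i : ℕ) j with h | h
    · exact Submodule.smul_mem _ _ (single_mem_stdSpace h)
    · simp [hv i h]

theorem finrank_stdSpace (hj : j ≤ d) : Module.finrank K (stdSpace K d j) = j := by
  have h1 : {v | ∃ i : Fin d, (i : ℕ) < j ∧ v = EuclideanSpace.single i (1 : K)} =
      Set.range fun i : Fin j => EuclideanSpace.single (Fin.castLE hj i) (1 : K) := by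
    ext v
    constructor
    · rintro ⟨i, hi, rfl⟩
      exact ⟨⟨i, hi⟩, rfl⟩
    · rintro ⟨i, rfl⟩
      exact ⟨Fin.castLE hj i, i.2, rfl⟩
  have h2 : LinearIndependent K fun i : Fin j =>
      EuclideanSpace.single (Fin.castLE hj i) (1 : K) := by
    have := (EuclideanSpace.basisFun (Fin d) K).toBasis.linearIndependent.comp (Fin.castLE hj)
      (Fin.castLE_injective hj)
    have e : (fun i : Fin j => EuclideanSpace.single (Fin.castLE hj i) (1 : K)) =
        (EuclideanSpace.basisFun (Fin d) K).toBasis ∘ Fin.castLE hj := by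
      ext i : 1
      simp
    rw [e]
    exact this
  rw [stdSpace, h1, finrank_span_eq_card h2, Fintype.card_fin]

theorem stdSpace_mono {i j : ℕ} (h : i ≤ j) : stdSpace K d i ≤ stdSpace K d j :=
  fun _ hv => mem_stdSpace_iff.2 fun l hl => mem_stdSpace_iff.1 hv l (h.trans hl)

theorem map_stdSpace_le_iff {g : SL(d, K)} {W : Submodule K (Vec K d)} :
    (stdSpace K d j).map (slEquiv g).toLinearMap ≤ W ↔
      ∀ i : Fin d, (i : ℕ) < j → slEquiv g (EuclideanSpace.single i 1) ∈ W := by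
  rw [Submodule.map_le_iff_le_comap, stdSpace, Submodule.span_le]
  constructor
  · intro h i hi
    exact h ⟨i, hi, rfl⟩
  · rintro h _ ⟨i, hi, rfl⟩
    exact h i hi

theorem finrank_map_slEquiv (g : SL(d, K)) (W : Submodule K (Vec K d)) :
    Module.finrank K (W.map (slEquiv g).toLinearMap) = Module.finrank K W :=
  LinearEquiv.finrank_map_eq _ _

/-! ### The action of `SL(d, K)` on Grassmannians and flags -/

/-- The action of `SL(d, K)` on `Gr_j(K^d)`. -/
def Gr.move (g : SL(d, K)) (W : Gr K d j) : Gr K d j where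
  carrier := W.carrier.map (slEquiv g).toLinearMap
  finrank_eq := by rw [finrank_map_slEquiv]; exact W.finrank_eq

/-- The span of the first `j` standard basis vectors as a point of the Grassmannian. -/
def Gr.std (K : Type*) [RCLike K] (d j : ℕ) (hj : j ≤ d) : Gr K d j :=
  ⟨stdSpace K d j, finrank_stdSpace hj⟩

/-- The `θ`-flag `g F_0`, where `F_0` is the standard flag. -/
def stdFlag (hθ : ∀ j ∈ θ, j ≤ d) (g : SL(d, K)) : Flag K d θ where
  proj j := (Gr.std K d j (hθ j j.2)).move g
  mono _ _ h := Submodule.map_mono (stdSpace_mono h)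

theorem stdFlag_carrier (hθ : ∀ j ∈ θ, j ≤ d) (g : SL(d, K)) (j : θ) :
    ((stdFlag hθ g).proj j).carrier = (stdSpace K d j).map (slEquiv g).toLinearMap := rfl

/-- The centre of `SL(d, K)` consists of the scalars that are `d`-th roots of unity, so passing to
`PSL` only requires invariance under these. -/
theorem coe_eq_coe_iff {g h : SL(d, K)} :
    (g : PSL(d, K)) = h ↔ ∃ c : K, c ^ d = 1 ∧
      (h : Matrix (Fin d) (Fin d) K) = c • (g : Matrix (Fin d) (Fin d) K) := by
  rw [QuotientGroup.eq, Matrix.SpecialLinearGroup.mem_center_iff]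
  have key : ∀ c : K, Matrix.scalar (Fin d) c = ((g⁻¹ * h : SL(d, K)) : Matrix (Fin d) (Fin d) K) ↔
      (h : Matrix (Fin d) (Fin d) K) = c • (g : Matrix (Fin d) (Fin d) K) := by
    intro c
    have hs : (g : Matrix (Fin d) (Fin d) K) * Matrix.scalar (Fin d) c =
        c • (g : Matrix (Fin d) (Fin d) K) := by
      ext i j
      simp [Matrix.scalar_apply, Matrix.mul_diagonal, mul_comm]
    constructor
    · intro hc
      have h1 : (h : Matrix (Fin d) (Fin d) K) =
          (g : Matrix (Fin d) (Fin d) K) * ((g⁻¹ * h : SL(d, K)) : Matrix (Fin d) (Fin d) K) := by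
        rw [← Matrix.SpecialLinearGroup.coe_mul]; simp
      rw [h1, ← hc, hs]
    · intro hc
      rw [Matrix.SpecialLinearGroup.coe_mul, hc, ← hs, ← Matrix.mul_assoc,
        ← Matrix.SpecialLinearGroup.coe_mul]
      simp
  simp only [Fintype.card_fin, key]

theorem ne_zero_of_pow_eq_one {c : K} (hd : d ≠ 0) (hc : c ^ d = 1) : c ≠ 0 := by
  rintro rfl
  rw [zero_pow hd] at hc
  exact zero_ne_one hc

theorem map_slEquiv_eq_of_coe_eq {g h : SL(d, K)} (hgh : (g : PSL(d, K)) = h)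
    (W : Submodule K (Vec K d)) :
    W.map (slEquiv g).toLinearMap = W.map (slEquiv h).toLinearMap := by
  rcases Nat.eq_zero_or_pos d with rfl | hd
  · rw [Subsingleton.elim g h]
  obtain ⟨c, hc, h1⟩ := coe_eq_coe_iff.1 hgh
  have hc0 := ne_zero_of_pow_eq_one hd.ne' hc
  have h2 : (slEquiv h).toLinearMap = c • (slEquiv g).toLinearMap := by
    rw [slEquiv_eq_toEuclideanLin, slEquiv_eq_toEuclideanLin, h1, map_smul]
  rw [h2, Submodule.map_smul _ _ _ hc0]

theorem coe_pslLift (g : PSL(d, K)) : (pslLift g : PSL(d, K)) = g := Quotient.out_eq g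

theorem Gr.act_coe (g : SL(d, K)) (W : Gr K d j) : W.act (g : PSL(d, K)) = W.move g :=
  Gr.ext (map_slEquiv_eq_of_coe_eq (coe_pslLift _) _)

theorem Flag.act_coe_stdFlag (hθ : ∀ j ∈ θ, j ≤ d) (g h : SL(d, K)) :
    (stdFlag hθ h).act (g : PSL(d, K)) = stdFlag hθ (g * h) := by
  refine Flag.ext (funext fun j => ?_)
  refine (Gr.act_coe g _).trans (Gr.ext ?_)
  exact (map_slEquiv_mul g h _).symm

/-- Flags are treated as cosets of the stabilizer of the standard flag. Together with
`map_stdSpace_eq_iff` this turns equality of flags into block triangularity. -/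
theorem stdFlag_eq_iff (hθ : ∀ j ∈ θ, j ≤ d) (g h : SL(d, K)) :
    stdFlag hθ g = stdFlag hθ h ↔ ∀ j ∈ θ,
      (stdSpace K d j).map (slEquiv (g⁻¹ * h)).toLinearMap = stdSpace K d j := by
  have key : ∀ W : Submodule K (Vec K d), W.map (slEquiv g).toLinearMap =
      W.map (slEquiv h).toLinearMap ↔ W.map (slEquiv (g⁻¹ * h)).toLinearMap = W := by
    intro W
    rw [map_slEquiv_mul]
    constructor
    · intro hW
      rw [← hW, ← map_slEquiv_mul]; simp
    · intro hW
      conv_lhs => rw [← hW]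
      rw [← map_slEquiv_mul]; simp
  constructor
  · intro hgh j hj
    rw [← key, ← stdFlag_carrier hθ g ⟨j, hj⟩, hgh]
    rfl
  · intro hgh
    refine Flag.ext (funext fun j => Gr.ext ?_)
    exact (key _).2 (hgh j j.2)

/-! ### Special unitary matrices -/

theorem inner_slEquiv {m : SL(d, K)} (hm : IsSU m) (v w : Vec K d) :
    inner K (slEquiv m v) (slEquiv m w) = inner K v w := by
  rw [IsSU, Matrix.mem_unitaryGroup_iff'] at hm
  simp only [EuclideanSpace.inner_eq_star_dotProduct, slEquiv_eq_toLp]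
  rw [Matrix.star_mulVec, dotProduct_comm, ← Matrix.dotProduct_mulVec, Matrix.mulVec_mulVec,
    ← Matrix.star_eq_conjTranspose, hm, Matrix.one_mulVec, dotProduct_comm]

theorem norm_slEquiv {m : SL(d, K)} (hm : IsSU m) (v : Vec K d) : ‖slEquiv m v‖ = ‖v‖ := by
  rw [@norm_eq_sqrt_re_inner K, @norm_eq_sqrt_re_inner K, inner_slEquiv hm]

theorem IsSU.inv {m : SL(d, K)} (hm : IsSU m) : IsSU m⁻¹ := by
  have h1 : ((m⁻¹ : SL(d, K)) : Matrix (Fin d) (Fin d) K) = star (m : Matrix (Fin d) (Fin d) K) := by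
    rw [IsSU, Matrix.mem_unitaryGroup_iff'] at hm
    rw [← Matrix.one_mul ((m⁻¹ : SL(d, K)) : Matrix (Fin d) (Fin d) K), ← hm, Matrix.mul_assoc,
      ← Matrix.SpecialLinearGroup.coe_mul]
    simp
  rw [IsSU, h1]
  exact Unitary.star_mem hm

theorem IsSU.mul {m n : SL(d, K)} (hm : IsSU m) (hn : IsSU n) : IsSU (m * n) := by
  rw [IsSU, Matrix.SpecialLinearGroup.coe_mul]
  exact mul_mem hm hn

theorem isSU_one : IsSU (1 : SL(d, K)) := by
  rw [IsSU, Matrix.SpecialLinearGroup.coe_one]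
  exact one_mem _

/-- Unitary maps conjugate orthogonal projections. Since projections define the topology, this makes
the orbit maps of the special unitary group visibly continuous. -/
theorem starProjection_move {m : SL(d, K)} (hm : IsSU m) (W : Gr K d j) (v : Vec K d) :
    (W.move m).carrier.starProjection v = slEquiv m (W.carrier.starProjection (slEquiv m⁻¹ v)) := by
  apply Submodule.eq_starProjection_of_mem_of_inner_eq_zero
  · exact Submodule.mem_map_of_mem (Submodule.starProjection_apply_mem _ _)
  · rintro _ ⟨w, hw, rfl⟩
    have h1 : v = slEquiv m (slEquiv m⁻¹ v) := (slEquiv_apply_inv_self m v).symm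
    conv_lhs => rw [h1]
    rw [slEquiv_inv_apply_self, ← map_sub]
    exact (inner_slEquiv hm _ _).trans (Submodule.starProjection_inner_eq_zero _ _ hw)

/-- The continuous linear map given by an element of `SL(d, K)`. -/
noncomputable def slCLM (g : SL(d, K)) : Vec K d →L[K] Vec K d :=
  Matrix.toEuclideanCLM (n := Fin d) (𝕜 := K) (g : Matrix (Fin d) (Fin d) K)

theorem slCLM_apply (g : SL(d, K)) (v : Vec K d) : slCLM g v = slEquiv g v := rfl

theorem continuous_slCLM : Continuous (slCLM : SL(d, K) → Vec K d →L[K] Vec K d) := by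
  have h1 : Continuous fun M : Matrix (Fin d) (Fin d) K =>
      Matrix.toEuclideanCLM (n := Fin d) (𝕜 := K) M :=
    LinearMap.continuous_of_finiteDimensional
      (Matrix.toEuclideanCLM (n := Fin d) (𝕜 := K)).toAlgEquiv.toLinearMap
  exact h1.comp continuous_subtype_val

theorem isCompact_setOf_isSU : IsCompact {m : SL(d, K) | IsSU m} := by
  have h1 : IsCompact {M : Matrix (Fin d) (Fin d) K | M ∈ Matrix.unitaryGroup (Fin d) K} := by
    have h2 : IsCompact {M : Matrix (Fin d) (Fin d) K | ∀ i j, M i j ∈ Metric.closedBall (0 : K) 1} :=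
      IsCompact.matrix (isCompact_closedBall _ _)
    refine h2.of_isClosed_subset ?_ ?_
    · simp only [Matrix.mem_unitaryGroup_iff]
      refine isClosed_eq ?_ continuous_const
      exact continuous_id.matrix_mul continuous_star
    · intro M hM i j
      simpa using entry_norm_bound_of_unitary hM i j
  exact Matrix.SpecialLinearGroup.isClosedEmbedding_val.isCompact_preimage h1

/-! ### Topology of Grassmannians and flag manifolds -/

theorem Gr.continuous_starProjection :
    Continuous fun W : Gr K d j => W.carrier.starProjection := continuous_induced_dom

theorem Gr.starProjection_injective :
    Function.Injective fun W : Gr K d j => W.carrier.starProjection :=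
  fun _ _ h => Gr.ext (Submodule.starProjection_inj.1 h)

instance : T2Space (Gr K d j) :=
  T2Space.of_injective_continuous Gr.starProjection_injective Gr.continuous_starProjection

theorem Flag.continuous_proj : Continuous fun x : Flag K d θ => x.proj := continuous_induced_dom

theorem Flag.continuous_proj_apply (j : θ) : Continuous fun x : Flag K d θ => x.proj j :=
  (continuous_apply j).comp Flag.continuous_proj

theorem Flag.proj_injective : Function.Injective fun x : Flag K d θ => x.proj :=
  fun _ _ h => Flag.ext h

instance : T2Space (Flag K d θ) :=
  T2Space.of_injective_continuous Flag.proj_injective Flag.continuous_proj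

theorem continuous_move_isSU (W : Gr K d j) :
    Continuous fun m : {m : SL(d, K) | IsSU m} => W.move (m : SL(d, K)) := by
  rw [continuous_induced_rng]
  have h1 : ((fun W : Gr K d j => W.carrier.starProjection) ∘
      fun m : {m : SL(d, K) | IsSU m} => W.move (m : SL(d, K))) =
      fun m : {m : SL(d, K) | IsSU m} => (slCLM (m : SL(d, K))).comp
        (W.carrier.starProjection.comp (slCLM (m : SL(d, K))⁻¹)) := by
    funext m
    ext1 v
    exact starProjection_move m.2 W v
  rw [h1]
  have h2 := continuous_slCLM (K := K) (d := d)
  exact (h2.comp continuous_subtype_val).clm_comp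
    (continuous_const.clm_comp (h2.comp continuous_subtype_val.inv))

theorem continuous_stdFlag_isSU (hθ : ∀ j ∈ θ, j ≤ d) :
    Continuous fun m : {m : SL(d, K) | IsSU m} => stdFlag hθ (m : SL(d, K)) := by
  rw [continuous_induced_rng]
  exact continuous_pi fun j => continuous_move_isSU _

/-- A vector orthogonal to few given vectors in a subspace. -/
theorem exists_orthogonal_vector {m : ℕ} (v : Fin m → Vec K d) (X : Submodule K (Vec K d))
    (hX : m < Module.finrank K X) :
    ∃ u ∈ X, ‖u‖ = 1 ∧ ∀ i, inner K (v i) u = 0 := by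
  set S := Submodule.span K (Set.range v)
  have h1 : Module.finrank K S ≤ m := by
    exact (finrank_range_le_card (R := K) v).trans (by simp)
  have h2 := Submodule.finrank_add_finrank_orthogonal S
  have h3 := Submodule.finrank_sup_add_finrank_inf_eq X Sᗮ
  have h4 := Submodule.finrank_le (X ⊔ Sᗮ)
  have h5 : X ⊓ Sᗮ ≠ ⊥ := by
    intro h
    rw [h, finrank_bot] at h3
    omega
  obtain ⟨u, hu, hu0⟩ := Submodule.exists_mem_ne_zero_of_ne_bot h5
  refine ⟨((‖u‖⁻¹ : ℝ) : K) • u, X.smul_mem _ hu.1, ?_, fun i => ?_⟩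
  · rw [norm_smul]
    simp [hu0]
  · rw [inner_smul_right, hu.2 (v i) (Submodule.subset_span ⟨i, rfl⟩), mul_zero]

/-- Gram–Schmidt along the flag: the next vector is taken in the smallest `x^j` of dimension greater
than `m`, orthogonally to the `m` earlier vectors, and then lies in all larger members of the flag.
-/
theorem exists_adapted_orthonormal (x : Flag K d θ) (m : ℕ) (hm : m ≤ d) :
    ∃ v : Fin m → Vec K d, Orthonormal K v ∧
      ∀ i : Fin m, ∀ j : θ, (i : ℕ) < j → v i ∈ (x.proj j).carrier := by
  induction m with
  | zero => exact ⟨Fin.elim0, ⟨fun i => i.elim0, fun i => i.elim0⟩, fun i => i.elim0⟩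
  | succ m ih =>
    obtain ⟨v, hv, hvx⟩ := ih (by omega)
    obtain ⟨X, hX, hXx⟩ : ∃ X : Submodule K (Vec K d), m < Module.finrank K X ∧
        ∀ j : θ, m < (j : ℕ) → X ≤ (x.proj j).carrier := by
      by_cases h : ∃ j : θ, m < (j : ℕ)
      · obtain ⟨j, hj, hmin⟩ := WellFounded.has_min (wellFounded_lt (α := θ))
          {j : θ | m < (j : ℕ)} h
        refine ⟨(x.proj j).carrier, by rw [(x.proj j).finrank_eq]; exact hj, fun l hl => ?_⟩
        exact x.mono _ _ (not_lt.1 (hmin l hl))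
      · refine ⟨⊤, ?_, fun j hj => absurd ⟨j, hj⟩ h⟩
        rw [finrank_top, finrank_euclideanSpace_fin]
        omega
    obtain ⟨u, huX, hu1, huv⟩ := exists_orthogonal_vector v X hX
    refine ⟨Fin.snoc v u, ⟨fun i => ?_, fun i l hil => ?_⟩, fun i j hj => ?_⟩
    · induction i using Fin.lastCases with
      | last => simpa using hu1
      | cast i => simpa using hv.1 i
    · induction i using Fin.lastCases with
      | last =>
        induction l using Fin.lastCases with
        | last => exact absurd rfl hil
        | cast l => simpa using inner_eq_zero_symm.1 (huv l)
      | cast i =>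
        induction l using Fin.lastCases with
        | last => simpa using huv i
        | cast l => simpa using hv.2 (fun h => hil (by rw [h]))
    · induction i using Fin.lastCases with
      | last => simpa using hXx j (by simpa using hj) huX
      | cast i => simpa using hvx i j (by simpa using hj)

theorem exists_isSU_of_orthonormal (v : Fin d → Vec K d) (hv : Orthonormal K v) :
    ∃ m : SL(d, K), IsSU m ∧
      ∀ i, ∃ c : K, slEquiv m (EuclideanSpace.single i 1) = c • v i := by
  rcases Nat.eq_zero_or_pos d with rfl | hd
  · exact ⟨1, isSU_one, fun i => i.elim0⟩
  set M : Matrix (Fin d) (Fin d) K := Matrix.of fun a b => v b a with hM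
  have hMu : M ∈ Matrix.unitaryGroup (Fin d) K := by
    rw [Matrix.mem_unitaryGroup_iff']
    ext a b
    have := orthonormal_iff_ite.1 hv a b
    rw [EuclideanSpace.inner_eq_star_dotProduct, dotProduct_comm] at this
    rw [Matrix.one_apply, ← this]
    rfl
  have hdet : ‖M.det‖ = 1 := by
    have := Matrix.det_of_mem_unitary hMu
    rw [Unitary.mem_iff] at this
    have h2 := congrArg norm this.1
    rw [norm_mul, norm_star, norm_one] at h2
    nlinarith [norm_nonneg M.det]
  have hdet0 : M.det ≠ 0 := by
    intro h; rw [h, norm_zero] at hdet; exact zero_ne_one hdet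
  -- The matrix with columns `v i` is unitary, but its determinant is only of modulus one. Dividing
  -- the first column by it repairs this, which is why the vectors are hit only up to scalars.
  set a : Fin d → K := Function.update 1 ⟨0, hd⟩ (M.det)⁻¹ with ha
  have hdiag : Matrix.diagonal a ∈ Matrix.unitaryGroup (Fin d) K := by
    rw [Matrix.mem_unitaryGroup_iff', Matrix.star_eq_conjTranspose, Matrix.diagonal_conjTranspose,
      Matrix.diagonal_mul_diagonal, ← Matrix.diagonal_one]
    congr 1
    funext i
    have : ‖a i‖ = 1 := by
      rw [ha, Function.update_apply]
      split_ifs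
      · rw [norm_inv, hdet, inv_one]
      · simp
    rw [Pi.star_apply, RCLike.star_def, RCLike.conj_mul, this]
    simp
  have hdet1 : (M * Matrix.diagonal a).det = 1 := by
    rw [Matrix.det_mul, Matrix.det_diagonal, ha, Finset.prod_update_of_mem (Finset.mem_univ _)]
    simp [hdet0]
  let m : SL(d, K) := ⟨M * Matrix.diagonal a, hdet1⟩
  refine ⟨m, mul_mem hMu hdiag, fun i => ⟨a i, ?_⟩⟩
  · ext l
    rw [slEquiv_single]
    change (M * Matrix.diagonal a) l i = _
    simp [hM, Matrix.mul_diagonal, mul_comm]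

theorem le_of_gr (W : Gr K d j) : j ≤ d := by
  have := Submodule.finrank_le W.carrier
  rwa [W.finrank_eq, finrank_euclideanSpace_fin] at this

theorem Gr.move_std_eq_iff (hj : j ≤ d) (g : SL(d, K)) (W : Gr K d j) :
    (Gr.std K d j hj).move g = W ↔
      ∀ i : Fin d, (i : ℕ) < j → slEquiv g (EuclideanSpace.single i 1) ∈ W.carrier := by
  rw [← map_stdSpace_le_iff]
  constructor
  · rintro rfl
    exact le_rfl
  · intro h
    refine Gr.ext (Submodule.eq_of_le_of_finrank_eq h ?_)
    exact ((Gr.std K d j hj).move g).finrank_eq.trans W.finrank_eq.symm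

/-- The special unitary group is transitive on flags. Hence every flag can be written as `stdFlag hθ
m`, and flag manifolds inherit compactness. -/
theorem exists_stdFlag_eq (hθ : ∀ j ∈ θ, j ≤ d) (x : Flag K d θ) :
    ∃ m : SL(d, K), IsSU m ∧ stdFlag hθ m = x := by
  obtain ⟨v, hv, hvx⟩ := exists_adapted_orthonormal x d le_rfl
  obtain ⟨m, hm, hmv⟩ := exists_isSU_of_orthonormal v hv
  refine ⟨m, hm, Flag.ext (funext fun j => ?_)⟩
  refine (Gr.move_std_eq_iff _ _ _).2 fun i hi => ?_
  obtain ⟨c, hc⟩ := hmv i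
  rw [hc]
  exact Submodule.smul_mem _ _ (hvx i j hi)

theorem isCompact_univ_flag (hθ : ∀ j ∈ θ, j ≤ d) : IsCompact (Set.univ : Set (Flag K d θ)) := by
  have : CompactSpace {m : SL(d, K) | IsSU m} := isCompact_iff_compactSpace.1 isCompact_setOf_isSU
  have h := isCompact_range (continuous_stdFlag_isSU (K := K) hθ)
  convert h
  refine (Set.range_eq_univ.2 fun x => ?_).symm
  obtain ⟨m, hm, hx⟩ := exists_stdFlag_eq hθ x
  exact ⟨⟨m, hm⟩, hx⟩

/-- A continuous surjection from a compact space onto a Hausdorff space is a quotient map, so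
continuity of maps out of a flag manifold can be tested on the special unitary group. -/
theorem isQuotientMap_stdFlag (hθ : ∀ j ∈ θ, j ≤ d) :
    IsQuotientMap fun m : {m : SL(d, K) | IsSU m} => stdFlag hθ (m : SL(d, K)) := by
  have : CompactSpace {m : SL(d, K) | IsSU m} := isCompact_iff_compactSpace.1 isCompact_setOf_isSU
  refine (continuous_stdFlag_isSU hθ).isClosedMap.isQuotientMap (continuous_stdFlag_isSU hθ) ?_
  intro x
  obtain ⟨m, hm, hx⟩ := exists_stdFlag_eq hθ x
  exact ⟨⟨m, hm⟩, hx⟩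

/-- The `{j}`-flag given by a point of the Grassmannian. -/
def Gr.toFlag (W : Gr K d j) : Flag K d {j} where
  proj i := ⟨W.carrier, by rw [W.finrank_eq]; exact (Finset.mem_singleton.1 i.2).symm⟩
  mono _ _ _ := le_rfl

theorem Gr.toFlag_proj (W : Gr K d j) :
    W.toFlag.proj ⟨j, Finset.mem_singleton_self j⟩ = W := rfl

theorem Flag.toFlag_proj (x : Flag K d {j}) :
    (x.proj ⟨j, Finset.mem_singleton_self j⟩).toFlag = x := by
  refine Flag.ext (funext fun i => Gr.ext ?_)
  obtain ⟨i, hi⟩ := i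
  obtain rfl := Finset.mem_singleton.1 hi
  rfl

instance : CompactSpace (Gr K d j) := by
  by_cases hj : j ≤ d
  · have hθ : ∀ i ∈ ({j} : Finset ℕ), i ≤ d := by simpa using hj
    constructor
    have h := (isCompact_univ_flag (K := K) hθ).image
      (Flag.continuous_proj_apply ⟨j, Finset.mem_singleton_self j⟩)
    convert h
    refine (Set.eq_univ_of_forall fun W => ?_).symm
    exact ⟨W.toFlag, trivial, rfl⟩
  · have : IsEmpty (Gr K d j) := ⟨fun W => hj (le_of_gr W)⟩
    infer_instance

/-- For non-unitary `g` the projection onto `g W` is not simply a conjugate of the one onto `W`.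
Instead, `g W = W'` is the closed condition that the projection onto `W'` fixes the range of `g`
composed with the projection onto `W`. As the Grassmannian is compact, forgetting `W'` is a closed
map. -/
theorem Gr.continuous_move :
    Continuous fun p : SL(d, K) × Gr K d j => p.2.move p.1 := by
  rw [continuous_iff_isClosed]
  intro C hC
  have h1 : (fun p : SL(d, K) × Gr K d j => p.2.move p.1) ⁻¹' C =
      Prod.fst '' ({q : (SL(d, K) × Gr K d j) × Gr K d j |
        q.2.carrier.starProjection.comp ((slCLM q.1.1).comp q.1.2.carrier.starProjection) =
          (slCLM q.1.1).comp q.1.2.carrier.starProjection} ∩ Prod.snd ⁻¹' C) := by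
    have key : ∀ (g : SL(d, K)) (W W' : Gr K d j),
        W'.carrier.starProjection.comp ((slCLM g).comp W.carrier.starProjection) =
          (slCLM g).comp W.carrier.starProjection ↔ W.move g = W' := by
      intro g W W'
      constructor
      · intro h
        refine Gr.ext (Submodule.eq_of_le_of_finrank_eq ?_ ?_)
        · rintro _ ⟨w, hw, rfl⟩
          have := DFunLike.congr_fun h w
          simp only [ContinuousLinearMap.comp_apply, Submodule.starProjection_eq_self_iff.2 hw,
            slCLM_apply] at this
          exact Submodule.starProjection_eq_self_iff.1 this
        · rw [(W.move g).finrank_eq, W'.finrank_eq]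
      · rintro rfl
        ext1 v
        simp only [ContinuousLinearMap.comp_apply, slCLM_apply]
        exact Submodule.starProjection_eq_self_iff.2
          (Submodule.mem_map_of_mem (Submodule.starProjection_apply_mem _ _))
    ext ⟨g, W⟩
    constructor
    · intro h
      exact ⟨((g, W), W.move g), ⟨(key _ _ _).2 rfl, h⟩, rfl⟩
    · rintro ⟨⟨p, W'⟩, ⟨h2, h3⟩, rfl⟩
      have := (key _ _ _).1 h2
      simp only [Set.mem_preimage] at h3 ⊢
      rwa [this]
  rw [h1]
  refine isClosedMap_fst_of_compactSpace _ (IsClosed.inter ?_ (hC.preimage continuous_snd))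
  have h2 := (Gr.continuous_starProjection (K := K) (d := d) (j := j))
  have h3 : Continuous fun q : (SL(d, K) × Gr K d j) × Gr K d j =>
      (slCLM q.1.1).comp q.1.2.carrier.starProjection :=
    (continuous_slCLM.comp (continuous_fst.comp continuous_fst)).clm_comp
      (h2.comp (continuous_snd.comp continuous_fst))
  exact isClosed_eq ((h2.comp continuous_snd).clm_comp h3) h3

theorem Gr.continuous_move_left (W : Gr K d j) :
    Continuous fun g : SL(d, K) => W.move g := by
  have h : Continuous fun g : SL(d, K) => (g, W) := by fun_prop
  have h2 := Gr.continuous_move.comp h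
  exact h2

theorem Gr.continuous_move_right (g : SL(d, K)) :
    Continuous fun W : Gr K d j => W.move g := by
  have h : Continuous fun W : Gr K d j => (g, W) := by fun_prop
  have h2 := Gr.continuous_move.comp h
  exact h2

theorem continuous_stdFlag (hθ : ∀ j ∈ θ, j ≤ d) :
    Continuous (stdFlag hθ : SL(d, K) → Flag K d θ) := by
  rw [continuous_induced_rng]
  exact continuous_pi fun j => Gr.continuous_move_left (Gr.std K d j (hθ j j.2))

theorem Flag.continuous_act (g : PSL(d, K)) : Continuous (Flag.act g : Flag K d θ → Flag K d θ) := by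
  rw [continuous_induced_rng]
  exact continuous_pi fun j =>
    (Gr.continuous_move_right (pslLift g)).comp (Flag.continuous_proj_apply j)

/-! ### Block triangular matrices and their exterior powers -/

theorem map_stdSpace_eq_iff (hj : j ≤ d) (p : SL(d, K)) :
    (stdSpace K d j).map (slEquiv p).toLinearMap = stdSpace K d j ↔
      ∀ a b : Fin d, (b : ℕ) < j → j ≤ (a : ℕ) → (p : Matrix (Fin d) (Fin d) K) a b = 0 := by
  have h := Gr.move_std_eq_iff hj p (Gr.std K d j hj)
  rw [Gr.ext_iff] at h
  refine h.trans ?_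
  constructor
  · intro h1 a b hb ha
    rw [← slEquiv_single]
    exact mem_stdSpace_iff.1 (h1 b hb) a ha
  · intro h1 b hb
    refine mem_stdSpace_iff.2 fun a ha => ?_
    rw [slEquiv_single]
    exact h1 a b hb ha

/-- The separating `i ∈ θ` places the rows from slot `s` on and the columns up to slot `s` inside
the zero block of `p` at `i`. -/
theorem compound_eq_zero_of_subordinate (hsub : Subordinate d k θ j)
    {p : Matrix (Fin d) (Fin d) K}
    (hp : ∀ i ∈ θ, ∀ a b : Fin d, (b : ℕ) < i → i ≤ (a : ℕ) → p a b = 0)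
    {I J : Fin (d.choose k)} (hI : (I : ℕ) < j) (hJ : j ≤ (J : ℕ)) : compound k p J I = 0 := by
  obtain ⟨-, s, i, hi, h1, h2⟩ := hsub I J hI hJ
  refine det_eq_zero_of_lower_left_block _ s fun a b ha hb => hp i hi _ _ ?_ ?_
  · exact lt_of_le_of_lt (Fin.le_def.1 ((tuple d k I).monotone hb)) h1
  · exact h2.trans (Fin.le_def.1 ((tuple d k J).monotone ha))

/-! ### The map on flags induced by the exterior power -/

/-- The map `g F_0 ↦ (⋀^k g) F_0` of flag manifolds. -/
noncomputable def wedgeFlag (hk : 1 ≤ k) (hθ : ∀ j ∈ θ, j ≤ d) (hθ' : ∀ j ∈ θ', j ≤ d.choose k)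
    (x : Flag K d θ) : Flag K (d.choose k) θ' :=
  stdFlag hθ' (compoundSL hk (exists_stdFlag_eq hθ x).choose)

/-- Independence of the chosen representative: two representatives differ by a matrix that is block
triangular for `θ`, whose compound is block triangular for `θ'`. Any `g` in `SL` is allowed here,
not only a unitary one. -/
theorem wedgeFlag_stdFlag (hk : 1 ≤ k) (hθ : ∀ j ∈ θ, j ≤ d) (hθ' : ∀ j ∈ θ', j ≤ d.choose k)
    (hsub : ∀ j ∈ θ', Subordinate d k θ j) (g : SL(d, K)) :
    wedgeFlag hk hθ hθ' (stdFlag hθ g) = stdFlag hθ' (compoundSL hk g) := by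
  have h := (exists_stdFlag_eq hθ (stdFlag hθ g)).choose_spec.2
  rw [wedgeFlag]
  set m := (exists_stdFlag_eq hθ (stdFlag hθ g)).choose
  rw [stdFlag_eq_iff] at h ⊢
  intro j hj
  rw [← map_inv, ← map_mul, map_stdSpace_eq_iff (hθ' j hj)]
  intro J I hI hJ
  refine compound_eq_zero_of_subordinate (hsub j hj) (fun i hi => ?_) hI hJ
  exact (map_stdSpace_eq_iff (hθ i hi) _).1 (h i hi)

theorem continuous_wedgeFlag (hk : 1 ≤ k) (hθ : ∀ j ∈ θ, j ≤ d)
    (hθ' : ∀ j ∈ θ', j ≤ d.choose k) (hsub : ∀ j ∈ θ', Subordinate d k θ j) :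
    Continuous (wedgeFlag hk hθ hθ' : Flag K d θ → Flag K (d.choose k) θ') := by
  rw [(isQuotientMap_stdFlag hθ).continuous_iff]
  have h1 : (wedgeFlag hk hθ hθ' ∘ fun m : {m : SL(d, K) | IsSU m} => stdFlag hθ (m : SL(d, K))) =
      fun m : {m : SL(d, K) | IsSU m} => stdFlag hθ' (compoundSL hk (m : SL(d, K))) := by
    funext m
    rw [Function.comp_apply, wedgeFlag_stdFlag hk hθ hθ' hsub]
  rw [h1]
  have h2 := (continuous_compoundSL (K := K) (d := d) hk).comp
    (continuous_subtype_val (p := fun m : SL(d, K) => IsSU m))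
  have h3 := (continuous_stdFlag (K := K) hθ').comp h2
  exact h3

/-! ### The homomorphism of projective groups -/

theorem compound_smul (c : K) (M : Matrix (Fin d) (Fin d) K) :
    compound k (c • M) = c ^ k • compound k M := by
  ext I J
  rw [compound_apply, Matrix.smul_apply, compound_apply, Matrix.submatrix_smul, Pi.smul_apply,
    Pi.smul_apply, Matrix.det_smul, Fintype.card_fin, smul_eq_mul]

theorem coe_compoundSL_eq {g h : SL(d, K)} (hk : 1 ≤ k)
    (hgh : (g : PSL(d, K)) = h) :
    (compoundSL hk g : PSL(d.choose k, K)) = compoundSL hk h := by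
  obtain ⟨c, hc, h1⟩ := coe_eq_coe_iff.1 hgh
  refine coe_eq_coe_iff.2 ⟨c ^ k, ?_, ?_⟩
  -- That `c ^ k` is a root of unity of order dividing `d.choose k` is read off from the
  -- determinants of the two compounds, without any arithmetic of binomial coefficients.
  · have h2 : (compoundSL hk h : Matrix (Fin (d.choose k)) (Fin (d.choose k)) K).det = 1 :=
      Matrix.SpecialLinearGroup.det_coe _
    rw [coe_compoundSL, h1, compound_smul, Matrix.det_smul, Fintype.card_fin] at h2
    rwa [← coe_compoundSL hk, Matrix.SpecialLinearGroup.det_coe, mul_one] at h2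
  · rw [coe_compoundSL, h1, compound_smul]
    rfl

/-- The homomorphism `PSL(d, K) → PSL(d choose k, K)` induced by the `k`-th exterior power. -/
noncomputable def compoundPSL (hk : 1 ≤ k) : PSL(d, K) →* PSL(d.choose k, K) :=
  QuotientGroup.lift _ ((QuotientGroup.mk' _).comp (compoundSL hk)) fun g hg => by
    have h1 : (g : PSL(d, K)) = (1 : SL(d, K)) := by
      rw [eq_comm, QuotientGroup.eq]; simpa using hg
    have h2 := coe_compoundSL_eq hk h1
    rw [map_one] at h2
    exact h2

theorem compoundPSL_coe (hk : 1 ≤ k) (g : SL(d, K)) :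
    compoundPSL hk (g : PSL(d, K)) = (compoundSL hk g : PSL(d.choose k, K)) := rfl

theorem continuous_compoundPSL (hk : 1 ≤ k) :
    Continuous (compoundPSL hk : PSL(d, K) → PSL(d.choose k, K)) := by
  have h : Continuous fun g : SL(d, K) => (compoundSL hk g : PSL(d.choose k, K)) :=
    continuous_quot_mk.comp (continuous_compoundSL hk)
  exact continuous_quot_lift _ h

theorem isExteriorPowerRep_compoundPSL (hk : 1 ≤ k) :
    IsExteriorPowerRep (compoundPSL hk : PSL(d, K) →* PSL(d.choose k, K)) :=
  fun g => ⟨compoundSL hk g, rfl, slEquiv_compoundSL hk g⟩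

theorem wedgeFlag_act (hk : 1 ≤ k) (hθ : ∀ j ∈ θ, j ≤ d)
    (hθ' : ∀ j ∈ θ', j ≤ d.choose k) (hsub : ∀ j ∈ θ', Subordinate d k θ j)
    (g : PSL(d, K)) (x : Flag K d θ) :
    wedgeFlag hk hθ hθ' (x.act g) = (wedgeFlag hk hθ hθ' x).act (compoundPSL hk g) := by
  obtain ⟨m, -, rfl⟩ := exists_stdFlag_eq hθ x
  obtain ⟨g, rfl⟩ := QuotientGroup.mk_surjective g
  rw [Flag.act_coe_stdFlag, wedgeFlag_stdFlag hk hθ hθ' hsub, wedgeFlag_stdFlag hk hθ hθ' hsub,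
    compoundPSL_coe, Flag.act_coe_stdFlag, map_mul]

/-! ### The Plücker embedding -/

theorem wedge_mul_coeff {v w : Fin k → Vec K d} {c : Matrix (Fin k) (Fin k) K}
    (h : ∀ b, v b = ∑ a, c a b • w a) : wedge v = c.det • wedge w := by
  ext I
  rw [PiLp.smul_apply, wedge_apply, wedge_apply, smul_eq_mul, mul_comm, ← Matrix.det_mul]
  congr 1
  ext a b
  simp [h, Matrix.mul_apply, mul_comm]

theorem linearIndependent_iff_wedge_ne_zero (v : Fin k → Vec K d) :
    LinearIndependent K v ↔ wedge v ≠ 0 := by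
  rw [wedge, ne_eq, LinearEquiv.map_eq_zero_iff]
  constructor
  · intro hv
    have h1 := exteriorPower.ιMulti_family_linearIndependent_field k hv
    have h2 := h1.ne_zero (Set.powersetCard.ofFinEmbEquiv (OrderIso.refl _).toOrderEmbedding)
    rwa [exteriorPower.ιMulti_family, Equiv.symm_apply_apply] at h2
  · intro h
    by_contra hv
    exact h ((exteriorPower.ιMulti K k).map_linearDependent v hv)

/-- The span of `v` is recovered as the set of `u` with `u ∧ v_1 ∧ ⋯ ∧ v_k = 0`. A vector in the
span of `w` but not in that of `v` would give a nonzero wedge with `v` and a zero one with `w`. -/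
theorem span_eq_of_wedge_eq_smul {v w : Fin k → Vec K d} (hv : LinearIndependent K v)
    (hw : LinearIndependent K w) {c : K} (h : wedge v = c • wedge w) :
    Submodule.span K (Set.range v) = Submodule.span K (Set.range w) := by
  have h1 : exteriorPower.ιMulti K k v = c • exteriorPower.ιMulti K k w := by
    rw [wedge, wedge, ← map_smul] at h
    exact (wedgeCoord K d k).injective h
  have h2 : ∀ u, ExteriorAlgebra.ιMulti K (M := Vec K d) (k + 1) (Fin.cons u v : Fin (k + 1) → Vec K d) =
      c • ExteriorAlgebra.ιMulti K (M := Vec K d) (k + 1) (Fin.cons u w : Fin (k + 1) → Vec K d) := by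
    intro u
    have h3 := congrArg (Subtype.val) h1
    rw [ExteriorAlgebra.ιMulti_succ_apply, ExteriorAlgebra.ιMulti_succ_apply]
    simp only [Fin.cons_zero, Matrix.vecTail, Function.comp_def, Fin.cons_succ]
    rw [← mul_smul_comm]
    congr 1
  symm
  refine Submodule.eq_of_le_of_finrank_eq (fun u hu => ?_) ?_
  · by_contra hcon
    have h4 : LinearIndependent K (Fin.cons u v : Fin (k + 1) → Vec K d) :=
      linearIndependent_finCons.2 ⟨hv, hcon⟩
    rw [linearIndependent_iff_wedge_ne_zero] at h4
    apply h4
    rw [wedge, LinearEquiv.map_eq_zero_iff]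
    apply Subtype.ext
    rw [exteriorPower.ιMulti_apply_coe, h2,
      (ExteriorAlgebra.ιMulti K (M := Vec K d) (k + 1)).map_linearDependent]
    · simp
    · intro h5
      exact (linearIndependent_finCons.1 h5).2 hu
  · rw [finrank_span_eq_card hv, finrank_span_eq_card hw]

theorem linearIndependent_slEquiv (g : SL(d, K)) {v : Fin k → Vec K d}
    (hv : LinearIndependent K v) : LinearIndependent K fun s => slEquiv g (v s) :=
  hv.map' (slEquiv g).toLinearMap (LinearEquiv.ker _)

theorem linearIndependent_single_tuple (I : Fin (d.choose k)) :
    LinearIndependent K fun s => EuclideanSpace.single (tuple d k I s) (1 : K) := by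
  rw [linearIndependent_iff_wedge_ne_zero, wedge_single]
  simp

theorem stdSpace_one_eq {D : ℕ} (hD : 0 < D) :
    stdSpace K D 1 = Submodule.span K {EuclideanSpace.single ⟨0, hD⟩ (1 : K)} := by
  rw [stdSpace]
  congr 1
  ext v
  constructor
  · rintro ⟨i, hi, rfl⟩
    have : i = ⟨0, hD⟩ := Fin.ext (by simp only; omega)
    rw [this]; rfl
  · rintro rfl
    exact ⟨⟨0, hD⟩, by simp, rfl⟩

theorem stdSpace_eq_span_tuple (hkd : k < d) {I : Fin (d.choose k)} (hI : (I : ℕ) < 1) :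
    stdSpace K d k = Submodule.span K
      (Set.range fun s => EuclideanSpace.single (tuple d k I s) (1 : K)) := by
  have h := (lt_one_iff_tuple hkd I).1 hI
  rw [stdSpace]
  congr 1
  ext v
  constructor
  · rintro ⟨i, hi, rfl⟩
    refine ⟨⟨i, hi⟩, ?_⟩
    have : tuple d k I ⟨i, hi⟩ = i := Fin.ext (h _)
    simp only [this]
  · rintro ⟨s, rfl⟩
    exact ⟨tuple d k I s, by rw [h]; exact s.2, rfl⟩

theorem singleton_le_choose (hkd : k < d) : ∀ j ∈ ({1} : Finset ℕ), j ≤ d.choose k := by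
  intro j hj
  rw [Finset.mem_singleton.1 hj]
  exact Nat.choose_pos hkd.le

theorem singleton_le (hkd : k < d) : ∀ j ∈ ({k} : Finset ℕ), j ≤ d := by
  intro j hj
  rw [Finset.mem_singleton.1 hj]
  exact hkd.le

theorem subordinate_singleton (hk : 1 ≤ k) (hkd : k < d) :
    ∀ j ∈ ({1} : Finset ℕ), Subordinate d k {k} j := by
  intro j hj
  rw [Finset.mem_singleton.1 hj]
  exact subordinate_one hk hkd (Finset.mem_singleton_self k)

/-- The Plücker map. -/
noncomputable def plucker (hk : 1 ≤ k) (hkd : k < d) (W : Gr K d k) : Gr K (d.choose k) 1 :=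
  (wedgeFlag hk (singleton_le hkd) (singleton_le_choose hkd) W.toFlag).proj
    ⟨1, Finset.mem_singleton_self 1⟩

/-- The line of the induced flag is spanned by the wedge of one particular basis of `x^k`, and
another basis changes this wedge by a nonzero determinant. -/
theorem wedgeFlag_carrier_one (hk : 1 ≤ k) (hkd : k < d) (hθ : ∀ j ∈ θ, j ≤ d)
    (hθ' : ∀ j ∈ θ', j ≤ d.choose k) (hsub : ∀ j ∈ θ', Subordinate d k θ j)
    (hkθ : k ∈ θ) (h1θ : 1 ∈ θ') (x : Flag K d θ) (v : Fin k → Vec K d)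
    (hv : LinearIndependent K v)
    (hvx : Submodule.span K (Set.range v) = (x.proj ⟨k, hkθ⟩).carrier) :
    ((wedgeFlag hk hθ hθ' x).proj ⟨1, h1θ⟩).carrier = Submodule.span K {wedge v} := by
  obtain ⟨m, -, rfl⟩ := exists_stdFlag_eq hθ x
  have hD := Nat.choose_pos hkd.le
  rw [wedgeFlag_stdFlag hk hθ hθ' hsub, stdFlag_carrier]
  rw [stdFlag_carrier, stdSpace_eq_span_tuple hkd (I := ⟨0, hD⟩) (by simp)] at hvx
  rw [stdSpace_one_eq hD, Submodule.map_span, Set.image_singleton]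
  have h1 : (slEquiv (compoundSL hk m)).toLinearMap (EuclideanSpace.single ⟨0, hD⟩ (1 : K)) =
      wedge fun s => slEquiv m (EuclideanSpace.single (tuple d k ⟨0, hD⟩ s) (1 : K)) := by
    rw [← slEquiv_compoundSL_wedge hk, wedge_single]
    rfl
  rw [h1]
  rw [Submodule.map_span, ← Set.range_comp] at hvx
  have h2 : ∀ b, ∃ c : Fin k → K, ∑ a, c a • slEquiv m
      (EuclideanSpace.single (tuple d k ⟨0, hD⟩ a) (1 : K)) = v b := by
    intro b
    have : v b ∈ Submodule.span K (Set.range v) := Submodule.subset_span ⟨b, rfl⟩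
    rw [hvx] at this
    exact (Submodule.mem_span_range_iff_exists_fun K).1 this
  choose c hc using h2
  have h3 := wedge_mul_coeff (v := v) (c := Matrix.of fun a b => c b a)
    (w := fun s => slEquiv m (EuclideanSpace.single (tuple d k ⟨0, hD⟩ s) (1 : K)))
    (fun b => (hc b).symm)
  have h4 := (linearIndependent_iff_wedge_ne_zero v).1 hv
  rw [h3] at h4 ⊢
  rw [Submodule.span_singleton_smul_eq]
  rw [isUnit_iff_ne_zero]
  intro h0
  rw [h0, zero_smul] at h4
  exact h4 rfl

theorem isPluckerMap_plucker (hk : 1 ≤ k) (hkd : k < d) :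
    IsPluckerMap (plucker hk hkd : Gr K d k → Gr K (d.choose k) 1) := fun W v hv hvW =>
  wedgeFlag_carrier_one hk hkd _ _ (subordinate_singleton hk hkd) (Finset.mem_singleton_self k)
    (Finset.mem_singleton_self 1) W.toFlag v hv hvW

theorem Gr.exists_basis (W : Gr K d k) : ∃ v : Fin k → Vec K d, LinearIndependent K v ∧
    Submodule.span K (Set.range v) = W.carrier := by
  have b := Module.finBasisOfFinrankEq K W.carrier W.finrank_eq
  refine ⟨fun s => (b s : Vec K d), ?_, ?_⟩
  · exact b.linearIndependent.map' W.carrier.subtype (Submodule.ker_subtype _)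
  · have h1 : Set.range (fun s => (b s : Vec K d)) = W.carrier.subtype '' Set.range b := by
      rw [← Set.range_comp]; rfl
    rw [h1, ← Submodule.map_span, b.span_eq, Submodule.map_top, Submodule.range_subtype]

theorem wedgeFlag_proj_one (hk : 1 ≤ k) (hkd : k < d) (hθ : ∀ j ∈ θ, j ≤ d)
    (hθ' : ∀ j ∈ θ', j ≤ d.choose k) (hsub : ∀ j ∈ θ', Subordinate d k θ j)
    (hkθ : k ∈ θ) (h1θ : 1 ∈ θ') (x : Flag K d θ) :
    (wedgeFlag hk hθ hθ' x).proj ⟨1, h1θ⟩ = plucker hk hkd (x.proj ⟨k, hkθ⟩) := by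
  obtain ⟨v, hv, hvW⟩ := (x.proj ⟨k, hkθ⟩).exists_basis
  refine Gr.ext ?_
  rw [wedgeFlag_carrier_one hk hkd hθ hθ' hsub hkθ h1θ x v hv hvW]
  exact (isPluckerMap_plucker hk hkd _ v hv hvW).symm

theorem plucker_injective (hk : 1 ≤ k) (hkd : k < d) :
    Function.Injective (plucker hk hkd : Gr K d k → Gr K (d.choose k) 1) := by
  intro V W hVW
  obtain ⟨v, hv, hvV⟩ := V.exists_basis
  obtain ⟨w, hw, hwW⟩ := W.exists_basis
  refine Gr.ext ?_
  have h1 : (plucker hk hkd V).carrier = Submodule.span K {wedge v} :=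
    isPluckerMap_plucker hk hkd V v hv hvV
  have h2 : (plucker hk hkd W).carrier = Submodule.span K {wedge w} :=
    isPluckerMap_plucker hk hkd W w hw hwW
  rw [← hvV, ← hwW]
  have h3 : wedge v ∈ Submodule.span K {wedge w} := by
    rw [← h2, ← hVW, h1]
    exact Submodule.mem_span_singleton_self _
  obtain ⟨c, hc⟩ := Submodule.mem_span_singleton.1 h3
  exact span_eq_of_wedge_eq_smul hv hw hc.symm

theorem Gr.continuous_toFlag : Continuous (Gr.toFlag : Gr K d k → Flag K d {k}) := by
  rw [continuous_induced_rng]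
  refine continuous_pi fun i => ?_
  obtain ⟨i, hi⟩ := i
  obtain rfl := Finset.mem_singleton.1 hi
  exact continuous_id

theorem continuous_plucker (hk : 1 ≤ k) (hkd : k < d) :
    Continuous (plucker hk hkd : Gr K d k → Gr K (d.choose k) 1) :=
  (Flag.continuous_proj_apply _).comp
    ((continuous_wedgeFlag hk _ _ (subordinate_singleton hk hkd)).comp Gr.continuous_toFlag)

theorem isEmbedding_plucker (hk : 1 ≤ k) (hkd : k < d) :
    IsEmbedding (plucker hk hkd : Gr K d k → Gr K (d.choose k) 1) :=
  ((continuous_plucker hk hkd).isClosedEmbedding (plucker_injective hk hkd)).isEmbedding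

/-! ### Injectivity of the map on flags -/

/-- Information about `⋀^k p` on a basis vector is converted here into information about `p`:
decomposable vectors determine their `k`-planes. -/
theorem span_slEquiv_tuple_eq (hk : 1 ≤ k) (p : SL(d, K)) (I : Fin (d.choose k))
    (v : Fin k → Vec K d) {c : K}
    (h : slEquiv (compoundSL hk p) (EuclideanSpace.single I (1 : K)) = c • wedge v) :
    ∀ s, slEquiv p (EuclideanSpace.single (tuple d k I s) 1) ∈
      Submodule.span K (Set.range v) := by
  have h0 : slEquiv (compoundSL hk p) (EuclideanSpace.single I (1 : K)) =
      wedge fun s => slEquiv p (EuclideanSpace.single (tuple d k I s) (1 : K)) := by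
    rw [← slEquiv_compoundSL_wedge, wedge_single]
  have h1 := linearIndependent_slEquiv p (linearIndependent_single_tuple (K := K) I)
  have hne := (linearIndependent_iff_wedge_ne_zero _).1 h1
  rw [← h0, h] at hne
  have hv : LinearIndependent K v := by
    rw [linearIndependent_iff_wedge_ne_zero]
    intro hv
    rw [hv, smul_zero] at hne
    exact hne rfl
  have h2 := span_eq_of_wedge_eq_smul h1 hv (h0.symm.trans h)
  intro s
  rw [← h2]
  exact Submodule.subset_span ⟨s, rfl⟩

theorem block_of_compound_one (hk : 1 ≤ k) (hkd : k < d) (p : SL(d, K))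
    (h : ∀ J I : Fin (d.choose k), (I : ℕ) < 1 → 1 ≤ (J : ℕ) →
      compound k (p : Matrix (Fin d) (Fin d) K) J I = 0) (a b : Fin d) (hb : (b : ℕ) < k)
    (ha : k ≤ (a : ℕ)) : (p : Matrix (Fin d) (Fin d) K) a b = 0 := by
  have hD := Nat.choose_pos hkd.le
  set I : Fin (d.choose k) := ⟨0, hD⟩ with hI
  have h1 : slEquiv (compoundSL hk p) (EuclideanSpace.single I (1 : K)) =
      compound k (p : Matrix (Fin d) (Fin d) K) I I •
        wedge (fun s => EuclideanSpace.single (tuple d k I s) (1 : K)) := by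
    ext J
    rw [slEquiv_single, wedge_single, coe_compoundSL]
    by_cases hJ : J = I
    · simp [hJ]
    · rw [h J I (by simp [hI])]
      · simp [hJ]
      · have : (J : ℕ) ≠ 0 := fun h => hJ (Fin.ext h)
        omega
  have h2 := span_slEquiv_tuple_eq hk p I _ h1 ⟨b, hb⟩
  rw [← stdSpace_eq_span_tuple hkd (by simp [hI])] at h2
  have h3 : tuple d k I ⟨b, hb⟩ = b :=
    Fin.ext ((lt_one_iff_tuple hkd I).1 (by simp [hI]) _)
  rw [h3] at h2
  rw [← slEquiv_single]
  exact mem_stdSpace_iff.1 h2 a ha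

/-- The tuple of vectors `(e_0, …, e_{k-2}, α e_{k-1} + β e_k)`. -/
noncomputable def pencil (hk : 1 ≤ k) (hkd : k < d) (α β : K) (s : Fin k) : Vec K d :=
  if (s : ℕ) + 1 = k then α • EuclideanSpace.single ⟨k - 1, by omega⟩ (1 : K) +
      β • EuclideanSpace.single ⟨k, hkd⟩ (1 : K)
    else EuclideanSpace.single ⟨s, by omega⟩ 1

theorem wedge_pencil (hk : 1 ≤ k) (hkd : k < d) {I₁ I₂ : Fin (d.choose k)}
    (h₁ : ∀ s, (tuple d k I₁ s : ℕ) = s)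
    (h₂ : ∀ s : Fin k, (tuple d k I₂ s : ℕ) = if (s : ℕ) + 1 = k then k else s) (α β : K) :
    wedge (pencil hk hkd α β) =
      α • EuclideanSpace.single I₁ (1 : K) + β • EuclideanSpace.single I₂ (1 : K) := by
  rw [← wedge_single, ← wedge_single]
  simp only [wedge]
  have hs : (⟨k - 1, by omega⟩ : Fin k) = ⟨k - 1, by omega⟩ := rfl
  generalize hs' : (⟨k - 1, by omega⟩ : Fin k) = s at hs
  have e0 : pencil hk hkd α β =
      Function.update (fun t : Fin k => (EuclideanSpace.single (tuple d k I₁ t) (1 : K) : Vec K d))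
      s (α • EuclideanSpace.single (tuple d k I₁ s) (1 : K) +
        β • EuclideanSpace.single (tuple d k I₂ s) (1 : K)) := by
    funext t
    rw [Function.update_apply, pencil]
    have h3 : ((t : ℕ) + 1 = k) ↔ t = s := by
      rw [← hs', Fin.ext_iff]; simp only; omega
    simp only [h3]
    split_ifs with h4
    · have h5 : tuple d k I₁ s = ⟨k - 1, by omega⟩ := Fin.ext (by rw [h₁, ← hs'])
      have h6 : tuple d k I₂ s = ⟨k, hkd⟩ := Fin.ext (by rw [h₂, ← hs', if_pos]; simp only; omega)
      rw [h5, h6]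
    · congr 1
      exact Fin.ext (h₁ t).symm
  have e1 : Function.update
      (fun t : Fin k => (EuclideanSpace.single (tuple d k I₁ t) (1 : K) : Vec K d)) s
        (EuclideanSpace.single (tuple d k I₂ s) (1 : K)) =
      fun t => EuclideanSpace.single (tuple d k I₂ t) (1 : K) := by
    funext t
    rw [Function.update_apply]
    split_ifs with h4
    · rw [h4]
    · congr 1
      refine Fin.ext ?_
      rw [h₁, h₂, if_neg]
      intro h5
      exact h4 (by rw [← hs', Fin.ext_iff]; simp only; omega)
  rw [e0, AlternatingMap.map_update_add, AlternatingMap.map_update_smul,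
    AlternatingMap.map_update_smul, Function.update_eq_self, e1, map_add, map_smul, map_smul]

/-- The `k`-planes of the pencil all contain `e_0, …, e_{k-2}`, lie in the span of `e_0, …, e_k`,
and are told apart by the ratio of the coordinates `k - 1` and `k`. -/
theorem exists_of_mem_span_pencil (hk : 1 ≤ k) (hkd : k < d) {α β : K} {x : Vec K d}
    (hx : x ∈ Submodule.span K (Set.range (pencil hk hkd α β))) :
    ∃ c, x ⟨k - 1, by omega⟩ = c * α ∧ x ⟨k, hkd⟩ = c * β ∧ ∀ i : Fin d, k < (i : ℕ) → x i = 0 := by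
  induction hx using Submodule.span_induction with
  | mem x hx =>
    obtain ⟨s, rfl⟩ := hx
    have hs := s.2
    rw [pencil]
    split_ifs with h
    · have h1 : (⟨k - 1, by omega⟩ : Fin d) ≠ ⟨k, hkd⟩ := by
        rw [ne_eq, Fin.ext_iff]; simp only; omega
      refine ⟨1, by simp [h1], by simp [h1.symm], fun i hi => ?_⟩
      have h2 : i ≠ ⟨k - 1, by omega⟩ := by rw [ne_eq, Fin.ext_iff]; simp only; omega
      have h3 : i ≠ ⟨k, by omega⟩ := by rw [ne_eq, Fin.ext_iff]; simp only; omega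
      simp [h2, h3]
    · have h1 : ∀ i : Fin d, k - 1 ≤ (i : ℕ) → i ≠ ⟨s, by omega⟩ := by
        intro i hi
        rw [ne_eq, Fin.ext_iff]; simp only; omega
      refine ⟨0, ?_, ?_, fun i hi => ?_⟩
      · simp [h1 ⟨k - 1, by omega⟩ (by simp)]
      · simp [h1 ⟨k, by omega⟩ (by simp)]
      · simp [h1 i (by omega)]
  | zero => exact ⟨0, by simp⟩
  | add x y _ _ hx hy =>
    obtain ⟨c, h1, h2, h3⟩ := hx
    obtain ⟨c', h1', h2', h3'⟩ := hy
    exact ⟨c + c', by simp [h1, h1', add_mul], by simp [h2, h2', add_mul],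
      fun i hi => by simp [h3 i hi, h3' i hi]⟩
  | smul a x _ hx =>
    obtain ⟨c, h1, h2, h3⟩ := hx
    exact ⟨a * c, by simp [h1, mul_assoc], by simp [h2, mul_assoc], fun i hi => by simp [h3 i hi]⟩

theorem exists_first_two (hk : 1 ≤ k) (hkd : k < d) : ∃ I₁ I₂ : Fin (d.choose k),
    I₁ ≠ I₂ ∧ (∀ s, (tuple d k I₁ s : ℕ) = s) ∧
    (∀ s : Fin k, (tuple d k I₂ s : ℕ) = if (s : ℕ) + 1 = k then k else s) ∧
    (I₁ : ℕ) < 1 ∧ (I₂ : ℕ) < 2 ∧ ∀ I : Fin (d.choose k), (I : ℕ) < 2 → I = I₁ ∨ I = I₂ := by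
  have hD := two_le_choose hk hkd
  refine ⟨⟨0, by omega⟩, ⟨1, by omega⟩, by simp, ?_, ?_, by simp, by simp, ?_⟩
  · exact (lt_one_iff_tuple hkd _).1 (by simp)
  · refine ((lt_two_iff_tuple hk hkd _).1 (by simp)).resolve_left ?_
    rw [← lt_one_iff_tuple hkd]
    simp
  · intro I hI
    rcases (by omega : (I : ℕ) = 0 ∨ (I : ℕ) = 1) with h | h
    · exact Or.inl (Fin.ext h)
    · exact Or.inr (Fin.ext h)

/-- Every vector of the plane spanned by the first two basis vectors of `⋀^k K^d` is decomposable,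
and the corresponding `k`-planes form a pencil. If `⋀^k p` preserves that plane, `p` sends the two
basic members of the pencil to two distinct members. Their sum gives the block at `k + 1` and their
intersection the block at `k - 1`. -/
theorem block_of_compound_two (hk : 1 ≤ k) (hkd : k < d) (p : SL(d, K))
    (h : ∀ J I : Fin (d.choose k), (I : ℕ) < 2 → 2 ≤ (J : ℕ) →
      compound k (p : Matrix (Fin d) (Fin d) K) J I = 0) :
    (∀ a b : Fin d, (b : ℕ) < k + 1 → k + 1 ≤ (a : ℕ) →
      (p : Matrix (Fin d) (Fin d) K) a b = 0) ∧
    ∀ a b : Fin d, (b : ℕ) < k - 1 → k - 1 ≤ (a : ℕ) →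
      (p : Matrix (Fin d) (Fin d) K) a b = 0 := by
  obtain ⟨I₁, I₂, hne, h₁, h₂, hI₁, hI₂, h12⟩ := exists_first_two hk hkd
  set C := compound k (p : Matrix (Fin d) (Fin d) K) with hC
  have hexp : ∀ I : Fin (d.choose k), (I : ℕ) < 2 →
      slEquiv (compoundSL hk p) (EuclideanSpace.single I (1 : K)) =
        C I₁ I • EuclideanSpace.single I₁ (1 : K) + C I₂ I • EuclideanSpace.single I₂ (1 : K) := by
    intro I hI
    ext J
    rw [slEquiv_single, coe_compoundSL, ← hC]
    by_cases hJ1 : J = I₁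
    · subst hJ1; simp [hne]
    by_cases hJ2 : J = I₂
    · subst hJ2; simp [hne.symm]
    rw [h J I hI]
    · simp [hJ1, hJ2]
    · by_contra hcon
      rcases h12 J (by omega) with h | h
      · exact hJ1 h
      · exact hJ2 h
  have hspan : ∀ I : Fin (d.choose k), (I : ℕ) < 2 → ∀ s, ∃ c : K,
      (p : Matrix (Fin d) (Fin d) K) ⟨k - 1, by omega⟩ (tuple d k I s) = c * C I₁ I ∧
      (p : Matrix (Fin d) (Fin d) K) ⟨k, hkd⟩ (tuple d k I s) = c * C I₂ I ∧
      ∀ a : Fin d, k < (a : ℕ) → (p : Matrix (Fin d) (Fin d) K) a (tuple d k I s) = 0 := by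
    intro I hI s
    have h3 := span_slEquiv_tuple_eq hk p I (pencil hk hkd (C I₁ I) (C I₂ I)) (c := 1)
      (by rw [one_smul, wedge_pencil hk hkd h₁ h₂, hexp I hI]) s
    obtain ⟨c, hc1, hc2, hc3⟩ := exists_of_mem_span_pencil hk hkd h3
    rw [slEquiv_single] at hc1 hc2
    refine ⟨c, hc1, hc2, fun a ha => ?_⟩
    rw [← slEquiv_single]
    exact hc3 a ha
  have hI₁' : (I₁ : ℕ) < 2 := by omega
  -- The `2 × 2` block of `⋀^k p` on the invariant plane is invertible, because `⋀^k p` is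
  -- injective.
  have hdet : C I₁ I₁ * C I₂ I₂ - C I₂ I₁ * C I₁ I₂ ≠ 0 := by
    intro h0
    have h3 : ∀ u v : K, u * C I₁ I₁ + v * C I₁ I₂ = 0 → u * C I₂ I₁ + v * C I₂ I₂ = 0 →
        u = 0 ∧ v = 0 := by
      intro u v hu hv
      have h4 : slEquiv (compoundSL hk p) (u • EuclideanSpace.single I₁ (1 : K) +
          v • EuclideanSpace.single I₂ (1 : K)) = 0 := by
        rw [map_add, map_smul, map_smul, hexp I₁ hI₁', hexp I₂ hI₂]
        calc _ = (u * C I₁ I₁ + v * C I₁ I₂) • EuclideanSpace.single I₁ (1 : K) +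
              (u * C I₂ I₁ + v * C I₂ I₂) • EuclideanSpace.single I₂ (1 : K) := by module
          _ = 0 := by rw [hu, hv]; simp
      rw [LinearEquiv.map_eq_zero_iff] at h4
      have h5 := congrArg (fun x : Vec K (d.choose k) => x I₁) h4
      have h6 := congrArg (fun x : Vec K (d.choose k) => x I₂) h4
      simp [hne, hne.symm] at h5 h6
      exact ⟨h5, h6⟩
    have h4 := h3 (C I₂ I₂) (-C I₂ I₁) (by linear_combination h0) (by ring)
    have h5 := h3 (C I₁ I₂) (-C I₁ I₁) (by ring) (by linear_combination -h0)
    have h6 := h3 1 0 (by simpa using h5.2) (by simpa using h4.2)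
    exact one_ne_zero h6.1
  constructor
  · intro a b hb ha
    by_cases hbk : (b : ℕ) < k
    · obtain ⟨c, -, -, h3⟩ := hspan I₁ hI₁' ⟨b, hbk⟩
      have : tuple d k I₁ ⟨b, hbk⟩ = b := Fin.ext (h₁ _)
      rw [this] at h3
      exact h3 a (by omega)
    · obtain ⟨c, -, -, h3⟩ := hspan I₂ hI₂ ⟨k - 1, by omega⟩
      have : tuple d k I₂ ⟨k - 1, by omega⟩ = b :=
        Fin.ext (by rw [h₂, if_pos] <;> (try simp only) <;> omega)
      rw [this] at h3
      exact h3 a (by omega)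
  · intro a b hb ha
    have e1 : tuple d k I₁ ⟨b, by omega⟩ = b := Fin.ext (h₁ _)
    have e2 : tuple d k I₂ ⟨b, by omega⟩ = b :=
      Fin.ext (by rw [h₂, if_neg]; simp only; omega)
    obtain ⟨c, h3, h4, h5⟩ := hspan I₁ hI₁' ⟨b, by omega⟩
    obtain ⟨c', h3', h4', -⟩ := hspan I₂ hI₂ ⟨b, by omega⟩
    rw [e1] at h3 h4 h5
    rw [e2] at h3' h4'
    -- The `b`-th column of `p` lies in both image planes, so its coordinates `(k - 1, k)` are
    -- proportional to two independent vectors.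
    have hc : c = 0 := by
      have h6 : c * (C I₁ I₁ * C I₂ I₂ - C I₂ I₁ * C I₁ I₂) = 0 := by
        linear_combination (C I₁ I₂) * h4 - (C I₂ I₂) * h3 + (C I₂ I₂) * h3' - (C I₁ I₂) * h4'
      exact (mul_eq_zero.1 h6).resolve_right hdet
    rw [hc, zero_mul] at h3 h4
    rcases (by omega : (a : ℕ) = k - 1 ∨ (a : ℕ) = k ∨ k < (a : ℕ)) with h6 | h6 | h6
    · have : a = ⟨k - 1, by omega⟩ := Fin.ext h6
      rw [this]; exact h3
    · have : a = ⟨k, hkd⟩ := Fin.ext h6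
      rw [this]; exact h4
    · exact h5 a h6

/-- The tuple obtained from the `I`-th one by reversing the order of the basis vectors. -/
theorem exists_reverse_tuple (I : Fin (d.choose k)) :
    ∃ I' : Fin (d.choose k), ∀ s, tuple d k I' s = (tuple d k I s.rev).rev := by
  obtain ⟨I', h⟩ := exists_tuple_eq (OrderEmbedding.ofStrictMono
    (fun s => (tuple d k I s.rev).rev)
    (fun a b hab => Fin.rev_lt_rev.2 ((tuple d k I).strictMono (Fin.rev_lt_rev.2 hab))))
  exact ⟨I', fun s => by rw [h]; rfl⟩

/-- The transpose of a matrix with respect to the antidiagonal. -/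
def antiTranspose (p : SL(d, K)) : SL(d, K) :=
  ⟨(p : Matrix (Fin d) (Fin d) K)ᵀ.submatrix Fin.revPerm Fin.revPerm, by
    rw [Matrix.det_submatrix_equiv_self, Matrix.det_transpose, p.2]⟩

theorem antiTranspose_apply (p : SL(d, K)) (a b : Fin d) :
    (antiTranspose p : Matrix (Fin d) (Fin d) K) a b =
      (p : Matrix (Fin d) (Fin d) K) b.rev a.rev := rfl

theorem compound_antiTranspose (p : SL(d, K)) {I J I' J' : Fin (d.choose k)}
    (hI : ∀ s, tuple d k I' s = (tuple d k I s.rev).rev)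
    (hJ : ∀ s, tuple d k J' s = (tuple d k J s.rev).rev) :
    compound k (antiTranspose p : Matrix (Fin d) (Fin d) K) J I =
      compound k (p : Matrix (Fin d) (Fin d) K) I' J' := by
  rw [compound_apply, compound_apply, ← Matrix.det_transpose,
    ← Matrix.det_submatrix_equiv_self Fin.revPerm]
  congr 1
  ext a b
  simp [antiTranspose_apply, hI, hJ]

theorem first_iff_reverse_last {I I' : Fin (d.choose k)} (hkd : k < d)
    (hI : ∀ s, tuple d k I' s = (tuple d k I s.rev).rev) :
    (I : ℕ) < 1 ↔ d.choose k - 1 ≤ (I' : ℕ) := by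
  rw [lt_one_iff_tuple hkd, last_iff_tuple hkd]
  constructor
  · intro h s
    rw [hI, Fin.val_rev, h, Fin.val_rev]
    omega
  · intro h s
    have := h s.rev
    rw [hI, Fin.rev_rev, Fin.val_rev, Fin.val_rev] at this
    omega

theorem first_two_iff_reverse_last_two {I I' : Fin (d.choose k)} (hk : 1 ≤ k) (hkd : k < d)
    (hI : ∀ s, tuple d k I' s = (tuple d k I s.rev).rev) :
    (I : ℕ) < 2 ↔ d.choose k - 2 ≤ (I' : ℕ) := by
  rw [lt_two_iff_tuple hk hkd, last_two_iff_tuple hk hkd, ← lt_one_iff_tuple hkd,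
    ← last_iff_tuple hkd, first_iff_reverse_last hkd hI]
  refine or_congr Iff.rfl ⟨fun h s => ?_, fun h s => ?_⟩
  · rw [hI, Fin.val_rev, h, Fin.val_rev]
    split_ifs <;> omega
  · have := h s.rev
    rw [hI, Fin.rev_rev, Fin.val_rev, Fin.val_rev] at this
    split_ifs at this ⊢ <;> omega

theorem compound_antiTranspose_eq_zero (p : SL(d, K)) {m : ℕ}
    (hm : ∀ I I' : Fin (d.choose k), (∀ s, tuple d k I' s = (tuple d k I s.rev).rev) →
      ((I : ℕ) < m ↔ d.choose k - m ≤ (I' : ℕ)))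
    (h : ∀ J I : Fin (d.choose k), (I : ℕ) < d.choose k - m → d.choose k - m ≤ (J : ℕ) →
      compound k (p : Matrix (Fin d) (Fin d) K) J I = 0) (J I : Fin (d.choose k))
    (hI : (I : ℕ) < m) (hJ : m ≤ (J : ℕ)) :
    compound k (antiTranspose p : Matrix (Fin d) (Fin d) K) J I = 0 := by
  obtain ⟨I', hI'⟩ := exists_reverse_tuple I
  obtain ⟨J', hJ'⟩ := exists_reverse_tuple J
  rw [compound_antiTranspose p hI' hJ']
  refine h _ _ ?_ ((hm I I' hI').1 hI)
  by_contra hcon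
  have := (hm J J' hJ').2 (by omega)
  omega

/-- The converse of `subordinate_theta`. The blocks at `k` and `k ± 1` come from `p`, those at `d -
k` and `d - k ± 1` from its antidiagonal transpose, which exchanges the first and the last tuples.
-/
theorem block_of_compound (hk : 1 ≤ k) (hkd : k < d) (p : SL(d, K))
    (h : ∀ j ∈ theta (d.choose k) 1, ∀ J I : Fin (d.choose k), (I : ℕ) < j → j ≤ (J : ℕ) →
      compound k (p : Matrix (Fin d) (Fin d) K) J I = 0) {i : ℕ} (hi : i ∈ theta d k)
    (a b : Fin d) (hb : (b : ℕ) < i) (ha : i ≤ (a : ℕ)) :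
    (p : Matrix (Fin d) (Fin d) K) a b = 0 := by
  have hD := two_le_choose hk hkd
  have hrev : ∀ {i : ℕ}, (∀ a b : Fin d, (b : ℕ) < d - i → d - i ≤ (a : ℕ) →
      (antiTranspose p : Matrix (Fin d) (Fin d) K) a b = 0) →
      (b : ℕ) < i → i ≤ (a : ℕ) → (p : Matrix (Fin d) (Fin d) K) a b = 0 := by
    intro i h1 hb ha
    have h2 := h1 b.rev a.rev (by rw [Fin.val_rev]; omega) (by rw [Fin.val_rev]; omega)
    rwa [antiTranspose_apply, Fin.rev_rev, Fin.rev_rev] at h2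
  have h1 := block_of_compound_one hk hkd p (h 1 (by rw [mem_theta_one hD]; omega))
  have h1' := block_of_compound_one hk hkd (antiTranspose p)
    (compound_antiTranspose_eq_zero p (fun I I' => first_iff_reverse_last hkd)
      (h (d.choose k - 1) (by rw [mem_theta_one hD]; omega)))
  have h2 : 2 < d.choose k → _ := fun h3 =>
    block_of_compound_two hk hkd p (h 2 (by rw [mem_theta_one hD]; omega))
  have h2' : 2 < d.choose k → _ := fun h3 =>
    block_of_compound_two hk hkd (antiTranspose p)
    (compound_antiTranspose_eq_zero p (fun I I' => first_two_iff_reverse_last_two hk hkd)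
      (h (d.choose k - 2) (by rw [mem_theta_one hD]; omega)))
  -- For `d = 2` the plane of the first two basis vectors is the whole space and carries no
  -- information, but then `θ_k = {1}` and the dimensions `k ± 1` are not needed.
  have hD2 : d ≠ 2 → 2 < d.choose k := by
    intro hd
    rcases Nat.lt_or_ge 2 (d.choose k) with h3 | h3
    · exact h3
    · exfalso
      have h4 : ∀ I : Fin (d.choose k), (I : ℕ) < 2 := fun I => by omega
      obtain ⟨d, rfl⟩ : ∃ e, d = e + 1 := ⟨d - 1, by omega⟩
      obtain ⟨k, rfl⟩ : ∃ e, k = e + 1 := ⟨k - 1, by omega⟩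
      rw [Nat.choose_succ_succ'] at h3
      by_cases h5 : k + 1 < d
      · have h6 := two_le_choose (k := k + 1) (d := d) (by omega) h5
        have h7 := Nat.choose_pos (n := d) (k := k) (by omega)
        omega
      · obtain rfl : d = k + 1 := by omega
        have h6 := two_le_choose (k := k) (d := k + 1) (by omega) (by omega)
        have h7 := Nat.choose_pos (n := k + 1) (k := k + 1) le_rfl
        omega
  rw [mem_theta] at hi
  obtain ⟨hi, hi1, hi2⟩ := hi
  rcases hi with rfl | rfl | rfl | rfl | rfl | rfl
  · exact (h2 (hD2 (by omega))).2 a b hb ha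
  · exact h1 a b hb ha
  · exact (h2 (hD2 (by omega))).1 a b hb ha
  · refine hrev (i := d - k - 1) (fun a b hb ha => (h2' (hD2 (by omega))).1 a b ?_ ?_) hb ha <;>
      omega
  · refine hrev (i := d - k) (fun a b hb ha => h1' a b ?_ ?_) hb ha <;> omega
  · refine hrev (i := d - k + 1) (fun a b hb ha => (h2' (hD2 (by omega))).2 a b ?_ ?_) hb ha <;>
      omega

/-! ### The closed embedding of flags of type `θ_k` -/

theorem theta_le (hkd : k < d) : ∀ j ∈ theta d k, j ≤ d := by
  intro j hj
  rw [mem_theta] at hj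
  omega

theorem theta_one_le (hk : 1 ≤ k) (hkd : k < d) : ∀ j ∈ theta (d.choose k) 1, j ≤ d.choose k := by
  intro j hj
  rw [mem_theta_one (two_le_choose hk hkd)] at hj
  omega

/-- The map from flags of type `θ_k` in `K^d` to flags of type `θ_1` in `⋀^k K^d`. -/
noncomputable def thetaFlag (hk : 1 ≤ k) (hkd : k < d) (x : Flag K d (theta d k)) :
    Flag K (d.choose k) (theta (d.choose k) 1) :=
  wedgeFlag hk (theta_le hkd) (theta_one_le hk hkd) x

theorem thetaFlag_stdFlag (hk : 1 ≤ k) (hkd : k < d) (g : SL(d, K)) :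
    thetaFlag hk hkd (stdFlag (theta_le hkd) g) =
      stdFlag (theta_one_le hk hkd) (compoundSL hk g) :=
  wedgeFlag_stdFlag hk _ _ (fun _ => subordinate_theta hk hkd) g

theorem continuous_thetaFlag (hk : 1 ≤ k) (hkd : k < d) :
    Continuous (thetaFlag hk hkd : Flag K d (theta d k) → _) :=
  continuous_wedgeFlag hk _ _ (fun _ => subordinate_theta hk hkd)

theorem thetaFlag_injective (hk : 1 ≤ k) (hkd : k < d) :
    Function.Injective (thetaFlag hk hkd : Flag K d (theta d k) → _) := by
  intro x y hxy
  obtain ⟨g, -, rfl⟩ := exists_stdFlag_eq (theta_le hkd) x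
  obtain ⟨h, -, rfl⟩ := exists_stdFlag_eq (theta_le hkd) y
  rw [thetaFlag_stdFlag, thetaFlag_stdFlag, stdFlag_eq_iff] at hxy
  rw [stdFlag_eq_iff]
  intro i hi
  rw [map_stdSpace_eq_iff (theta_le hkd i hi)]
  refine block_of_compound hk hkd _ (fun j hj J I hI hJ => ?_) hi
  have h1 := hxy j hj
  rw [← map_inv, ← map_mul, map_stdSpace_eq_iff (theta_one_le hk hkd j hj)] at h1
  exact h1 J I hI hJ

theorem isClosedEmbedding_thetaFlag (hk : 1 ≤ k) (hkd : k < d) :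
    IsClosedEmbedding (thetaFlag hk hkd : Flag K d (theta d k) → _) := by
  have : CompactSpace (Flag K d (theta d k)) := ⟨isCompact_univ_flag (theta_le hkd)⟩
  exact (continuous_thetaFlag hk hkd).isClosedEmbedding (thetaFlag_injective hk hkd)

/-! ### Singular value decompositions -/

theorem eq_of_antitone_of_multiset_eq {n : ℕ} {a b : Fin n → ℝ} (ha : Antitone a)
    (hb : Antitone b) (h : Multiset.map a Finset.univ.val = Multiset.map b Finset.univ.val) :
    a = b := by
  rw [Fin.univ_val_map, Fin.univ_val_map, Multiset.coe_eq_coe] at h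
  exact List.ofFn_injective (h.eq_of_sortedGE ha.sortedGE_ofFn hb.sortedGE_ofFn)

theorem IsSU.star_mul_self {m : SL(d, K)} (hm : IsSU m) :
    (m : Matrix (Fin d) (Fin d) K)ᴴ * (m : Matrix (Fin d) (Fin d) K) = 1 := by
  rw [IsSU, Matrix.mem_unitaryGroup_iff'] at hm
  exact hm

theorem IsSU.conjTranspose_eq {m : SL(d, K)} (hm : IsSU m) :
    (m : Matrix (Fin d) (Fin d) K)ᴴ = ((m⁻¹ : SL(d, K)) : Matrix (Fin d) (Fin d) K) := by
  rw [← Matrix.mul_one (m : Matrix (Fin d) (Fin d) K)ᴴ, ← Matrix.SpecialLinearGroup.coe_one,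
    ← mul_inv_cancel m, Matrix.SpecialLinearGroup.coe_mul, ← Matrix.mul_assoc, hm.star_mul_self,
    Matrix.one_mul]

theorem expDiag_conjTranspose (A : Fin d → ℝ) : (expDiag K A)ᴴ = expDiag K A := by
  rw [expDiag, Matrix.diagonal_conjTranspose]
  congr 1
  funext i
  simp

theorem expDiag_mul (A B : Fin d → ℝ) : expDiag K A * expDiag K B = expDiag K (A + B) := by
  rw [expDiag, expDiag, expDiag, Matrix.diagonal_mul_diagonal]
  congr 1
  funext i
  rw [Pi.add_apply, Real.exp_add]
  push_cast
  rfl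

theorem toEuclideanLin_mul_apply (P Q : Matrix (Fin d) (Fin d) K) (v : Vec K d) :
    Matrix.toEuclideanLin (P * Q) v = Matrix.toEuclideanLin P (Matrix.toEuclideanLin Q v) :=
  LinearMap.congr_fun (Matrix.toLpLin_mul_same 2 P Q) v

theorem toEuclideanLin_coe (g : SL(d, K)) (v : Vec K d) :
    Matrix.toEuclideanLin (g : Matrix (Fin d) (Fin d) K) v = slEquiv g v := rfl

theorem adjoint_comp_slEquiv (g : SL(d, K)) :
    LinearMap.adjoint (slEquiv g).toLinearMap ∘ₗ (slEquiv g).toLinearMap =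
      Matrix.toEuclideanLin
        ((g : Matrix (Fin d) (Fin d) K)ᴴ * (g : Matrix (Fin d) (Fin d) K)) := by
  rw [slEquiv_eq_toEuclideanLin, ← Matrix.toEuclideanLin_conjTranspose_eq_adjoint]
  exact (Matrix.toLpLin_mul_same 2 _ _).symm

theorem conjTranspose_mul_self_of_svd {g m₁ m₂ : SL(d, K)} {A : Fin d → ℝ} (h₁ : IsSU m₁)
    (h₂ : IsSU m₂) (h : (g : Matrix (Fin d) (Fin d) K) = m₁ * expDiag K A * m₂) :
    (g : Matrix (Fin d) (Fin d) K)ᴴ * (g : Matrix (Fin d) (Fin d) K) =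
      ((m₂⁻¹ : SL(d, K)) : Matrix (Fin d) (Fin d) K) * expDiag K (A + A) * m₂ := by
  rw [h, Matrix.conjTranspose_mul, Matrix.conjTranspose_mul, expDiag_conjTranspose,
    h₂.conjTranspose_eq]
  calc _ = ((m₂⁻¹ : SL(d, K)) : Matrix (Fin d) (Fin d) K) * (expDiag K A *
        ((m₁ : Matrix (Fin d) (Fin d) K)ᴴ * (m₁ : Matrix (Fin d) (Fin d) K)) * expDiag K A) * m₂ := by
        simp only [Matrix.mul_assoc]
    _ = _ := by rw [h₁.star_mul_self, Matrix.mul_one, expDiag_mul]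

/-- The basis `m₂⁻¹ e_i` diagonalizes `g* g` with eigenvalues `exp(2 A_i)`. These and the sorted
eigenvalues are both the roots of the characteristic polynomial, and two decreasing families with
the same multiset of values coincide. -/
theorem singularValues_of_svd {g m₁ m₂ : SL(d, K)} {A : Fin d → ℝ} (hA : Antitone A)
    (h₁ : IsSU m₁) (h₂ : IsSU m₂)
    (h : (g : Matrix (Fin d) (Fin d) K) = m₁ * expDiag K A * m₂) (i : Fin d) :
    (slEquiv g).toLinearMap.singularValues (i : ℕ) = Real.exp (A i) := by
  set T := (slEquiv g).toLinearMap with hT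
  have hn : Module.finrank K (Vec K d) = d := finrank_euclideanSpace_fin
  set S := LinearMap.adjoint T ∘ₗ T with hS
  have hsym : S.IsSymmetric := T.isSymmetric_adjoint_comp_self
  let b := (EuclideanSpace.basisFun (Fin d) K).toBasis.map (slEquiv m₂⁻¹)
  have hb : ∀ i, S (b i) = ((Real.exp (A i + A i) : ℝ) : K) • b i := by
    intro i
    have hbi : b i = slEquiv m₂⁻¹ (EuclideanSpace.single i 1) := by simp [b]
    have h3 : S = Matrix.toEuclideanLin
        (((m₂⁻¹ : SL(d, K)) : Matrix (Fin d) (Fin d) K) * expDiag K (A + A) *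
          (m₂ : Matrix (Fin d) (Fin d) K)) := by
      rw [hS, hT, adjoint_comp_slEquiv, conjTranspose_mul_self_of_svd h₁ h₂ h]
    have h4 : S (b i) = slEquiv m₂⁻¹ (Matrix.toEuclideanLin (expDiag K (A + A))
        (slEquiv m₂ (slEquiv m₂⁻¹ (EuclideanSpace.single i 1)))) := by
      rw [hbi, h3, toEuclideanLin_mul_apply, toEuclideanLin_mul_apply, toEuclideanLin_coe,
        toEuclideanLin_coe]
    rw [h4, slEquiv_apply_inv_self, hbi, ← map_smul]
    congr 1
    ext l
    simp [Matrix.toLpLin_apply, expDiag, RCLike.real_smul_eq_coe_mul]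
  have hmat : LinearMap.toMatrix b b S =
      Matrix.diagonal fun i => ((Real.exp (A i + A i) : ℝ) : K) := by
    ext i l
    rw [LinearMap.toMatrix_apply, hb, map_smul, Module.Basis.repr_self, Matrix.diagonal_apply]
    by_cases hil : i = l
    · subst hil; simp [RCLike.real_smul_eq_coe_mul]
    · simp [hil]
  have hroots := hsym.roots_charpoly_eq_eigenvalues hn
  rw [← LinearMap.charpoly_toMatrix S b, hmat, Matrix.charpoly_diagonal,
    Polynomial.roots_prod _ _
      (by simp [Finset.prod_ne_zero_iff, Polynomial.X_sub_C_ne_zero])] at hroots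
  have hroots2 := congrArg (Multiset.map (RCLike.re : K → ℝ)) hroots
  simp only [Polynomial.roots_X_sub_C, Multiset.bind_singleton, Multiset.map_map] at hroots2
  have heq : (fun i => Real.exp (A i + A i)) = hsym.eigenvalues hn := by
    refine eq_of_antitone_of_multiset_eq ?_ (hsym.eigenvalues_antitone hn) ?_
    · intro a b hab
      exact Real.exp_le_exp.2 (add_le_add (hA hab) (hA hab))
    · simpa [Function.comp_def] using hroots2
  rw [T.singularValues_fin hn i]
  have h6 := congrFun heq i
  change √(hsym.eigenvalues hn i) = _
  rw [← h6, Real.exp_add, Real.sqrt_mul_self (Real.exp_pos _).le]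

/-- With `n` a special unitary eigenbasis of `g* g` and `A` the logarithms of the singular values,
`m₁ = g n exp(-A)` is unitary and `m₂ = n⁻¹`. -/
theorem exists_svd (g : SL(d, K)) : ∃ (A : Fin d → ℝ) (m₁ m₂ : SL(d, K)), Antitone A ∧
    IsSU m₁ ∧ IsSU m₂ ∧ (g : Matrix (Fin d) (Fin d) K) = m₁ * expDiag K A * m₂ := by
  set T := (slEquiv g).toLinearMap with hT
  have hn : Module.finrank K (Vec K d) = d := finrank_euclideanSpace_fin
  set S := LinearMap.adjoint T ∘ₗ T with hS
  have hsym : S.IsSymmetric := T.isSymmetric_adjoint_comp_self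
  set σ : Fin d → ℝ := fun i => T.singularValues i with hσ
  have hσpos : ∀ i, 0 < σ i := by
    have h1 : Function.Injective T := (slEquiv g).injective
    rw [T.injective_iff_forall_lt_finrank_singularValues_pos, hn] at h1
    exact fun i => h1 i i.2
  obtain ⟨n, hnSU, hnb⟩ := exists_isSU_of_orthonormal _ (hsym.eigenvectorBasis hn).orthonormal
  have hnS : ∀ i, S (slEquiv n (EuclideanSpace.single i 1)) =
      ((σ i ^ 2 : ℝ) : K) • slEquiv n (EuclideanSpace.single i 1) := by
    intro i
    obtain ⟨c, hc⟩ := hnb i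
    rw [hc, map_smul, hsym.apply_eigenvectorBasis, hσ]
    simp only
    rw [T.sq_singularValues_fin hn, smul_comm]
  set G := (g : Matrix (Fin d) (Fin d) K) with hG
  set N := (n : Matrix (Fin d) (Fin d) K) with hN
  set A : Fin d → ℝ := fun i => Real.log (σ i) with hA
  have hexp : ∀ i, Real.exp (A i) = σ i := fun i => Real.exp_log (hσpos i)
  have hdiag : Nᴴ * (Gᴴ * G) * N = expDiag K (A + A) := by
    have h1 : Gᴴ * G * N = N * expDiag K (A + A) := by
      ext i l
      have h2 := congrArg (fun v : Vec K d => v i) (hnS l)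
      rw [hS, hT, adjoint_comp_slEquiv] at h2
      rw [expDiag, Matrix.mul_diagonal, Pi.add_apply, Real.exp_add, hexp, ← pow_two]
      rw [PiLp.smul_apply, slEquiv_single, smul_eq_mul, mul_comm] at h2
      rw [← h2, Matrix.toLpLin_apply]
      simp only [Matrix.mul_apply, Matrix.mulVec, dotProduct, slEquiv_single]
      rfl
    rw [Matrix.mul_assoc, h1, ← Matrix.mul_assoc, hnSU.star_mul_self, Matrix.one_mul]
  have hinv : ∀ B : Fin d → ℝ, expDiag K B * expDiag K (-B) = 1 := by
    intro B
    rw [expDiag_mul, add_neg_cancel, expDiag]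
    simp
  set M₁ := G * N * expDiag K (-A) with hM₁
  have hM₁u : M₁ᴴ * M₁ = 1 := by
    have h1 : M₁ᴴ * M₁ = expDiag K (-A) * (Nᴴ * (Gᴴ * G) * N) * expDiag K (-A) := by
      rw [hM₁, Matrix.conjTranspose_mul, Matrix.conjTranspose_mul, expDiag_conjTranspose]
      simp only [Matrix.mul_assoc]
    rw [h1, hdiag, expDiag_mul, expDiag_mul]
    have : -A + (A + A) + -A = 0 := by abel
    rw [this, expDiag]
    simp
  -- The determinant has modulus one because `M₁` is unitary, and it is a positive real product of
  -- exponentials, hence it equals one.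
  have hM₁det : M₁.det = 1 := by
    have h1 : M₁.det = ((∏ i, Real.exp ((-A) i) : ℝ) : K) := by
      rw [hM₁, Matrix.det_mul, Matrix.det_mul, hG, hN, Matrix.SpecialLinearGroup.det_coe,
        Matrix.SpecialLinearGroup.det_coe, expDiag, Matrix.det_diagonal]
      push_cast
      simp
    have h2 : ‖M₁.det‖ = 1 := by
      have h3 := congrArg (fun X : Matrix (Fin d) (Fin d) K => ‖X.det‖) hM₁u
      simp only [Matrix.det_mul, Matrix.det_conjTranspose, Matrix.det_one, norm_mul, norm_star,
        norm_one] at h3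
      nlinarith [norm_nonneg M₁.det]
    have h3 : 0 < ∏ i, Real.exp ((-A) i) := Finset.prod_pos fun i _ => Real.exp_pos _
    rw [h1, RCLike.norm_ofReal, abs_of_pos h3] at h2
    rw [h1, h2, RCLike.ofReal_one]
  refine ⟨A, ⟨M₁, hM₁det⟩, n⁻¹, ?_, ?_, hnSU.inv, ?_⟩
  · intro a b hab
    exact Real.log_le_log (hσpos b) (T.singularValues_antitone hab)
  · exact Matrix.mem_unitaryGroup_iff'.2 hM₁u
  · change G = M₁ * expDiag K A * ((n⁻¹ : SL(d, K)) : Matrix (Fin d) (Fin d) K)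
    have h1 : expDiag K (-A) * expDiag K A = 1 := by simpa using hinv (-A)
    rw [hM₁, Matrix.mul_assoc (G * N), h1, Matrix.mul_one, Matrix.mul_assoc, hN,
      ← Matrix.SpecialLinearGroup.coe_mul, mul_inv_cancel, Matrix.SpecialLinearGroup.coe_one,
      Matrix.mul_one]

theorem norm_eq_one_of_pow {c : K} (hd : d ≠ 0) (hc : c ^ d = 1) : ‖c‖ = 1 := by
  have h := congrArg norm hc
  rw [norm_pow, norm_one] at h
  exact (pow_eq_one_iff_of_nonneg (norm_nonneg _) hd).1 h

theorem exists_isSU_smul {m : SL(d, K)} (hm : IsSU m) {c : K} (hc : c ^ d = 1) :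
    ∃ m' : SL(d, K), IsSU m' ∧
      (m' : Matrix (Fin d) (Fin d) K) = c • (m : Matrix (Fin d) (Fin d) K) := by
  rcases Nat.eq_zero_or_pos d with rfl | hd
  · exact ⟨m, hm, Subsingleton.elim _ _⟩
  refine ⟨⟨c • (m : Matrix (Fin d) (Fin d) K), ?_⟩, ?_, rfl⟩
  · rw [Matrix.det_smul, Fintype.card_fin, hc, one_mul, Matrix.SpecialLinearGroup.det_coe]
  · refine Matrix.mem_unitaryGroup_iff'.2 ?_
    change (c • (m : Matrix (Fin d) (Fin d) K))ᴴ * (c • (m : Matrix (Fin d) (Fin d) K)) = 1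
    rw [Matrix.conjTranspose_smul, Matrix.smul_mul, Matrix.mul_smul, smul_smul, hm.star_mul_self,
      RCLike.star_def, RCLike.conj_mul, norm_eq_one_of_pow hd.ne' hc]
    simp

theorem cartan_of_svd {g m₁ m₂ : SL(d, K)} {A : Fin d → ℝ} (hA : Antitone A)
    (h₁ : IsSU m₁) (h₂ : IsSU m₂)
    (h : (g : Matrix (Fin d) (Fin d) K) = m₁ * expDiag K A * m₂) : cartan (g : PSL(d, K)) = A := by
  funext i
  obtain ⟨c, hc, hcg⟩ := coe_eq_coe_iff.1 (coe_pslLift (g : PSL(d, K))).symm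
  obtain ⟨m, hm, hmc⟩ := exists_isSU_smul h₁ hc
  rw [cartan, singularValues_of_svd hA hm h₂ (by rw [hcg, h, hmc]; simp),
    Real.log_exp]

theorem exists_svd_cartan (g : SL(d, K)) : Antitone (cartan (g : PSL(d, K))) ∧
    ∃ m₁ m₂ : SL(d, K), IsSU m₁ ∧ IsSU m₂ ∧
      (g : Matrix (Fin d) (Fin d) K) = m₁ * expDiag K (cartan (g : PSL(d, K))) * m₂ := by
  obtain ⟨A, m₁, m₂, hA, h₁, h₂, h⟩ := exists_svd g
  rw [cartan_of_svd hA h₁ h₂ h]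
  exact ⟨hA, m₁, m₂, h₁, h₂, h⟩

/-! ### Sorting the exponents of a singular value decomposition -/

theorem simpleRoot_apply (hj : 1 ≤ j) (hjd : j < d) (A : Fin d → ℝ) :
    simpleRoot d j A = A ⟨j - 1, by omega⟩ - A ⟨j, hjd⟩ := by
  have h1 : 1 ≤ j ∧ j ≤ d := ⟨hj, hjd.le⟩
  have h2 : 1 ≤ j + 1 ∧ j + 1 ≤ d := ⟨by omega, hjd⟩
  simp [simpleRoot, entry, h1, h2]

/-- The tuple sums that arise from an exterior power are not decreasing in the lexicographic order.
A monomial matrix `P` in the special unitary group sorts them and is absorbed into both unitary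
factors. -/
theorem exists_sorted_svd {g m₁ m₂ : SL(d, K)} {B : Fin d → ℝ} (h₁ : IsSU m₁) (h₂ : IsSU m₂)
    (h : (g : Matrix (Fin d) (Fin d) K) = m₁ * expDiag K B * m₂) :
    ∃ π : Equiv.Perm (Fin d), Antitone (B ∘ π) ∧ cartan (g : PSL(d, K)) = B ∘ π ∧
      ∃ P : SL(d, K), IsSU P ∧
        (∀ i, ∃ c : K, slEquiv P (EuclideanSpace.single i 1) =
          c • EuclideanSpace.single (π i) 1) ∧
        (g : Matrix (Fin d) (Fin d) K) = (m₁ * P : SL(d, K)) *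
          expDiag K (cartan (g : PSL(d, K))) * (P⁻¹ * m₂ : SL(d, K)) := by
  set π := Tuple.sort (-B) with hπ
  have hanti : Antitone (B ∘ π) := by
    intro a b hab
    have := Tuple.monotone_sort (-B) hab
    simpa using this
  obtain ⟨P, hP, hPe⟩ := exists_isSU_of_orthonormal
    (fun i => EuclideanSpace.basisFun (Fin d) K (π i))
    ((EuclideanSpace.basisFun (Fin d) K).orthonormal.comp π π.injective)
  have hPe' : ∀ i, ∃ c : K, slEquiv P (EuclideanSpace.single i 1) =
      c • EuclideanSpace.single (π i) 1 := by
    intro i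
    obtain ⟨c, hc⟩ := hPe i
    exact ⟨c, by simpa using hc⟩
  have hcomm : expDiag K B * (P : Matrix (Fin d) (Fin d) K) = P * expDiag K (B ∘ π) := by
    ext a i
    rw [expDiag, expDiag, Matrix.diagonal_mul, Matrix.mul_diagonal, ← slEquiv_single]
    obtain ⟨c, hc⟩ := hPe' i
    rw [hc]
    by_cases ha : a = π i
    · subst ha; simp [mul_comm]
    · simp [ha]
  have hdec : (g : Matrix (Fin d) (Fin d) K) = (m₁ * P : SL(d, K)) *
      expDiag K (B ∘ π) * (P⁻¹ * m₂ : SL(d, K)) := by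
    rw [h, Matrix.SpecialLinearGroup.coe_mul, Matrix.SpecialLinearGroup.coe_mul,
      Matrix.mul_assoc (m₁ : Matrix (Fin d) (Fin d) K) (P : Matrix (Fin d) (Fin d) K), ← hcomm]
    simp only [Matrix.mul_assoc]
    rw [← Matrix.mul_assoc (P : Matrix (Fin d) (Fin d) K), ← Matrix.SpecialLinearGroup.coe_mul,
      mul_inv_cancel, Matrix.SpecialLinearGroup.coe_one, Matrix.one_mul]
  have hcar := cartan_of_svd hanti (h₁.mul hP) (hP.inv.mul h₂) hdec
  exact ⟨π, hanti, hcar, P, hP, hPe', by rw [hcar]; exact hdec⟩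

/-- If the first `j` exponents all exceed the others, sorting can only permute within the two
groups: an index leaving the first group would force another to enter it, in the wrong order. -/
theorem perm_lt_of_gap {B : Fin d → ℝ} {π : Equiv.Perm (Fin d)} (hπ : Antitone (B ∘ π))
    (hgap : ∀ a b : Fin d, (a : ℕ) < j → j ≤ (b : ℕ) → B b < B a) (i : Fin d) :
    (π i : ℕ) < j ↔ (i : ℕ) < j := by
  have h1 : ∀ i : Fin d, (i : ℕ) < j → (π i : ℕ) < j := by
    intro i hi
    by_contra hcon
    have hex : ∃ i' : Fin d, j ≤ (i' : ℕ) ∧ (π i' : ℕ) < j := by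
      by_contra! hall
      have hc := Finset.card_lt_card (s := (Finset.univ.filter fun a : Fin d => j ≤ (a : ℕ)).map
        π.toEmbedding) (t := Finset.univ.filter fun a : Fin d => j ≤ (a : ℕ)) ?_
      · simp at hc
      · rw [Finset.ssubset_iff_of_subset]
        · refine ⟨π i, by simpa using hcon, ?_⟩
          simpa using hi
        · intro b hb
          obtain ⟨a, ha, rfl⟩ := Finset.mem_map.1 hb
          simpa using hall a (by simpa using ha)
    obtain ⟨i', hi', hπi'⟩ := hex
    have h2 := hgap (π i') (π i) hπi' (not_lt.1 hcon)
    have h3 : B (π i') ≤ B (π i) := hπ (Fin.le_def.2 (by omega))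
    exact absurd h2 h3.not_gt
  refine ⟨fun h => ?_, h1 i⟩
  by_contra hcon
  have hc := Finset.card_lt_card (s := (Finset.univ.filter fun a : Fin d => (a : ℕ) < j).map
    π.toEmbedding) (t := Finset.univ.filter fun a : Fin d => (a : ℕ) < j) ?_
  · simp at hc
  · rw [Finset.ssubset_iff_of_subset]
    · refine ⟨π i, by simpa using h, ?_⟩
      simpa using hcon
    · intro b hb
      obtain ⟨a, ha, rfl⟩ := Finset.mem_map.1 hb
      simpa using h1 a (by simpa using ha)

theorem le_simpleRoot_of_gap {g m₁ m₂ : SL(d, K)} {B : Fin d → ℝ} (h₁ : IsSU m₁) (h₂ : IsSU m₂)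
    (h : (g : Matrix (Fin d) (Fin d) K) = m₁ * expDiag K B * m₂) (hj : 1 ≤ j) (hjd : j < d)
    {ε : ℝ} (hε : 0 < ε)
    (hgap : ∀ a b : Fin d, (a : ℕ) < j → j ≤ (b : ℕ) → ε ≤ B a - B b) :
    ε ≤ simpleRoot d j (cartan (g : PSL(d, K))) := by
  obtain ⟨π, hπ, hcar, -⟩ := exists_sorted_svd h₁ h₂ h
  have h3 := perm_lt_of_gap (j := j) hπ (fun a b ha hb => by linarith [hgap a b ha hb])
  rw [simpleRoot_apply hj hjd, hcar]
  refine hgap _ _ ((h3 _).2 (by simp only; omega)) ?_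
  rw [← not_lt, h3]
  simp

/-- Sorting preserves the standard subspaces at the dimensions where there is a gap, so an unsorted
decomposition already displays the Cartan flag. -/
theorem isCartanFlag_of_gap (hθ : ∀ j ∈ θ, 1 ≤ j ∧ j < d) (hθ' : ∀ j ∈ θ, j ≤ d)
    {g m₁ m₂ : SL(d, K)} {B : Fin d → ℝ}
    (h₁ : IsSU m₁) (h₂ : IsSU m₂) (h : (g : Matrix (Fin d) (Fin d) K) = m₁ * expDiag K B * m₂)
    {ε : ℝ} (hε : 0 < ε)
    (hgap : ∀ j ∈ θ, ∀ a b : Fin d, (a : ℕ) < j → j ≤ (b : ℕ) → ε ≤ B a - B b) :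
    IsCartanFlag (g : PSL(d, K)) (stdFlag hθ' m₁) := by
  refine ⟨fun j hj => hε.trans_le
    (le_simpleRoot_of_gap h₁ h₂ h (hθ j hj).1 (hθ j hj).2 hε (hgap j hj)), ?_⟩
  obtain ⟨π, hπ, hcar, P, hP, hPe, hdec⟩ := exists_sorted_svd h₁ h₂ h
  refine ⟨g, m₁ * P, P⁻¹ * m₂, rfl, h₁.mul hP, hP.inv.mul h₂, hdec, fun j => ?_⟩
  rw [stdFlag_carrier, map_slEquiv_mul]
  congr 1
  have h3 := perm_lt_of_gap (j := (j : ℕ)) hπ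
    (fun a b ha hb => by linarith [hgap j j.2 a b ha hb])
  have h4 := (Gr.move_std_eq_iff (hθ' j j.2) P (Gr.std K d j (hθ' j j.2))).2 fun i hi => by
    obtain ⟨c, hc⟩ := hPe i
    rw [hc]
    exact Submodule.smul_mem _ _ (single_mem_stdSpace ((h3 i).2 hi))
  exact (congrArg Gr.carrier h4).symm

theorem exists_isCartanFlag (hθ' : ∀ j ∈ θ, j ≤ d) (g : PSL(d, K))
    (hg : ∀ j ∈ θ, 0 < simpleRoot d j (cartan g)) : ∃ x : Flag K d θ, IsCartanFlag g x := by
  obtain ⟨g, rfl⟩ := QuotientGroup.mk_surjective g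
  obtain ⟨-, m₁, m₂, h₁, h₂, h⟩ := exists_svd_cartan g
  exact ⟨stdFlag hθ' m₁, hg, g, m₁, m₂, rfl, h₁, h₂, h, fun j => rfl⟩

theorem mul_conjTranspose_of_svd {g m₁ m₂ : SL(d, K)} {A : Fin d → ℝ} (h₁ : IsSU m₁)
    (h₂ : IsSU m₂) (h : (g : Matrix (Fin d) (Fin d) K) = m₁ * expDiag K A * m₂) :
    (g : Matrix (Fin d) (Fin d) K) * (g : Matrix (Fin d) (Fin d) K)ᴴ =
      (m₁ : Matrix (Fin d) (Fin d) K) * expDiag K (A + A) * (m₁⁻¹ : SL(d, K)) := by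
  rw [h, Matrix.conjTranspose_mul, Matrix.conjTranspose_mul, expDiag_conjTranspose,
    h₁.conjTranspose_eq]
  have h3 : (m₂ : Matrix (Fin d) (Fin d) K) * (m₂ : Matrix (Fin d) (Fin d) K)ᴴ = 1 := by
    rw [h₂.conjTranspose_eq, ← Matrix.SpecialLinearGroup.coe_mul, mul_inv_cancel,
      Matrix.SpecialLinearGroup.coe_one]
  calc _ = (m₁ : Matrix (Fin d) (Fin d) K) * (expDiag K A *
        ((m₂ : Matrix (Fin d) (Fin d) K) * (m₂ : Matrix (Fin d) (Fin d) K)ᴴ) * expDiag K A) *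
          (m₁⁻¹ : SL(d, K)) := by
        simp only [Matrix.mul_assoc]
    _ = _ := by rw [h3, Matrix.mul_one, expDiag_mul]

/-- Two decompositions give the same `g g*`, so `m₁⁻¹ n₁` commutes with `exp(2A)`. Its entries
between different exponents vanish, and a positive root at `j` makes it block triangular there. -/
theorem IsCartanFlag.unique (hθ : ∀ j ∈ θ, 1 ≤ j ∧ j < d) {g : PSL(d, K)} {x y : Flag K d θ}
    (hx : IsCartanFlag g x) (hy : IsCartanFlag g y) : x = y := by
  obtain ⟨hpos, g₁, m₁, m₂, rfl, hm₁, hm₂, hm, hxm⟩ := hx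
  obtain ⟨-, g₂, n₁, n₂, hg, hn₁, hn₂, hn, hyn⟩ := hy
  rcases Nat.eq_zero_or_pos d with rfl | hd
  · refine Flag.ext (funext fun j => absurd (hθ j j.2) (by omega))
  have hθ' : ∀ j ∈ θ, j ≤ d := fun j hj => (hθ j hj).2.le
  have hx' : x = stdFlag hθ' m₁ := Flag.ext (funext fun j => Gr.ext (hxm j))
  have hy' : y = stdFlag hθ' n₁ := Flag.ext (funext fun j => Gr.ext (hyn j))
  rw [hx', hy', stdFlag_eq_iff]
  set A := cartan (g₁ : PSL(d, K)) with hA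
  have hAanti : Antitone A := (exists_svd_cartan g₁).1
  obtain ⟨c, hc, hcg⟩ := coe_eq_coe_iff.1 hg.symm
  have h1 := mul_conjTranspose_of_svd hm₁ hm₂ hm
  have h2 := mul_conjTranspose_of_svd hn₁ hn₂ hn
  have h3 : (g₂ : Matrix (Fin d) (Fin d) K) * (g₂ : Matrix (Fin d) (Fin d) K)ᴴ =
      (g₁ : Matrix (Fin d) (Fin d) K) * (g₁ : Matrix (Fin d) (Fin d) K)ᴴ := by
    rw [hcg, Matrix.conjTranspose_smul, Matrix.smul_mul, Matrix.mul_smul, smul_smul,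
      RCLike.star_def, RCLike.mul_conj, norm_eq_one_of_pow hd.ne' hc]
    simp
  rw [h1, h2] at h3
  have h4 : ((m₁⁻¹ * n₁ : SL(d, K)) : Matrix (Fin d) (Fin d) K) * expDiag K (A + A) =
      expDiag K (A + A) * ((m₁⁻¹ * n₁ : SL(d, K)) : Matrix (Fin d) (Fin d) K) := by
    have h5 := congrArg (fun X => ((m₁⁻¹ : SL(d, K)) : Matrix (Fin d) (Fin d) K) * X *
      (n₁ : Matrix (Fin d) (Fin d) K)) h3
    simp only [Matrix.mul_assoc] at h5
    rw [← Matrix.SpecialLinearGroup.coe_mul n₁⁻¹, inv_mul_cancel,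
      Matrix.SpecialLinearGroup.coe_one, Matrix.mul_one, ← Matrix.mul_assoc, ← Matrix.mul_assoc,
      ← Matrix.SpecialLinearGroup.coe_mul m₁⁻¹, ← Matrix.mul_assoc,
      ← Matrix.SpecialLinearGroup.coe_mul m₁⁻¹ m₁, inv_mul_cancel,
      Matrix.SpecialLinearGroup.coe_one, Matrix.one_mul] at h5
    exact h5
  intro j hj
  rw [map_stdSpace_eq_iff (hθ' j hj)]
  intro a b hb ha
  have h5 := congrFun (congrFun h4 a) b
  rw [expDiag, Matrix.mul_diagonal, Matrix.diagonal_mul] at h5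
  have hjpos := hpos j hj
  rw [simpleRoot_apply (hθ j hj).1 (hθ j hj).2] at hjpos
  have hb' : A ⟨j - 1, by omega⟩ ≤ A b := hAanti (Fin.le_def.2 (by simp only; omega))
  have ha' : A a ≤ A ⟨j, (hθ j hj).2⟩ := hAanti (Fin.le_def.2 ha)
  have h6 : Real.exp ((A + A) a) ≠ Real.exp ((A + A) b) := by
    rw [ne_eq, Real.exp_eq_exp, Pi.add_apply, Pi.add_apply]
    linarith
  have h7 : ((m₁⁻¹ * n₁ : SL(d, K)) : Matrix (Fin d) (Fin d) K) a b *
      ((Real.exp ((A + A) b) - Real.exp ((A + A) a) : ℝ) : K) = 0 := by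
    push_cast
    linear_combination h5
  refine (mul_eq_zero.1 h7).resolve_right ?_
  rw [RCLike.ofReal_eq_zero, sub_eq_zero]
  exact h6.symm

/-! ### Cartan projections of exterior powers -/

/-- The difference is a sum of nonnegative terms, one per slot. In the slot separated by `i` the
term is at least `α_i`. -/
theorem exists_simpleRoot_le_tupleSum_sub (hsub : Subordinate d k θ j) {A : Fin d → ℝ}
    (hA : Antitone A) {I J : Fin (d.choose k)} (hI : (I : ℕ) < j) (hJ : j ≤ (J : ℕ)) :
    ∃ i ∈ θ, simpleRoot d i A ≤ tupleSum k A I - tupleSum k A J := by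
  obtain ⟨hle, s, i, hi, h1, h2⟩ := hsub I J hI hJ
  have hJs := (tuple d k J s).2
  refine ⟨i, hi, ?_⟩
  rw [simpleRoot_apply (by omega) (by omega), tupleSum, tupleSum, ← Finset.sum_sub_distrib]
  calc A ⟨i - 1, by omega⟩ - A ⟨i, by omega⟩ ≤ A (tuple d k I s) - A (tuple d k J s) := by
        refine sub_le_sub (hA (Fin.le_def.2 ?_)) (hA (Fin.le_def.2 h2))
        simp only; omega
    _ ≤ _ := Finset.single_le_sum (f := fun s => A (tuple d k I s) - A (tuple d k J s))
        (fun s _ => sub_nonneg.2 (hA (hle s))) (Finset.mem_univ s)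

theorem compoundSL_svd (hk : 1 ≤ k) {g m₁ m₂ : SL(d, K)} {A : Fin d → ℝ}
    (h : (g : Matrix (Fin d) (Fin d) K) = m₁ * expDiag K A * m₂) :
    (compoundSL hk g : Matrix (Fin (d.choose k)) (Fin (d.choose k)) K) =
      compoundSL hk m₁ * expDiag K (tupleSum k A) * compoundSL hk m₂ := by
  rw [coe_compoundSL, h, compound_mul, compound_mul, compound_expDiag]
  rfl

theorem le_simpleRoot_compoundPSL (hk : 1 ≤ k) (hj : 1 ≤ j) (hjd : j < d.choose k)
    (hsub : Subordinate d k θ j) (g : PSL(d, K)) {ε : ℝ} (hε : 0 < ε)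
    (h : ∀ i ∈ θ, ε ≤ simpleRoot d i (cartan g)) :
    ε ≤ simpleRoot (d.choose k) j (cartan (compoundPSL hk g)) := by
  obtain ⟨g, rfl⟩ := QuotientGroup.mk_surjective g
  obtain ⟨hA, m₁, m₂, h₁, h₂, hg⟩ := exists_svd_cartan g
  refine le_simpleRoot_of_gap (isSU_compoundSL hk h₁) (isSU_compoundSL hk h₂)
    (compoundSL_svd hk hg) hj hjd hε fun I J hI hJ => ?_
  obtain ⟨i, hi, hle⟩ := exists_simpleRoot_le_tupleSum_sub hsub hA hI hJ
  exact (h i hi).trans hle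

theorem isCartanFlag_wedgeFlag (hk : 1 ≤ k) (hθ : ∀ j ∈ θ, j ≤ d)
    (hθ' : ∀ j ∈ θ', j ≤ d.choose k) (hθ'r : ∀ j ∈ θ', 1 ≤ j ∧ j < d.choose k)
    (hsub : ∀ j ∈ θ', Subordinate d k θ j) {g : PSL(d, K)} {x : Flag K d θ}
    (hx : IsCartanFlag g x) :
    IsCartanFlag (compoundPSL hk g) (wedgeFlag hk hθ hθ' x) := by
  obtain ⟨hpos, g', m₁, m₂, rfl, h₁, h₂, hg, hxm⟩ := hx
  have hA := (exists_svd_cartan g').1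
  obtain rfl : x = stdFlag hθ m₁ := Flag.ext (funext fun j => Gr.ext (hxm j))
  rw [wedgeFlag_stdFlag hk hθ hθ' hsub, compoundPSL_coe]
  obtain ⟨ε, hε, hεle⟩ : ∃ ε > 0, ∀ i ∈ θ, ε ≤ simpleRoot d i (cartan (g' : PSL(d, K))) := by
    rcases θ.eq_empty_or_nonempty with rfl | hne
    · exact ⟨1, one_pos, by simp⟩
    · obtain ⟨i, hi, hmin⟩ := θ.exists_min_image
        (fun i => simpleRoot d i (cartan (g' : PSL(d, K)))) hne
      exact ⟨_, hpos i hi, hmin⟩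
  refine isCartanFlag_of_gap hθ'r hθ' (isSU_compoundSL hk h₁) (isSU_compoundSL hk h₂)
    (compoundSL_svd hk hg) hε fun j hj I J hI hJ => ?_
  obtain ⟨i, hi, hle⟩ := exists_simpleRoot_le_tupleSum_sub (hsub j hj) hA hI hJ
  exact (hεle i hi).trans hle

theorem tupleSum_first_sub_second (hk : 1 ≤ k) (hkd : k < d) {I₁ I₂ : Fin (d.choose k)}
    (h₁ : ∀ s, (tuple d k I₁ s : ℕ) = s)
    (h₂ : ∀ s : Fin k, (tuple d k I₂ s : ℕ) = if (s : ℕ) + 1 = k then k else s)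
    (A : Fin d → ℝ) : tupleSum k A I₁ - tupleSum k A I₂ = simpleRoot d k A := by
  rw [simpleRoot_apply hk hkd, tupleSum, tupleSum, ← Finset.sum_sub_distrib,
    Finset.sum_eq_single ⟨k - 1, by omega⟩]
  · congr 2
    · exact Fin.ext (h₁ _)
    · refine Fin.ext ?_
      rw [h₂, if_pos]
      simp only; omega
  · intro s _ hs
    rw [sub_eq_zero]
    congr 1
    refine Fin.ext ?_
    rw [h₁, h₂, if_neg]
    intro hcon
    exact hs (Fin.ext (by simp only; omega))
  · intro h
    exact absurd (Finset.mem_univ _) h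

/-- Ties are allowed, so the permutation need not fix the first two indices; only the values are
determined. -/
theorem sorted_first_two {D : ℕ} {B : Fin D → ℝ} {π : Equiv.Perm (Fin D)}
    (hπ : Antitone (B ∘ π)) (hD : 2 ≤ D) (h0 : ∀ J, B J ≤ B ⟨0, by omega⟩)
    (h1 : ∀ J : Fin D, 1 ≤ (J : ℕ) → B J ≤ B ⟨1, by omega⟩) :
    B (π ⟨0, by omega⟩) = B ⟨0, by omega⟩ ∧ B (π ⟨1, by omega⟩) = B ⟨1, by omega⟩ := by
  have hmax : ∀ a b : Fin D, a ≤ π.symm b → B b ≤ B (π a) := by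
    intro a b hab
    have := hπ hab
    simpa using this
  have e0 : B (π ⟨0, by omega⟩) = B ⟨0, by omega⟩ :=
    le_antisymm (h0 _) (hmax _ _ (Fin.le_def.2 (by simp)))
  refine ⟨e0, ?_⟩
  by_cases hπ0 : π ⟨0, by omega⟩ = ⟨0, by omega⟩
  · refine le_antisymm (h1 _ ?_) (hmax _ _ ?_)
    · by_contra hcon
      have h2 : π ⟨1, by omega⟩ = ⟨0, by omega⟩ := Fin.ext (by simp only; omega)
      have := π.injective (h2.trans hπ0.symm)
      simp at this
    · by_contra hcon
      have h2 : π.symm ⟨1, by omega⟩ = ⟨0, by omega⟩ :=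
        Fin.ext (by rw [Fin.le_def] at hcon; simp only at hcon ⊢; omega)
      rw [Equiv.symm_apply_eq, hπ0] at h2
      simp at h2
  · have h2 : 1 ≤ (π ⟨0, by omega⟩ : ℕ) := by
      by_contra hcon
      exact hπ0 (Fin.ext (by simp only; omega))
    have h3 : B ⟨0, by omega⟩ = B ⟨1, by omega⟩ :=
      le_antisymm (e0 ▸ h1 _ h2) (h0 _)
    rw [← h3]
    refine le_antisymm (h0 _) (hmax _ _ ?_)
    by_contra hcon
    have h4 : π.symm ⟨0, by omega⟩ = ⟨0, by omega⟩ :=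
      Fin.ext (by rw [Fin.le_def] at hcon; simp only at hcon ⊢; omega)
    rw [Equiv.symm_apply_eq] at h4
    exact hπ0 h4.symm

theorem simpleRoot_one_compoundPSL (hk : 1 ≤ k) (hkd : k < d) (g : PSL(d, K)) :
    simpleRoot (d.choose k) 1 (cartan (compoundPSL hk g)) = simpleRoot d k (cartan g) := by
  have hD := two_le_choose hk hkd
  obtain ⟨g, rfl⟩ := QuotientGroup.mk_surjective g
  obtain ⟨hA, m₁, m₂, h₁, h₂, hg⟩ := exists_svd_cartan g
  set A := cartan (g : PSL(d, K)) with hAdef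
  obtain ⟨π, hπ, hcar, -⟩ := exists_sorted_svd (isSU_compoundSL hk h₁) (isSU_compoundSL hk h₂)
    (compoundSL_svd hk hg)
  have hI₁ := (lt_one_iff_tuple hkd (⟨0, by omega⟩ : Fin (d.choose k))).1 (by simp)
  have hI₂ := ((lt_two_iff_tuple hk hkd (⟨1, by omega⟩ : Fin (d.choose k))).1
    (by simp)).resolve_left (by rw [← lt_one_iff_tuple hkd]; simp)
  have hs := sorted_first_two hπ hD ?_ ?_
  · change simpleRoot (d.choose k) 1
      (cartan (compoundSL hk g : PSL(d.choose k, K))) = simpleRoot d k A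
    rw [hcar, simpleRoot_apply le_rfl (by omega), Function.comp_apply, Function.comp_apply]
    rw [← tupleSum_first_sub_second hk hkd hI₁ hI₂]
    exact congrArg₂ (· - ·) hs.1 hs.2
  · intro J
    refine Finset.sum_le_sum fun s _ => hA (Fin.le_def.2 ?_)
    rw [hI₁]
    exact le_tuple J s
  · intro J hJ
    refine Finset.sum_le_sum fun s _ => hA (Fin.le_def.2 ?_)
    rw [hI₂]
    split_ifs with h
    · have h2 := le_last_of_not_first hk (mt (lt_one_iff_tuple hkd J).2 (by omega))
      have : s = ⟨k - 1, by omega⟩ := Fin.ext (by simp only; omega)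
      rw [this]; exact h2
    · exact le_tuple J s

/-! ### Injectivity of the exterior power representation -/

/-- If `⋀^k g` is scalar, then so is `⋀^k` of every conjugate of `g`, which therefore has a zero
corner entry. Conjugating by unitaries shows that `g u` is orthogonal to `w` whenever `u` and `w`
are orthonormal. Basis vectors make `g` diagonal, and the pairs `e_a ± e_b` make its diagonal
constant. -/
theorem compoundPSL_injective (hk : 1 ≤ k) (hkd : k < d) :
    Function.Injective (compoundPSL hk : PSL(d, K) →* PSL(d.choose k, K)) := by
  rw [injective_iff_map_eq_one]
  intro g hg
  obtain ⟨g, rfl⟩ := QuotientGroup.mk_surjective g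
  have hg' : ((1 : SL(d.choose k, K)) : PSL(d.choose k, K)) = compoundSL hk g := hg.symm
  obtain ⟨c, -, hcg⟩ := coe_eq_coe_iff.1 hg'
  have hd : 0 < d := by omega
  have key : ∀ u w : Vec K d, ‖u‖ = 1 → ‖w‖ = 1 → inner K u w = 0 →
      inner K w (slEquiv g u) = 0 := by
    intro u w hu hw huw
    have h01 : (⟨0, hd⟩ : Fin d) ≠ ⟨d - 1, by omega⟩ := by
      rw [ne_eq, Fin.ext_iff]; simp only; omega
    -- Only the first and the last index matter: `u` is placed first and `w` last, so that their
    -- pairing becomes the lower left corner entry.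
    set v : Fin d → Vec K d := fun i => if i = ⟨0, hd⟩ then u else w with hv
    have hon : Orthonormal K (Set.domRestrict {⟨0, hd⟩, ⟨d - 1, by omega⟩} v) := by
      constructor
      · rintro ⟨i, hi⟩
        change ‖v i‖ = 1
        rw [hv]
        dsimp only
        split_ifs <;> assumption
      · rintro ⟨i, hi⟩ ⟨l, hl⟩ hil
        have hil' : i ≠ l := fun h => hil (Subtype.ext h)
        change inner K (v i) (v l) = 0
        rw [hv]
        dsimp only
        rcases hi with rfl | rfl <;> rcases hl with rfl | rfl
        · exact absurd rfl hil'
        · rw [if_pos rfl, if_neg h01.symm]; exact huw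
        · rw [if_pos rfl, if_neg h01.symm]; exact inner_eq_zero_symm.1 huw
        · exact absurd rfl hil'
    obtain ⟨b, hb⟩ := hon.exists_orthonormalBasis_extension_of_card_eq (by simp)
    obtain ⟨m, hm, hmb⟩ := exists_isSU_of_orthonormal b b.orthonormal
    obtain ⟨c₀, hc₀⟩ := hmb ⟨0, hd⟩
    obtain ⟨c₁, hc₁⟩ := hmb ⟨d - 1, by omega⟩
    rw [hb _ (by simp)] at hc₀ hc₁
    simp only [hv, if_true, if_neg h01.symm] at hc₀ hc₁
    have hcc : (compound k ((m⁻¹ * g * m : SL(d, K)) : Matrix (Fin d) (Fin d) K)) =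
        c • (1 : Matrix (Fin (d.choose k)) (Fin (d.choose k)) K) := by
      rw [← coe_compoundSL hk, map_mul, map_mul, Matrix.SpecialLinearGroup.coe_mul,
        Matrix.SpecialLinearGroup.coe_mul, hcg, Matrix.SpecialLinearGroup.coe_one,
        Matrix.mul_smul, Matrix.mul_one, Matrix.smul_mul, ← Matrix.SpecialLinearGroup.coe_mul,
        ← map_mul, inv_mul_cancel, map_one, Matrix.SpecialLinearGroup.coe_one]
    have h0 := block_of_compound_one hk hkd (m⁻¹ * g * m) (fun J I hI hJ => by
      rw [hcc, Matrix.smul_apply, Matrix.one_apply_ne, smul_zero]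
      rintro rfl
      omega) ⟨d - 1, by omega⟩ ⟨0, hd⟩ (by simp only; omega) (by simp only; omega)
    have h1 : inner K (slEquiv m (EuclideanSpace.single ⟨d - 1, by omega⟩ 1))
        (slEquiv g (slEquiv m (EuclideanSpace.single ⟨0, hd⟩ 1))) = (0 : K) := by
      rw [← slEquiv_apply_inv_self m (slEquiv g _), inner_slEquiv hm, ← slEquiv_mul,
        ← slEquiv_mul, EuclideanSpace.inner_single_left, slEquiv_single, h0, mul_zero]
    have hne : ∀ i, slEquiv m (EuclideanSpace.single i (1 : K)) ≠ 0 := by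
      intro i
      rw [ne_eq, LinearEquiv.map_eq_zero_iff]
      simp
    have hc₀' : c₀ ≠ 0 := by
      rintro rfl
      exact hne _ (by rw [hc₀, zero_smul])
    have hc₁' : c₁ ≠ 0 := by
      rintro rfl
      exact hne _ (by rw [hc₁, zero_smul])
    rw [hc₀, hc₁, map_smul, inner_smul_left, inner_smul_right] at h1
    simpa [hc₀', hc₁'] using h1
  have hoff : ∀ a b, a ≠ b → (g : Matrix (Fin d) (Fin d) K) a b = 0 := by
    intro a b hab
    have h1 := key (EuclideanSpace.single b 1) (EuclideanSpace.single a 1) (by simp) (by simp)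
      (by simp [EuclideanSpace.inner_single_left, hab.symm])
    simpa [EuclideanSpace.inner_single_left, slEquiv_single] using h1
  have hdiag : ∀ a b, (g : Matrix (Fin d) (Fin d) K) a a = (g : Matrix (Fin d) (Fin d) K) b b := by
    intro a b
    by_cases hab : a = b
    · rw [hab]
    set u : Vec K d := EuclideanSpace.single a 1 + EuclideanSpace.single b 1 with hu
    set w : Vec K d := EuclideanSpace.single a 1 - EuclideanSpace.single b 1 with hw
    have hu0 : u ≠ 0 := by
      intro h
      have := congrArg (fun x : Vec K d => x a) h
      simp [hu, hab] at this
    have hw0 : w ≠ 0 := by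
      intro h
      have := congrArg (fun x : Vec K d => x a) h
      simp [hw, hab] at this
    have huw : inner K u w = 0 := by
      simp [hu, hw, inner_add_left, inner_sub_right, EuclideanSpace.inner_single_left, hab,
        Ne.symm hab]
    have hnorm : ∀ x : Vec K d, x ≠ 0 → ‖((‖x‖⁻¹ : ℝ) : K) • x‖ = 1 := by
      intro x hx
      rw [norm_smul]
      simp [hx]
    have h1 := key (((‖u‖⁻¹ : ℝ) : K) • u) (((‖w‖⁻¹ : ℝ) : K) • w) (hnorm u hu0) (hnorm w hw0)
      (by rw [inner_smul_left, inner_smul_right, huw]; simp)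
    rw [map_smul, inner_smul_left, inner_smul_right] at h1
    have h2 : inner K w (slEquiv g u) = 0 := by
      simpa [hu0, hw0] using h1
    rw [hu, hw, map_add, inner_add_right, inner_sub_left, inner_sub_left] at h2
    simp only [EuclideanSpace.inner_single_left, slEquiv_single, map_one, one_mul,
      hoff a b hab, hoff b a (Ne.symm hab)] at h2
    linear_combination h2
  have h1 : ((1 : SL(d, K)) : PSL(d, K)) = g := by
    refine coe_eq_coe_iff.2 ⟨(g : Matrix (Fin d) (Fin d) K) ⟨0, hd⟩ ⟨0, hd⟩, ?_, ?_⟩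
    · have h2 : (g : Matrix (Fin d) (Fin d) K) =
          Matrix.diagonal fun _ => (g : Matrix (Fin d) (Fin d) K) ⟨0, hd⟩ ⟨0, hd⟩ := by
        ext a b
        by_cases hab : a = b
        · subst hab; simp [hdiag a ⟨0, hd⟩]
        · rw [hoff a b hab, Matrix.diagonal_apply_ne _ hab]
      have h3 := Matrix.SpecialLinearGroup.det_coe g
      rw [h2, Matrix.det_diagonal, Finset.prod_const] at h3
      simpa using h3
    · ext a b
      by_cases hab : a = b
      · subst hab; simp [hdiag a ⟨0, hd⟩]
      · simp [hoff a b hab, hab]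
  exact h1.symm

/-! ### Limit sets and critical exponents of exterior powers -/

theorem IsDivergent.eventually_le {Γ : Subgroup PSL(d, K)} (hΓ : IsDivergent θ Γ)
    {γ : ℕ → PSL(d, K)} (hγ : Function.Injective γ) (hmem : ∀ i, γ i ∈ Γ) (ε : ℝ) :
    ∀ᶠ i in atTop, ∀ j ∈ θ, ε ≤ simpleRoot d j (cartan (γ i)) :=
  (Filter.eventually_all_finset θ).2 fun j hj => (hΓ j hj γ hγ hmem).eventually_ge_atTop ε

theorem IsDivergent.mono {Γ : Subgroup PSL(d, K)} (hΓ : IsDivergent θ Γ) (h : θ' ⊆ θ) :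
    IsDivergent θ' Γ := fun j hj => hΓ j (h hj)

theorem exists_lift_sequence (hk : 1 ≤ k) {Γ : Subgroup PSL(d, K)}
    {γ : ℕ → PSL(d.choose k, K)} (hγ : Function.Injective γ)
    (hmem : ∀ i, γ i ∈ Γ.map (compoundPSL hk)) :
    ∃ γ' : ℕ → PSL(d, K), Function.Injective γ' ∧ (∀ i, γ' i ∈ Γ) ∧
      ∀ i, compoundPSL hk (γ' i) = γ i := by
  choose γ' h1 h2 using hmem
  refine ⟨γ', fun i l hil => hγ ?_, h1, h2⟩
  rw [← h2, ← h2, hil]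

theorem IsDivergent.map_compoundPSL (hk : 1 ≤ k) (hθ'r : ∀ j ∈ θ', 1 ≤ j ∧ j < d.choose k)
    (hsub : ∀ j ∈ θ', Subordinate d k θ j) {Γ : Subgroup PSL(d, K)} (hΓ : IsDivergent θ Γ) :
    IsDivergent θ' (Γ.map (compoundPSL hk)) := by
  intro j hj γ hγ hmem
  obtain ⟨γ', hγ', hmem', hγγ'⟩ := exists_lift_sequence hk hγ hmem
  refine tendsto_atTop.2 fun b => ?_
  filter_upwards [hΓ.eventually_le hγ' hmem' (max b 1)] with i hi
  rw [← hγγ']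
  exact (le_max_left b 1).trans (le_simpleRoot_compoundPSL hk (hθ'r j hj).1 (hθ'r j hj).2
    (hsub j hj) _ (lt_max_of_lt_right one_pos) hi)

/-- Cartan flags of `η(γ)` are the images of those of `γ` by uniqueness. A convergent sequence of
images has its limit in the closed range, and the embedding makes the original flags converge. For
the other inclusion, injectivity of `η` keeps sequences injective. -/
theorem limitSet_map_compoundPSL (hk : 1 ≤ k) (hkd : k < d) (hθ : ∀ j ∈ θ, j ≤ d)
    (hθ' : ∀ j ∈ θ', j ≤ d.choose k) (hθ'r : ∀ j ∈ θ', 1 ≤ j ∧ j < d.choose k)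
    (hsub : ∀ j ∈ θ', Subordinate d k θ j)
    (hemb : IsClosedEmbedding (wedgeFlag hk hθ hθ' : Flag K d θ → Flag K (d.choose k) θ'))
    {Γ : Subgroup PSL(d, K)} (hΓ : IsDivergent θ Γ) :
    limitSet θ' (Γ.map (compoundPSL hk)) = wedgeFlag hk hθ hθ' '' limitSet θ Γ := by
  ext y
  constructor
  · rintro ⟨γ, hγ, hmem, u, hu, hlim⟩
    obtain ⟨γ', hγ', hmem', hγγ'⟩ := exists_lift_sequence hk hγ hmem
    -- A Cartan flag exists only when the roots are positive, which divergence guarantees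
    -- eventually; an arbitrary flag is used for the other terms.
    have h1 : ∀ i, ∃ v : Flag K d θ, (∀ j ∈ θ, 0 < simpleRoot d j (cartan (γ' i))) →
        IsCartanFlag (γ' i) v := by
      intro i
      by_cases h : ∀ j ∈ θ, 0 < simpleRoot d j (cartan (γ' i))
      · obtain ⟨v, hv⟩ := exists_isCartanFlag hθ _ h
        exact ⟨v, fun _ => hv⟩
      · exact ⟨stdFlag hθ 1, fun h' => absurd h' h⟩
    choose v hv using h1
    have h2 : ∀ᶠ i in atTop, IsCartanFlag (γ' i) (v i) := by
      filter_upwards [hΓ.eventually_le hγ' hmem' 1] with i hi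
      exact hv i fun j hj => one_pos.trans_le (hi j hj)
    have h3 : u =ᶠ[atTop] fun i => wedgeFlag hk hθ hθ' (v i) := by
      filter_upwards [hu, h2] with i hi hi2
      rw [← hγγ'] at hi
      exact hi.unique hθ'r (isCartanFlag_wedgeFlag hk hθ hθ' hθ'r hsub hi2)
    have h4 : Tendsto (fun i => wedgeFlag hk hθ hθ' (v i)) atTop (𝓝 y) := hlim.congr' h3
    obtain ⟨x, rfl⟩ : y ∈ Set.range (wedgeFlag hk hθ hθ' : Flag K d θ → _) :=
      hemb.isClosed_range.mem_of_tendsto h4 (Eventually.of_forall fun i => ⟨_, rfl⟩)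
    exact ⟨x, ⟨γ', hγ', hmem', v, h2, hemb.isInducing.tendsto_nhds_iff.2 h4⟩, rfl⟩
  · rintro ⟨x, ⟨γ, hγ, hmem, u, hu, hlim⟩, rfl⟩
    refine ⟨fun i => compoundPSL hk (γ i), (compoundPSL_injective hk hkd).comp hγ,
      fun i => ⟨γ i, hmem i, rfl⟩, fun i => wedgeFlag hk hθ hθ' (u i), ?_,
      (hemb.continuous.tendsto x).comp hlim⟩
    filter_upwards [hu] with i hi
    exact isCartanFlag_wedgeFlag hk hθ hθ' hθ'r hsub hi

theorem theta_range {i : ℕ} (hkd : k < d) (hi : i ∈ theta d k) : 1 ≤ i ∧ i < d := by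
  rw [mem_theta] at hi
  omega

theorem self_mem_theta (hk : 1 ≤ k) (hkd : k < d) : k ∈ theta d k := by
  rw [mem_theta]
  omega

theorem one_lt_choose (hk : 1 ≤ k) (hkd : k < d) : 1 < d.choose k := two_le_choose hk hkd

theorem limitSet_theta_map (hk : 1 ≤ k) (hkd : k < d) {Γ : Subgroup PSL(d, K)}
    (hΓ : IsDivergent (theta d k) Γ) :
    limitSet (theta (d.choose k) 1) (Γ.map (compoundPSL hk)) =
      thetaFlag hk hkd '' limitSet (theta d k) Γ :=
  limitSet_map_compoundPSL hk hkd _ _ (fun _ => theta_range (one_lt_choose hk hkd))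
    (fun _ => subordinate_theta hk hkd) (isClosedEmbedding_thetaFlag hk hkd) hΓ

theorem isClosedEmbedding_wedgeFlag_singleton (hk : 1 ≤ k) (hkd : k < d) :
    IsClosedEmbedding (wedgeFlag hk (singleton_le hkd) (singleton_le_choose hkd) :
      Flag K d {k} → Flag K (d.choose k) {1}) := by
  have : CompactSpace (Flag K d {k}) := ⟨isCompact_univ_flag (singleton_le hkd)⟩
  refine (continuous_wedgeFlag hk _ _ (subordinate_singleton hk hkd)).isClosedEmbedding ?_
  intro x y hxy
  have h1 := congrArg (fun z : Flag K (d.choose k) {1} => z.proj ⟨1, Finset.mem_singleton_self 1⟩)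
    hxy
  dsimp only at h1
  rw [wedgeFlag_proj_one hk hkd _ _ (subordinate_singleton hk hkd) (Finset.mem_singleton_self k),
    wedgeFlag_proj_one hk hkd _ _ (subordinate_singleton hk hkd) (Finset.mem_singleton_self k)]
    at h1
  rw [← x.toFlag_proj, ← y.toFlag_proj, plucker_injective hk hkd h1]

theorem limitSetGr_map (hk : 1 ≤ k) (hkd : k < d) {Γ : Subgroup PSL(d, K)}
    (hΓ : IsDivergent (theta d k) Γ) :
    limitSetGr 1 (Γ.map (compoundPSL hk)) = plucker hk hkd '' limitSetGr k Γ := by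
  rw [limitSetGr, limitSetGr, limitSet_map_compoundPSL hk hkd (singleton_le hkd)
    (singleton_le_choose hkd) (fun j hj => ?_) (subordinate_singleton hk hkd)
    (isClosedEmbedding_wedgeFlag_singleton hk hkd)
    (hΓ.mono (Finset.singleton_subset_iff.2 (self_mem_theta hk hkd))), Set.image_image,
    Set.image_image]
  · refine Set.image_congr fun x _ => ?_
    exact wedgeFlag_proj_one hk hkd _ _ (subordinate_singleton hk hkd) _ _ x
  · rw [Finset.mem_singleton.1 hj]
    exact ⟨le_rfl, one_lt_choose hk hkd⟩

/-- As `η` is injective on `Γ`, the two Poincaré series are reindexings of each other with equal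
terms. -/
theorem critExp_map (hk : 1 ≤ k) (hkd : k < d) (Γ : Subgroup PSL(d, K)) :
    critExp (simpleRoot (d.choose k) 1) (Γ.map (compoundPSL hk)) =
      critExp (simpleRoot d k) Γ := by
  have h : ∀ s : ℝ, poincareSeries (simpleRoot (d.choose k) 1) (Γ.map (compoundPSL hk)) s =
      poincareSeries (simpleRoot d k) Γ s := by
    intro s
    rw [poincareSeries, poincareSeries, ← (Γ.equivMapOfInjective (compoundPSL hk)
      (compoundPSL_injective hk hkd)).toEquiv.tsum_eq]
    refine tsum_congr fun γ => ?_
    rw [← simpleRoot_one_compoundPSL hk hkd]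
    rfl
  simp only [critExp, h]

/-! ### Pairs of transverse flags -/

theorem Flag.space_of_mem (x : Flag K d θ) (hj : j ∈ θ) : x.space j = (x.proj ⟨j, hj⟩).carrier :=
  dif_pos hj

theorem Flag.space_mono (x : Flag K d θ) {i : ℕ} (hi : i ∈ θ) (hj : j ∈ θ) (hij : i ≤ j) :
    x.space i ≤ x.space j := by
  rw [x.space_of_mem hi, x.space_of_mem hj]
  exact x.mono ⟨i, hi⟩ ⟨j, hj⟩ hij

theorem stdFlag_space (hθ : ∀ j ∈ θ, j ≤ d) (g : SL(d, K)) (hj : j ∈ θ) :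
    (stdFlag hθ g).space j = (stdSpace K d j).map (slEquiv g).toLinearMap :=
  (stdFlag hθ g).space_of_mem hj

theorem Flag.finrank_space (x : Flag K d θ) (hj : j ∈ θ) :
    Module.finrank K (x.space j) = j := by
  rw [x.space_of_mem hj]
  exact (x.proj ⟨j, hj⟩).finrank_eq

theorem Flag.Transverse.disjoint {x y : Flag K d θ} (h : x.Transverse y)
    (hθ : ∀ j ∈ θ, j ≤ d) (hsymm : ∀ j ∈ θ, d - j ∈ θ) (hj : j ∈ θ) :
    x.space j ⊓ y.space (d - j) = ⊥ := by
  have h1 := Submodule.finrank_sup_add_finrank_inf_eq (x.space j) (y.space (d - j))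
  rw [h j hj, x.finrank_space hj, y.finrank_space (hsymm j hj), finrank_top,
    finrank_euclideanSpace_fin] at h1
  have := hθ j hj
  rw [← Submodule.finrank_eq_zero (R := K)]
  omega

theorem map_slEquiv_mem_iff (g : SL(d, K)) (W : Submodule K (Vec K d)) (v : Vec K d) :
    slEquiv g v ∈ W.map (slEquiv g).toLinearMap ↔ v ∈ W := by
  constructor
  · rintro ⟨w, hw, h⟩
    rwa [← (slEquiv g).injective h]
  · exact fun h => ⟨v, h, rfl⟩

theorem sub_truncate_mem (v : Vec K d) (j : ℕ) :
    ∃ u ∈ stdSpace K d j, ∀ a : Fin d, ((a : ℕ) < j → (v - u) a = 0) ∧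
      (j ≤ (a : ℕ) → (v - u) a = v a) := by
  refine ⟨WithLp.toLp 2 fun a => if (a : ℕ) < j then v a else 0, ?_, fun a => ⟨fun h => ?_,
    fun h => ?_⟩⟩
  · rw [mem_stdSpace_iff]
    intro i hi
    simp [hi.not_gt]
  · simp [h]
  · simp [h.not_gt]

/-- Any pair of transverse flags is conjugate to the pair of the standard flag and the
opposite one. -/
theorem Flag.Transverse.exists_stdFlag {x y : Flag K d θ} (h : x.Transverse y)
    (hθ : ∀ j ∈ θ, j ≤ d) (hsymm : ∀ j ∈ θ, d - j ∈ θ) :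
    ∃ g : SL(d, K), stdFlag hθ g = x ∧ ∀ j ∈ θ, ∀ v : Vec K d,
      slEquiv g v ∈ y.space (d - j) ↔ ∀ a : Fin d, (a : ℕ) < j → v a = 0 := by
  obtain ⟨m, -, rfl⟩ := exists_stdFlag_eq hθ x
  -- Each basis vector is corrected by earlier ones so as to land in `y^{d-j}` for all `j ≤ i` in
  -- `θ`. The largest such `j` gives the smallest of these spaces, and transversality there provides
  -- the correction. The corrections form a unitriangular matrix, which does not move `x`.
  have h1 : ∀ i : Fin d, ∃ w ∈ stdSpace K d i, ∀ j ∈ θ, j ≤ (i : ℕ) →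
      slEquiv m (EuclideanSpace.single i 1 + w) ∈ y.space (d - j) := by
    intro i
    rcases (θ.filter (· ≤ (i : ℕ))).eq_empty_or_nonempty with he | hne
    · refine ⟨0, zero_mem _, fun j hj hji => ?_⟩
      have : j ∈ θ.filter (· ≤ (i : ℕ)) := Finset.mem_filter.2 ⟨hj, hji⟩
      rw [he] at this
      exact absurd this (Finset.notMem_empty j)
    · obtain ⟨j₀, hj₀, hmax⟩ := (θ.filter (· ≤ (i : ℕ))).exists_max_image id hne
      rw [Finset.mem_filter] at hj₀
      have h2 : slEquiv m (EuclideanSpace.single i 1) ∈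
          (stdFlag hθ m).space j₀ ⊔ y.space (d - j₀) := by
        rw [h j₀ hj₀.1]; exact Submodule.mem_top
      obtain ⟨a, ha, b, hb, hab⟩ := Submodule.mem_sup.1 h2
      rw [stdFlag_space hθ m hj₀.1] at ha
      obtain ⟨w, hw, rfl⟩ := ha
      refine ⟨-w, neg_mem (stdSpace_mono hj₀.2 hw), fun j hj hji => ?_⟩
      have h3 := hmax j (Finset.mem_filter.2 ⟨hj, hji⟩)
      have h4 : slEquiv m (EuclideanSpace.single i 1 + -w) = b := by
        rw [map_add, map_neg, ← hab]
        simp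
      rw [h4]
      exact y.space_mono (hsymm _ hj₀.1) (hsymm _ hj) (by simp only [id] at h3; omega) hb
  choose w hw hwy using h1
  have hw0 : ∀ i a : Fin d, i ≤ a → w i a = 0 := fun i a hia => mem_stdSpace_iff.1 (hw i) a hia
  set M : Matrix (Fin d) (Fin d) K := Matrix.of fun a b => (EuclideanSpace.single b (1 : K) + w b) a
    with hM
  have hMtri : ∀ a b, b < a → M a b = 0 := by
    intro a b hba
    simp [hM, hw0 b a hba.le, hba.ne']
  have hdet : M.det = 1 := by
    rw [det_of_isUpperTriangular (fun a b hba => hMtri a b hba)]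
    refine Finset.prod_eq_one fun a _ => ?_
    simp [hM, hw0 a a le_rfl]
  let u : SL(d, K) := ⟨M, hdet⟩
  have hu : ∀ i, slEquiv (m * u) (EuclideanSpace.single i 1) =
      slEquiv m (EuclideanSpace.single i 1 + w i) := by
    intro i
    rw [slEquiv_mul]
    congr 1
    ext a
    rw [slEquiv_single]
    rfl
  have hstd : stdFlag hθ (m * u) = stdFlag hθ m := by
    rw [eq_comm, stdFlag_eq_iff]
    intro j hj
    rw [inv_mul_cancel_left, map_stdSpace_eq_iff (hθ j hj)]
    intro a b hb ha
    exact hMtri a b (Fin.lt_def.2 (by omega))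
  have hmem : ∀ j ∈ θ, ∀ v : Vec K d, (∀ a : Fin d, (a : ℕ) < j → v a = 0) →
      slEquiv (m * u) v ∈ y.space (d - j) := by
    intro j hj v hv
    have h2 : v = ∑ i, v i • EuclideanSpace.single i (1 : K) := by
      have := ((EuclideanSpace.basisFun (Fin d) K).sum_repr v).symm
      simpa using this
    rw [h2, map_sum]
    refine sum_mem fun i _ => ?_
    rw [map_smul]
    rcases lt_or_ge (i : ℕ) j with hi | hi
    · rw [hv i hi, zero_smul]; exact zero_mem _
    · rw [hu]; exact Submodule.smul_mem _ _ (hwy i j hj hi)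
  refine ⟨m * u, hstd, fun j hj v => ⟨fun hv a ha => ?_, hmem j hj v⟩⟩
  obtain ⟨t, ht, htv⟩ := sub_truncate_mem v j
  have h2 := hmem j hj (v - t) fun a ha => (htv a).1 ha
  have h3 : slEquiv (m * u) t ∈ y.space (d - j) := by
    have := sub_mem hv h2
    rwa [map_sub, sub_sub_cancel] at this
  have h4 : slEquiv (m * u) t ∈ (stdFlag hθ m).space j := by
    rw [← hstd, stdFlag_space hθ _ hj, map_slEquiv_mem_iff]
    exact ht
  have h5 : slEquiv (m * u) t ∈ (stdFlag hθ m).space j ⊓ y.space (d - j) := ⟨h4, h3⟩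
  rw [h.disjoint hθ hsymm hj, Submodule.mem_bot, LinearEquiv.map_eq_zero_iff] at h5
  have h6 := (htv a).1 ha
  rwa [h5, sub_zero] at h6

theorem exists_coord_of_transverse {x y : Flag K d θ} (h : x.Transverse y)
    (hθ : ∀ j ∈ θ, j ≤ d) (hsymm : ∀ j ∈ θ, d - j ∈ θ) :
    ∃ g q : SL(d, K), stdFlag hθ g = x ∧ stdFlag hθ (g * q) = y ∧
      (∀ j ∈ θ, ∀ v : Vec K d,
        slEquiv g v ∈ y.space (d - j) ↔ ∀ a : Fin d, (a : ℕ) < j → v a = 0) ∧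
      ∀ i ∈ θ, ∀ a b : Fin d, (a : ℕ) < i → (b : ℕ) < d - i →
        (q : Matrix (Fin d) (Fin d) K) a b = 0 := by
  obtain ⟨g, hg, hgy⟩ := h.exists_stdFlag hθ hsymm
  obtain ⟨m, -, hm⟩ := exists_stdFlag_eq hθ y
  refine ⟨g, g⁻¹ * m, hg, by rw [mul_inv_cancel_left, hm], hgy, fun i hi a b ha hb => ?_⟩
  rw [← slEquiv_single]
  refine (hgy i hi _).1 ?_ a ha
  rw [← slEquiv_mul, mul_inv_cancel_left, ← hm, stdFlag_space hθ m (hsymm i hi),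
    map_slEquiv_mem_iff]
  exact single_mem_stdSpace hb

theorem compound_eq_zero_of_opposable (hopp : Opposable d k θ j)
    {q : Matrix (Fin d) (Fin d) K}
    (hq : ∀ i ∈ θ, ∀ a b : Fin d, (a : ℕ) < i → (b : ℕ) < d - i → q a b = 0)
    {I J : Fin (d.choose k)} (hI : (I : ℕ) < j) (hJ : (J : ℕ) < d.choose k - j) :
    compound k q I J = 0 := by
  obtain ⟨s, i, hi, h1, h2⟩ := hopp I J hI hJ
  refine det_eq_zero_of_upper_left_block _ s.rev fun a b ha hb => hq i hi _ _ ?_ ?_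
  · exact lt_of_le_of_lt (Fin.le_def.1 ((tuple d k I).monotone ha)) h1
  · rw [Fin.rev_rev] at hb
    exact lt_of_le_of_lt (Fin.le_def.1 ((tuple d k J).monotone hb)) h2

theorem coord_eq_zero_of_opposable (hk : 1 ≤ k) (hopp : Opposable d k θ j) {q : SL(d, K)}
    (hq : ∀ i ∈ θ, ∀ a b : Fin d, (a : ℕ) < i → (b : ℕ) < d - i →
      (q : Matrix (Fin d) (Fin d) K) a b = 0)
    {v : Vec K (d.choose k)} (hv : v ∈ stdSpace K (d.choose k) (d.choose k - j))
    {I : Fin (d.choose k)} (hI : (I : ℕ) < j) : slEquiv (compoundSL hk q) v I = 0 := by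
  rw [slEquiv_apply_apply]
  refine Finset.sum_eq_zero fun J _ => ?_
  rcases lt_or_ge (J : ℕ) (d.choose k - j) with hJ | hJ
  · rw [coe_compoundSL, compound_eq_zero_of_opposable hopp hq hI hJ, zero_mul]
  · rw [mem_stdSpace_iff.1 hv J hJ, mul_zero]

/-- In a frame adapted to the pair, a common vector has its coordinates supported in the first `j`,
while the vanishing minors make exactly those coordinates zero. Complementary dimensions then turn a
trivial intersection into a sum equal to the whole space. -/
theorem Flag.Transverse.wedgeFlag (hk : 1 ≤ k) (hθ : ∀ j ∈ θ, j ≤ d)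
    (hsymm : ∀ j ∈ θ, d - j ∈ θ) (hθ' : ∀ j ∈ θ', j ≤ d.choose k)
    (hsymm' : ∀ j ∈ θ', d.choose k - j ∈ θ')
    (hsub : ∀ j ∈ θ', Subordinate d k θ j) (hopp : ∀ j ∈ θ', Opposable d k θ j)
    {x y : Flag K d θ} (h : x.Transverse y) :
    (HyperconvexWedge.wedgeFlag hk hθ hθ' x).Transverse
      (HyperconvexWedge.wedgeFlag hk hθ hθ' y) := by
  obtain ⟨g, q, rfl, rfl, -, hq⟩ := exists_coord_of_transverse h hθ hsymm
  rw [wedgeFlag_stdFlag hk hθ hθ' hsub, wedgeFlag_stdFlag hk hθ hθ' hsub]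
  intro j hj
  have h1 : (stdFlag hθ' (compoundSL hk g)).space j ⊓
      (stdFlag hθ' (compoundSL hk (g * q))).space (d.choose k - j) = ⊥ := by
    rw [stdFlag_space hθ' _ hj, stdFlag_space hθ' _ (hsymm' j hj), eq_bot_iff]
    rintro - ⟨⟨v, hv, rfl⟩, ⟨w, hw, hvw⟩⟩
    rw [map_mul] at hvw
    change slEquiv _ w = slEquiv _ v at hvw
    rw [slEquiv_mul] at hvw
    have h2 := (slEquiv _).injective hvw
    have h3 : v = 0 := by
      ext I
      rcases lt_or_ge (I : ℕ) j with hI | hI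
      · rw [← h2]
        exact coord_eq_zero_of_opposable hk (hopp j hj) hq hw hI
      · exact mem_stdSpace_iff.1 hv I hI
    rw [h3, map_zero]
    exact zero_mem _
  have h2 := Submodule.finrank_sup_add_finrank_inf_eq
    ((stdFlag hθ' (compoundSL hk g)).space j)
    ((stdFlag hθ' (compoundSL hk (g * q))).space (d.choose k - j))
  rw [h1, finrank_bot, Flag.finrank_space _ hj, Flag.finrank_space _ (hsymm' j hj)] at h2
  refine Submodule.eq_top_of_finrank_eq ?_
  have := hθ' j hj
  rw [finrank_euclideanSpace_fin]
  omega

/-! ### Exterior powers of hyperconvex groups -/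

theorem isAnosov_map (hk : 1 ≤ k) (hkd : k < d) {Γ : Subgroup PSL(d, K)}
    (hΓ : IsAnosov (theta d k) Γ) :
    IsAnosov (theta (d.choose k) 1) (Γ.map (compoundPSL hk)) := by
  obtain ⟨⟨hsymm, hdiv, htr⟩, hcon⟩ := hΓ
  have hlim := limitSet_theta_map hk hkd hdiv
  have hinj := thetaFlag_injective (K := K) hk hkd
  have hsymm' : ∀ j ∈ theta (d.choose k) 1, d.choose k - j ∈ theta (d.choose k) 1 :=
    fun j => sub_mem_theta (one_lt_choose hk hkd)
  refine ⟨⟨hsymm', hdiv.map_compoundPSL hk (fun _ => theta_range (one_lt_choose hk hkd))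
    (fun _ => subordinate_theta hk hkd), ?_⟩, ?_⟩
  · rw [hlim]
    rintro - ⟨x, hx, rfl⟩ - ⟨y, hy, rfl⟩ hxy
    exact (htr x hx y hy (fun h => hxy (h ▸ rfl))).wedgeFlag hk _ hsymm _ hsymm'
      (fun _ => subordinate_theta hk hkd) (fun _ => opposable_theta hk hkd)
  · rw [hlim]
    rintro - ⟨x, hx, rfl⟩
    obtain ⟨γ, hγ, a, ha, b, hb, hab, hxa, hyb⟩ := hcon x hx
    have hact : ∀ (g : PSL(d, K)) y, (thetaFlag hk hkd y).act (compoundPSL hk g) =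
        thetaFlag hk hkd (y.act g) := fun g y =>
      (wedgeFlag_act hk _ _ (fun _ => subordinate_theta hk hkd) g y).symm
    refine ⟨fun i => compoundPSL hk (γ i), fun i => ⟨γ i, hγ i, rfl⟩, thetaFlag hk hkd a, ?_,
      thetaFlag hk hkd b, ?_, hinj.ne hab, ?_, ?_⟩
    · rw [hlim]; exact ⟨a, ha, rfl⟩
    · rw [hlim]; exact ⟨b, hb, rfl⟩
    · simp only [hact]
      exact ((continuous_thetaFlag hk hkd).tendsto a).comp hxa
    · rw [hlim]
      rintro - ⟨y, hy, rfl⟩ hyx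
      simp only [hact]
      exact ((continuous_thetaFlag hk hkd).tendsto b).comp
        (hyb y hy fun h => hyx (h ▸ rfl))

theorem Flag.space_self (x : Flag K d (theta d k)) (hkd : k < d) : x.space d = ⊤ := by
  have h : d ∉ theta d k := fun h => (theta_range hkd h).2.false
  rw [Flag.space, dif_neg h, if_neg (by omega)]

theorem Flag.space_zero (x : Flag K d (theta d k)) (hkd : k < d) : x.space 0 = ⊥ := by
  have h : 0 ∉ theta d k := fun h => absurd (theta_range hkd h).1 (by omega)
  rw [Flag.space, dif_neg h, if_pos rfl]

/-- The boundary cases are needed because `k - 1` may be `0` and `k + 1` may be `d`, which do not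
belong to `θ_k`. -/
theorem mem_space_iff_of_adapted (hkd : k < d) {g : SL(d, K)} {z : Flag K d (theta d k)}
    (hz : ∀ j ∈ theta d k, ∀ v : Vec K d,
      slEquiv g v ∈ z.space (d - j) ↔ ∀ a : Fin d, (a : ℕ) < j → v a = 0)
    (hj : j ∈ theta d k ∨ j = 0 ∨ j = d) (v : Vec K d) :
    slEquiv g v ∈ z.space (d - j) ↔ ∀ a : Fin d, (a : ℕ) < j → v a = 0 := by
  rcases hj with hj | rfl | rfl
  · exact hz j hj v
  · rw [Nat.sub_zero, z.space_self hkd]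
    simp
  · rw [Nat.sub_self, z.space_zero hkd, Submodule.mem_bot, LinearEquiv.map_eq_zero_iff]
    exact ⟨fun h a _ => by rw [h]; rfl, fun h => by ext a; exact h a a.2⟩

/-- The coordinate of `⋀^k y` along the second basis vector of `⋀^k K^d`, in a frame adapted to
`x` and `z`, does not vanish. -/
theorem compound_second_ne_zero (hk : 1 ≤ k) (hkd : k < d) {x z : Flag K d (theta d k)}
    {g h : SL(d, K)} (hx : stdFlag (theta_le hkd) g = x)
    (hz : ∀ j ∈ theta d k, ∀ v : Vec K d,
      slEquiv g v ∈ z.space (d - j) ↔ ∀ a : Fin d, (a : ℕ) < j → v a = 0)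
    (hyz : (stdFlag (theta_le hkd) h).Transverse z)
    (hhyp : ((x.space k ⊓ z.space (d - k + 1)) ⊔ z.space (d - k - 1)) ⊓
        (((stdFlag (theta_le hkd) h).space k ⊓ z.space (d - k + 1)) ⊔ z.space (d - k - 1)) =
          z.space (d - k - 1)) {I₁ I₂ : Fin (d.choose k)}
    (h₁ : ∀ s, (tuple d k I₁ s : ℕ) = s)
    (h₂ : ∀ s : Fin k, (tuple d k I₂ s : ℕ) = if (s : ℕ) + 1 = k then k else s) :
    compound k ((g⁻¹ * h : SL(d, K)) : Matrix (Fin d) (Fin d) K) I₂ I₁ ≠ 0 := by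
  intro h0
  rw [compound_apply] at h0
  -- A kernel vector of the vanishing minor gives a nonzero vector of `y^k` whose coordinates `0, …,
  -- k - 2` and `k` in the frame `g` are zero.
  obtain ⟨c, hc0, hc⟩ := Matrix.exists_mulVec_eq_zero_iff.2 h0
  set u : Vec K d := ∑ s, c s • EuclideanSpace.single (tuple d k I₁ s) (1 : K) with hu
  set w : Vec K d := slEquiv (g⁻¹ * h) u with hw
  have hkθ := self_mem_theta hk hkd
  have hu_mem : u ∈ stdSpace K d k := by
    refine sum_mem fun s _ => Submodule.smul_mem _ _ (single_mem_stdSpace ?_)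
    rw [h₁]; exact s.2
  have hgw : slEquiv g w = slEquiv h u := by
    rw [hw, ← slEquiv_mul, mul_inv_cancel_left]
  have hwy : slEquiv g w ∈ (stdFlag (theta_le hkd) h).space k := by
    rw [hgw, stdFlag_space _ _ hkθ, map_slEquiv_mem_iff]
    exact hu_mem
  have hw0 : ∀ s, w (tuple d k I₂ s) = 0 := by
    intro s
    have h3 := congrFun hc s
    rw [hw, hu, map_sum]
    simp only [Matrix.mulVec, dotProduct, Matrix.submatrix_apply, Pi.zero_apply] at h3
    rw [← h3, WithLp.ofLp_sum, Finset.sum_apply]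
    refine Finset.sum_congr rfl fun t _ => ?_
    rw [map_smul, PiLp.smul_apply, slEquiv_single, smul_eq_mul, mul_comm]
  have hwa : ∀ a : Fin d, (a : ℕ) < k - 1 ∨ (a : ℕ) = k → w a = 0 := by
    intro a ha
    rcases ha with ha | ha
    · have h3 : tuple d k I₂ ⟨a, by omega⟩ = a := by
        refine Fin.ext ?_
        rw [h₂, if_neg]
        (try simp only); omega
      rw [← h3]; exact hw0 _
    · have h3 : tuple d k I₂ ⟨k - 1, by omega⟩ = a := by
        refine Fin.ext ?_
        rw [h₂, if_pos, ha]
        (try simp only); omega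
      rw [← h3]; exact hw0 _
  have hz' := fun {j} => mem_space_iff_of_adapted (j := j) hkd hz
  have hlow : k - 1 ∈ theta d k ∨ k - 1 = 0 ∨ k - 1 = d := by
    rw [mem_theta]; omega
  have hhigh : k + 1 ∈ theta d k ∨ k + 1 = 0 ∨ k + 1 = d := by
    rw [mem_theta]; omega
  have e1 : d - k + 1 = d - (k - 1) := by omega
  have e2 : d - k - 1 = d - (k + 1) := by omega
  have hwz : slEquiv g w ∈ z.space (d - k + 1) := by
    rw [e1, hz' hlow]
    exact fun a ha => hwa a (Or.inl ha)
  obtain ⟨t, ht, htw⟩ := sub_truncate_mem w k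
  have hta : ∀ a : Fin d, (a : ℕ) < k → t a = w a := by
    intro a ha
    have := (htw a).1 ha
    rw [PiLp.sub_apply, sub_eq_zero] at this
    exact this.symm
  -- Truncating after coordinate `k - 1` leaves a vector of `x^k ∩ z^{d-k+1}`. The remainder starts
  -- beyond coordinate `k`, since that coordinate vanishes, and so lies in `z^{d-k-1}`.
  have h4 : slEquiv g w ∈ (x.space k ⊓ z.space (d - k + 1)) ⊔ z.space (d - k - 1) := by
    have h5 : slEquiv g w = slEquiv g t + slEquiv g (w - t) := by
      rw [map_sub, add_sub_cancel]
    rw [h5]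
    refine Submodule.add_mem_sup ⟨?_, ?_⟩ ?_
    · rw [← hx]
      change slEquiv g t ∈ (stdFlag (theta_le hkd) g).space k
      rw [stdFlag_space _ _ hkθ, map_slEquiv_mem_iff]
      exact ht
    · change slEquiv g t ∈ z.space (d - k + 1)
      rw [e1, hz' hlow]
      intro a ha
      rw [hta a (by omega)]
      exact hwa a (Or.inl ha)
    · rw [e2, hz' hhigh]
      intro a ha
      rcases lt_or_ge (a : ℕ) k with h6 | h6
      · exact (htw a).1 h6
      · rw [(htw a).2 h6]
        exact hwa a (Or.inr (by omega))
  have h5 : slEquiv g w ∈ z.space (d - k - 1) := by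
    rw [← hhyp]
    exact ⟨h4, Submodule.mem_sup_left ⟨hwy, hwz⟩⟩
  rw [e2, hz' hhigh] at h5
  have h6 : slEquiv g w ∈ z.space (d - k) := by
    rw [hz k hkθ]
    exact fun a ha => h5 a (by omega)
  have h7 : slEquiv g w ∈ (stdFlag (theta_le hkd) h).space k ⊓ z.space (d - k) := ⟨hwy, h6⟩
  rw [hyz.disjoint (theta_le hkd) (fun _ => sub_mem_theta hkd) hkθ, Submodule.mem_bot, hgw,
    LinearEquiv.map_eq_zero_iff] at h7
  refine hc0 (funext fun s => ?_)
  exact Fintype.linearIndependent_iff.1 (linearIndependent_single_tuple (K := K) I₁) c h7 s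

/-- In dimension `D` with index `1` the space `z^{d-k+1}` becomes everything, and only `(x^1 +
z^{D-2}) ∩ (y^1 + z^{D-2})` matters. The second coordinate in the frame adapted to `x` and `z`
vanishes on `x^1` and on `z^{D-2}`, but not on `y^1`; hence a common vector has no `y^1` component.
-/
theorem isCoHyperconvex_map (hk : 1 ≤ k) (hkd : k < d) {Γ : Subgroup PSL(d, K)}
    (hΓ : IsCoHyperconvex k Γ) : IsCoHyperconvex 1 (Γ.map (compoundPSL hk)) := by
  have hD := two_le_choose hk hkd
  refine ⟨isAnosov_map hk hkd hΓ.1, ?_⟩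
  obtain ⟨⟨⟨hsymm, hdiv, htr⟩, -⟩, hhyp⟩ := hΓ
  rw [limitSet_theta_map hk hkd hdiv]
  rintro - ⟨x, hx, rfl⟩ - ⟨y, hy, rfl⟩ - ⟨z, hz, rfl⟩ hxy hyz hxz
  replace hxy : x ≠ y := fun h => hxy (h ▸ rfl)
  replace hyz : y ≠ z := fun h => hyz (h ▸ rfl)
  replace hxz : x ≠ z := fun h => hxz (h ▸ rfl)
  have hhyp := hhyp x hx y hy z hz hxy hyz hxz
  have htr := htr y hy z hz hyz
  obtain ⟨g, q, hgx, hqz, hgz, hq⟩ := exists_coord_of_transverse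
    (‹∀ x ∈ limitSet (theta d k) Γ, ∀ y ∈ limitSet (theta d k) Γ, x ≠ y → x.Transverse y›
      x hx z hz hxz) (theta_le hkd) hsymm
  obtain ⟨h, -, rfl⟩ := exists_stdFlag_eq (theta_le hkd) y
  set I₁ : Fin (d.choose k) := ⟨0, by omega⟩ with hI₁
  set I₂ : Fin (d.choose k) := ⟨1, by omega⟩ with hI₂
  have h₁ := (lt_one_iff_tuple hkd I₁).1 (by simp [hI₁])
  have h₂ := ((lt_two_iff_tuple hk hkd I₂).1 (by simp [hI₂])).resolve_left
    (by rw [← lt_one_iff_tuple hkd]; simp [hI₂])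
  have hne := compound_second_ne_zero hk hkd hgx hgz htr hhyp h₁ h₂
  have h1θ := self_mem_theta le_rfl (one_lt_choose hk hkd)
  rw [show d.choose k - 1 + 1 = d.choose k by omega,
    (thetaFlag hk hkd z).space_self (one_lt_choose hk hkd), inf_top_eq, inf_top_eq]
  have hone : ∀ p : SL(d, K), (thetaFlag hk hkd (stdFlag (theta_le hkd) p)).space 1 =
      Submodule.span K {slEquiv (compoundSL hk p) (EuclideanSpace.single I₁ 1)} := by
    intro p
    rw [thetaFlag_stdFlag, stdFlag_space _ _ h1θ, stdSpace_one_eq (by omega), Submodule.map_span,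
      Set.image_singleton]
    rfl
  have hZ : ∀ v ∈ (thetaFlag hk hkd z).space (d.choose k - 1 - 1),
      slEquiv (compoundSL hk g⁻¹) v I₂ = 0 := by
    intro v hv
    rw [show d.choose k - 1 - 1 = d.choose k - 2 by omega] at hv
    rcases hD.eq_or_lt with hD2 | hD2
    · rw [show d.choose k - 2 = 0 by omega, Flag.space_zero _ (one_lt_choose hk hkd), Submodule.mem_bot] at hv
      rw [hv, map_zero]
      rfl
    · have h2θ : 2 ∈ theta (d.choose k) 1 := by rw [mem_theta_one hD]; omega
      rw [← hqz, thetaFlag_stdFlag, stdFlag_space _ _ (sub_mem_theta (one_lt_choose hk hkd) h2θ)]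
        at hv
      obtain ⟨w, hw, rfl⟩ := hv
      have h3 := coord_eq_zero_of_opposable hk (opposable_theta hk hkd h2θ) hq hw
        (I := I₂) (by simp [hI₂])
      change slEquiv (compoundSL hk g⁻¹) (slEquiv (compoundSL hk (g * q)) w) I₂ = 0
      rw [← slEquiv_mul, ← map_mul, inv_mul_cancel_left]
      exact h3
  refine le_antisymm ?_ (le_inf le_sup_right le_sup_right)
  rintro t ⟨ht1, ht2⟩
  rw [← hgx] at ht1
  rw [SetLike.mem_coe, hone] at ht1 ht2
  obtain ⟨a, ha, z₁, hz₁, rfl⟩ := Submodule.mem_sup.1 ht1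
  obtain ⟨b, hb, z₂, hz₂, hab⟩ := Submodule.mem_sup.1 ht2
  obtain ⟨α, rfl⟩ := Submodule.mem_span_singleton.1 ha
  obtain ⟨β, rfl⟩ := Submodule.mem_span_singleton.1 hb
  have h3 := congrArg (fun v => slEquiv (compoundSL hk g⁻¹) v I₂) hab
  simp only [map_add, map_smul, PiLp.add_apply, PiLp.smul_apply, hZ z₁ hz₁, hZ z₂ hz₂,
    add_zero] at h3
  rw [← slEquiv_mul, ← map_mul, ← slEquiv_mul, ← map_mul, inv_mul_cancel, map_one, slEquiv_one,
    slEquiv_single, coe_compoundSL] at h3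
  have h4 : β = 0 := by
    have h5 : I₂ ≠ I₁ := by rw [hI₁, hI₂, ne_eq, Fin.ext_iff]; simp
    rw [PiLp.single_apply, if_neg h5, smul_zero, smul_eq_mul] at h3
    exact (mul_eq_zero.1 h3).resolve_right hne
  rw [← hab, h4, zero_smul, zero_add]
  exact hz₂

/-! ### The Iwasawa cocycle -/

/-- The fundamental weight `ω_j(A) = A_1 + ⋯ + A_j`. -/
def weight (j : ℕ) (A : Fin d → ℝ) : ℝ :=
  ∑ s ∈ Finset.range j, if h : s < d then A ⟨s, h⟩ else 0

theorem weight_succ {j : ℕ} (hj : j < d) (A : Fin d → ℝ) :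
    weight (j + 1) A = weight j A + A ⟨j, hj⟩ := by
  rw [weight, Finset.sum_range_succ, dif_pos hj, weight]

theorem simpleRoot_eq_weight (hk : 1 ≤ k) (hkd : k < d) (A : Fin d → ℝ) :
    simpleRoot d k A = 2 * weight k A - weight (k - 1) A - weight (k + 1) A := by
  obtain ⟨k, rfl⟩ : ∃ l, k = l + 1 := ⟨k - 1, by omega⟩
  rw [simpleRoot_apply hk hkd, weight_succ hkd, weight_succ (show k < d by omega)]
  simp only [Nat.add_sub_cancel]
  ring

theorem tupleSum_eq_weight {I : Fin (d.choose j)} (hI : ∀ s, (tuple d j I s : ℕ) = s)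
    (A : Fin d → ℝ) : tupleSum j A I = weight j A := by
  rw [tupleSum, weight, Finset.sum_range]
  refine Finset.sum_congr rfl fun s _ => ?_
  have hs : (s : ℕ) < d := by rw [← hI]; exact (tuple d j I s).2
  rw [dif_pos hs]
  exact congrArg A (Fin.ext (hI s))

theorem det_expDiag (A : Fin d → ℝ) : (expDiag K A).det = ((Real.exp (∑ i, A i) : ℝ) : K) := by
  rw [expDiag, Matrix.det_diagonal, Real.exp_sum]
  push_cast
  rfl

theorem weight_self {X m n : SL(d, K)} {A : Fin d → ℝ}
    (h : (X : Matrix (Fin d) (Fin d) K) = m * expDiag K A * n) : weight d A = 0 := by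
  have h1 := congrArg Matrix.det h
  rw [Matrix.det_mul, Matrix.det_mul, Matrix.SpecialLinearGroup.det_coe,
    Matrix.SpecialLinearGroup.det_coe, Matrix.SpecialLinearGroup.det_coe, one_mul, mul_one,
    det_expDiag] at h1
  have h2 : Real.exp (∑ i, A i) = 1 := by exact_mod_cast h1.symm
  rw [Real.exp_eq_one_iff] at h2
  rw [weight, Finset.sum_range, ← h2]
  refine Finset.sum_congr rfl fun i _ => ?_
  rw [dif_pos i.2]

theorem norm_compoundSL_single {X m n : SL(d, K)} {A : Fin d → ℝ} (hj : 1 ≤ j) (hm : IsSU m)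
    (hn : IsUpperUnipotent n) (h : (X : Matrix (Fin d) (Fin d) K) = m * expDiag K A * n)
    {I : Fin (d.choose j)} (hI : (I : ℕ) < 1) :
    ‖slEquiv (compoundSL hj X) (EuclideanSpace.single I 1)‖ = Real.exp (tupleSum j A I) := by
  have hn' := isUpperUnipotent_compoundSL hj hn
  have h1 : slEquiv (compoundSL hj X) (EuclideanSpace.single I (1 : K)) =
      ((Real.exp (tupleSum j A I) : ℝ) : K) •
        slEquiv (compoundSL hj m) (EuclideanSpace.single I 1) := by
    ext J
    rw [slEquiv_single, PiLp.smul_apply, slEquiv_single, compoundSL_svd hj h, Matrix.mul_apply,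
      Finset.sum_eq_single I, hn'.1, mul_one, expDiag, Matrix.mul_diagonal, mul_comm, smul_eq_mul]
    · intro L _ hL
      rw [hn'.2 L I (Fin.lt_def.2 ?_), mul_zero]
      have : (L : ℕ) ≠ I := fun h => hL (Fin.ext h)
      omega
    · intro h
      exact absurd (Finset.mem_univ _) h
  rw [h1, norm_smul, norm_slEquiv (isSU_compoundSL hj hm)]
  simp

/-- By `norm_compoundSL_single`, `exp(ω_j)` is the norm of the image of the unit vector representing
`⋀^j x^j`. Another lift or another refining full flag changes that image by a scalar of modulus one.
-/
theorem IsIwasawa.weight_eq (hj : 1 ≤ j) (hjd : j < d) {g : PSL(d, K)} {x : Flag K d θ}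
    (hjθ : j ∈ θ) {A B : Fin d → ℝ} (hA : IsIwasawa g x A) (hB : IsIwasawa g x B) :
    weight j A = weight j B := by
  obtain ⟨g₁, h₁, m₁, n₁, rfl, hh₁, hm₁, hn₁, hx₁, hg₁⟩ := hA
  obtain ⟨g₂, h₂, m₂, n₂, hg, hh₂, hm₂, hn₂, hx₂, hg₂⟩ := hB
  have hD : 0 < d.choose j := Nat.choose_pos hjd.le
  set I : Fin (d.choose j) := ⟨0, hD⟩ with hI
  have hI' := (lt_one_iff_tuple hjd I).1 (by simp [hI])
  rw [← Matrix.SpecialLinearGroup.coe_mul] at hg₁ hg₂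
  have e₁ := norm_compoundSL_single hj hm₁ hn₁ hg₁ (I := I) (by simp [hI])
  have e₂ := norm_compoundSL_single hj hm₂ hn₂ hg₂ (I := I) (by simp [hI])
  rw [tupleSum_eq_weight hI'] at e₁ e₂
  rw [← Real.exp_eq_exp, ← e₁, ← e₂]
  obtain ⟨c, hc, hcg⟩ := coe_eq_coe_iff.1 hg.symm
  have hp : ∀ a b : Fin d, (b : ℕ) < j → j ≤ (a : ℕ) →
      ((h₁⁻¹ * h₂ : SL(d, K)) : Matrix (Fin d) (Fin d) K) a b = 0 := by
    rw [← map_stdSpace_eq_iff hjd.le, map_slEquiv_mul, ← hx₂ ⟨j, hjθ⟩, hx₁ ⟨j, hjθ⟩,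
      ← map_slEquiv_mul, inv_mul_cancel, map_slEquiv_one]
  have hpe : ∃ a : K, slEquiv (compoundSL hj (h₁⁻¹ * h₂)) (EuclideanSpace.single I (1 : K)) =
      a • EuclideanSpace.single I 1 := by
    refine ⟨compound j ((h₁⁻¹ * h₂ : SL(d, K)) : Matrix (Fin d) (Fin d) K) I I, ?_⟩
    ext J
    rw [slEquiv_single, coe_compoundSL, PiLp.smul_apply, PiLp.single_apply]
    by_cases hJ : J = I
    · rw [hJ, if_pos rfl, smul_eq_mul, mul_one]
    · rw [if_neg hJ, smul_zero]
      refine compound_eq_zero_of_subordinate (θ := {j}) (j := 1)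
        (subordinate_one hj hjd (Finset.mem_singleton_self j)) ?_ (by simp [hI]) ?_
      · intro i hi
        rw [Finset.mem_singleton.1 hi]
        exact hp
      · have : (J : ℕ) ≠ 0 := fun h => hJ (Fin.ext h)
        omega
  obtain ⟨a, ha⟩ := hpe
  have hna : ‖a‖ = 1 := by
    have h3 := congrArg norm ha
    rw [norm_slEquiv (isSU_compoundSL hj (hh₁.inv.mul hh₂)), norm_smul] at h3
    simpa using h3.symm
  have h3 : slEquiv (compoundSL hj (g₂ * h₂)) (EuclideanSpace.single I (1 : K)) =
      (c ^ j * a) • slEquiv (compoundSL hj (g₁ * h₁)) (EuclideanSpace.single I 1) := by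
    have h4 : slEquiv (compoundSL hj (g₂ * h₂)) (EuclideanSpace.single I (1 : K)) =
        c ^ j • slEquiv (compoundSL hj (g₁ * h₂)) (EuclideanSpace.single I 1) := by
      ext J
      rw [slEquiv_single, PiLp.smul_apply, slEquiv_single, coe_compoundSL, coe_compoundSL,
        Matrix.SpecialLinearGroup.coe_mul, Matrix.SpecialLinearGroup.coe_mul, hcg,
        Matrix.smul_mul, compound_smul]
      rfl
    have h5 : g₁ * h₂ = g₁ * h₁ * (h₁⁻¹ * h₂) := by group
    rw [h4, h5, map_mul, slEquiv_mul, ha, map_smul, mul_smul]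
  rw [h3, norm_smul, norm_mul, norm_pow, norm_eq_one_of_pow (by omega) hc, hna]
  simp

/-- The root is a combination of `ω_{k-1}`, `ω_k` and `ω_{k+1}`, each with index in `θ_k` or equal
to `0` or `d`. In the last two cases the weight is zero, by emptiness of the sum or by determinant
one. Hence the arbitrary choice inside `iwasawa` is harmless. -/
theorem IsIwasawa.simpleRoot_eq (hk : 1 ≤ k) (hkd : k < d) {g : PSL(d, K)}
    {x : Flag K d (theta d k)} {A B : Fin d → ℝ} (hA : IsIwasawa g x A)
    (hB : IsIwasawa g x B) : simpleRoot d k A = simpleRoot d k B := by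
  have key : ∀ j, j ∈ theta d k ∨ j = 0 ∨ j = d → weight j A = weight j B := by
    rintro j (hj | rfl | rfl)
    · exact hA.weight_eq (theta_range hkd hj).1 (theta_range hkd hj).2 hj hB
    · simp [weight]
    · obtain ⟨g₁, h₁, m₁, n₁, -, -, -, -, -, hg₁⟩ := hA
      obtain ⟨g₂, h₂, m₂, n₂, -, -, -, -, -, hg₂⟩ := hB
      rw [← Matrix.SpecialLinearGroup.coe_mul] at hg₁ hg₂
      rw [weight_self hg₁, weight_self hg₂]
  rw [simpleRoot_eq_weight hk hkd, simpleRoot_eq_weight hk hkd, key k, key (k - 1), key (k + 1)]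
  all_goals rw [mem_theta]; omega

/-- A special unitary `m` with the same full flag as `g` makes `m⁻¹ g` upper triangular. Its
diagonal splits into phases, absorbed into `m`, and absolute values, which form `exp(A)`. -/
theorem exists_iwasawa_decomposition (g : SL(d, K)) :
    ∃ (m n : SL(d, K)) (A : Fin d → ℝ), IsSU m ∧ IsUpperUnipotent n ∧
      (g : Matrix (Fin d) (Fin d) K) = m * expDiag K A * n := by
  have hθ : ∀ j ∈ Finset.range d, j ≤ d := fun j hj => (Finset.mem_range.1 hj).le
  obtain ⟨m, hm, hmg⟩ := exists_stdFlag_eq hθ (stdFlag hθ g)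
  rw [stdFlag_eq_iff] at hmg
  set p : Matrix (Fin d) (Fin d) K := ((m⁻¹ * g : SL(d, K)) : Matrix (Fin d) (Fin d) K) with hp
  have hpdet : p.det = 1 := Matrix.SpecialLinearGroup.det_coe _
  have htri : ∀ a b, b < a → p a b = 0 := by
    intro a b hba
    exact (map_stdSpace_eq_iff (hθ a (Finset.mem_range.2 a.2)) _).1
      (hmg a (Finset.mem_range.2 a.2)) a b hba le_rfl
  have hprod : ∏ a, p a a = 1 := by
    rw [← hpdet, det_of_isUpperTriangular (fun a b hba => htri a b hba)]
  have hne : ∀ a, p a a ≠ 0 := by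
    intro a h
    have h1 : ∏ a, p a a = 0 := Finset.prod_eq_zero (Finset.mem_univ a) h
    exact zero_ne_one (h1.symm.trans hprod)
  have hnorm : ∀ a, 0 < ‖p a a‖ := fun a => norm_pos_iff.2 (hne a)
  set A : Fin d → ℝ := fun a => Real.log ‖p a a‖ with hA
  have hexp : ∀ a, Real.exp (A a) = ‖p a a‖ := fun a => Real.exp_log (hnorm a)
  set u : Fin d → K := fun a => p a a / ((‖p a a‖ : ℝ) : K) with hu
  have hpu : ∀ a, p a a = u a * ((‖p a a‖ : ℝ) : K) := by
    intro a
    rw [hu]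
    dsimp only
    rw [div_mul_cancel₀]
    exact RCLike.ofReal_ne_zero.2 (hnorm a).ne'
  have hun : ∀ a, ‖u a‖ = 1 := by
    intro a
    rw [hu]
    dsimp only
    rw [norm_div, RCLike.norm_ofReal, abs_of_pos (hnorm a), div_self (hnorm a).ne']
  have hnprod : ∏ a, ((‖p a a‖ : ℝ) : K) = 1 := by
    have h1 := congrArg norm hprod
    rw [norm_prod, norm_one] at h1
    rw [← map_prod (algebraMap ℝ K) (fun a => ‖p a a‖) Finset.univ]
    exact (congrArg _ h1).trans (map_one _)
  have huprod : ∏ a, u a = 1 := by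
    rw [hu, Finset.prod_div_distrib, hprod, hnprod, div_one]
  have hudet : (Matrix.diagonal u).det = 1 := by rw [Matrix.det_diagonal, huprod]
  let U : SL(d, K) := ⟨Matrix.diagonal u, hudet⟩
  have hU : IsSU U := by
    rw [IsSU, Matrix.mem_unitaryGroup_iff, Matrix.star_eq_conjTranspose]
    change Matrix.diagonal u * (Matrix.diagonal u)ᴴ = 1
    rw [Matrix.diagonal_conjTranspose, Matrix.diagonal_mul_diagonal, ← Matrix.diagonal_one]
    congr 1
    ext a
    rw [Pi.star_apply, RCLike.star_def, RCLike.mul_conj, hun]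
    simp
  set N : Matrix (Fin d) (Fin d) K := Matrix.of fun a b => (p a a)⁻¹ * p a b with hN
  have hNtri : ∀ a b, b < a → N a b = 0 := by
    intro a b hba
    rw [hN, Matrix.of_apply, htri a b hba, mul_zero]
  have hNdiag : ∀ a, N a a = 1 := by
    intro a
    rw [hN, Matrix.of_apply, inv_mul_cancel₀ (hne a)]
  have hNdet : N.det = 1 := by
    rw [det_of_isUpperTriangular (fun a b hba => hNtri a b hba)]
    exact Finset.prod_eq_one fun a _ => hNdiag a
  let n : SL(d, K) := ⟨N, hNdet⟩
  refine ⟨m * U, n, A, hm.mul hU, ⟨hNdiag, hNtri⟩, ?_⟩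
  have hpN : p = Matrix.diagonal u * expDiag K A * N := by
    ext a b
    rw [expDiag, Matrix.diagonal_mul_diagonal, Matrix.diagonal_mul, hexp, ← hpu, hN,
      Matrix.of_apply, mul_inv_cancel_left₀ (hne a)]
  have hg : (g : Matrix (Fin d) (Fin d) K) = (m : Matrix (Fin d) (Fin d) K) * p := by
    rw [hp, ← Matrix.SpecialLinearGroup.coe_mul, mul_inv_cancel_left]
  rw [hg, hpN, Matrix.SpecialLinearGroup.coe_mul]
  simp only [Matrix.mul_assoc]
  rfl

theorem isIwasawa_iwasawa (hθ : ∀ j ∈ θ, j ≤ d) (g : PSL(d, K)) (x : Flag K d θ) :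
    IsIwasawa g x (iwasawa g x) := by
  refine Classical.epsilon_spec ?_
  obtain ⟨h, hh, rfl⟩ := exists_stdFlag_eq hθ x
  obtain ⟨m, n, A, hm, hn, hmn⟩ := exists_iwasawa_decomposition (pslLift g * h)
  exact ⟨A, pslLift g, h, m, n, coe_pslLift g, hh, hm, hn, fun _ => rfl, hmn⟩

/-- Unlike the singular value decomposition, the Iwasawa decomposition imposes no order on the
exponents, so the tuple sums need no sorting. -/
theorem IsIwasawa.wedgeFlag (hk : 1 ≤ k) (hθ : ∀ j ∈ θ, j ≤ d)
    (hθ' : ∀ j ∈ θ', j ≤ d.choose k) (hsub : ∀ j ∈ θ', Subordinate d k θ j)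
    {g : PSL(d, K)} {x : Flag K d θ} {A : Fin d → ℝ} (hA : IsIwasawa g x A) :
    IsIwasawa (compoundPSL hk g) (HyperconvexWedge.wedgeFlag hk hθ hθ' x : Flag K _ θ')
      (tupleSum k A) := by
  obtain ⟨g', h, m, n, rfl, hh, hm, hn, hx, hg⟩ := hA
  obtain rfl : x = stdFlag hθ h := Flag.ext (funext fun j => Gr.ext (hx j))
  refine ⟨compoundSL hk g', compoundSL hk h, compoundSL hk m, compoundSL hk n, rfl,
    isSU_compoundSL hk hh, isSU_compoundSL hk hm, isUpperUnipotent_compoundSL hk hn, ?_, ?_⟩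
  · rw [wedgeFlag_stdFlag hk hθ hθ' hsub]
    exact fun _ => rfl
  · rw [← Matrix.SpecialLinearGroup.coe_mul] at hg
    rw [← Matrix.SpecialLinearGroup.coe_mul, ← map_mul]
    exact compoundSL_svd hk hg

theorem simpleRoot_iwasawa_thetaFlag (hk : 1 ≤ k) (hkd : k < d) (g : PSL(d, K))
    (x : Flag K d (theta d k)) :
    simpleRoot (d.choose k) 1 (iwasawa (compoundPSL hk g) (thetaFlag hk hkd x)) =
      simpleRoot d k (iwasawa g x) := by
  have hD := two_le_choose hk hkd
  have h1 := (isIwasawa_iwasawa (theta_le hkd) g x).wedgeFlag hk (theta_le hkd)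
    (theta_one_le hk hkd) (fun _ => subordinate_theta hk hkd)
  have h2 := isIwasawa_iwasawa (theta_one_le hk hkd) (compoundPSL hk g) (thetaFlag hk hkd x)
  rw [h2.simpleRoot_eq le_rfl hD h1, simpleRoot_apply le_rfl hD]
  refine tupleSum_first_sub_second hk hkd ((lt_one_iff_tuple hkd _).1 (by simp)) ?_ _
  exact ((lt_two_iff_tuple hk hkd _).1 (by simp)).resolve_left
    (by rw [← lt_one_iff_tuple hkd]; simp)

/-! ### Patterson–Sullivan measures -/

theorem measurableEmbedding_thetaFlag (hk : 1 ≤ k) (hkd : k < d) :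
    MeasurableEmbedding (thetaFlag hk hkd : Flag K d (theta d k) → _) :=
  (isClosedEmbedding_thetaFlag hk hkd).measurableEmbedding

theorem absolutelyContinuous_map_iff {α β : Type*} [MeasurableSpace α] [MeasurableSpace β]
    {f : α → β} (hf : MeasurableEmbedding f) {μ ν : Measure α} :
    μ.map f ≪ ν.map f ↔ μ ≪ ν := by
  refine ⟨fun h => ?_, fun h => h.map hf.measurable⟩
  refine Measure.AbsolutelyContinuous.mk fun s hs hνs => ?_
  have h1 : ν.map f (f '' s) = 0 := by
    rw [hf.map_apply, Set.preimage_image_eq _ hf.injective, hνs]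
  have h2 := h h1
  rwa [hf.map_apply, Set.preimage_image_eq _ hf.injective] at h2

theorem map_act_map_thetaFlag (hk : 1 ≤ k) (hkd : k < d) (g : PSL(d, K))
    (μ : Measure (Flag K d (theta d k))) :
    (μ.map (thetaFlag hk hkd)).map (Flag.act (compoundPSL hk g)) =
      (μ.map (Flag.act g)).map (thetaFlag hk hkd) := by
  have h1 := (measurableEmbedding_thetaFlag (K := K) hk hkd).measurable
  rw [Measure.map_map (Flag.continuous_act _).measurable h1,
    Measure.map_map h1 (Flag.continuous_act _).measurable]
  congr 1
  funext x
  exact (wedgeFlag_act hk _ _ (fun _ => subordinate_theta hk hkd) g x).symm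

/-- Support, mutual absolute continuity and Radon–Nikodym derivatives all transfer both ways along a
measurable embedding, which intertwines the actions and the cocycles. The equivalence serves both
directions of the correspondence. -/
theorem isPattersonSullivan_map_iff (hk : 1 ≤ k) (hkd : k < d) {Γ : Subgroup PSL(d, K)}
    (hΓ : IsDivergent (theta d k) Γ) (μ : Measure (Flag K d (theta d k))) :
    IsPattersonSullivan (theta (d.choose k) 1) (simpleRoot (d.choose k) 1)
        (Γ.map (compoundPSL hk)) (μ.map (thetaFlag hk hkd)) ↔
      IsPattersonSullivan (theta d k) (simpleRoot d k) Γ μ := by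
  have hemb := measurableEmbedding_thetaFlag (K := K) hk hkd
  rw [IsPattersonSullivan, IsPattersonSullivan, critExp_map hk hkd, hemb.ae_map_iff,
    Measure.isProbabilityMeasure_map_iff hemb.measurable.aemeasurable,
    limitSet_theta_map hk hkd hΓ]
  refine and_congr_right fun _ => and_congr_right fun hprob => and_congr ?_ ?_
  · simp only [hemb.injective.mem_set_image]
  · have key : ∀ γ, ((μ.map (thetaFlag hk hkd)).map (Flag.act (compoundPSL hk γ)) ≪
          μ.map (thetaFlag hk hkd) ∧
        μ.map (thetaFlag hk hkd) ≪ (μ.map (thetaFlag hk hkd)).map (Flag.act (compoundPSL hk γ)) ∧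
        ((μ.map (thetaFlag hk hkd)).map (Flag.act (compoundPSL hk γ))).rnDeriv
            (μ.map (thetaFlag hk hkd)) =ᵐ[μ.map (thetaFlag hk hkd)] fun x =>
          ENNReal.ofReal (Real.exp (-((critExp (simpleRoot d k) Γ).toReal *
            simpleRoot (d.choose k) 1 (iwasawa (compoundPSL hk γ)⁻¹ x))))) ↔
        ((μ.map (Flag.act γ) ≪ μ) ∧ (μ ≪ μ.map (Flag.act γ)) ∧
          (μ.map (Flag.act γ)).rnDeriv μ =ᵐ[μ] fun x =>
            ENNReal.ofReal (Real.exp (-((critExp (simpleRoot d k) Γ).toReal *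
              simpleRoot d k (iwasawa γ⁻¹ x))))) := by
      intro γ
      have : IsFiniteMeasure (μ.map (Flag.act γ)) := inferInstance
      rw [map_act_map_thetaFlag, absolutelyContinuous_map_iff hemb,
        absolutelyContinuous_map_iff hemb]
      refine and_congr_right fun _ => and_congr_right fun _ => ?_
      have h1 := hemb.rnDeriv_map (μ.map (Flag.act γ)) μ
      rw [Filter.EventuallyEq, hemb.ae_map_iff, ← map_inv]
      simp only [simpleRoot_iwasawa_thetaFlag hk hkd]
      exact ⟨fun h => h1.symm.trans h, fun h => h1.trans h⟩
    constructor
    · exact fun h γ hγ => (key γ).1 (h _ ⟨γ, hγ, rfl⟩)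
    · rintro h - ⟨γ, hγ, rfl⟩
      exact (key γ).2 (h γ hγ)

theorem map_proj_map_thetaFlag (hk : 1 ≤ k) (hkd : k < d)
    (hkθ : k ∈ theta d k) (h1θ : 1 ∈ theta (d.choose k) 1)
    (μ : Measure (Flag K d (theta d k))) :
    (μ.map (thetaFlag hk hkd)).map (fun x => x.proj ⟨1, h1θ⟩) =
      (μ.map fun x => x.proj ⟨k, hkθ⟩).map (plucker hk hkd) := by
  rw [Measure.map_map (Flag.continuous_proj_apply _).measurable
      (measurableEmbedding_thetaFlag hk hkd).measurable,
    Measure.map_map (continuous_plucker hk hkd).measurable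
      (Flag.continuous_proj_apply _).measurable]
  congr 1
  funext x
  exact wedgeFlag_proj_one hk hkd _ _ (fun _ => subordinate_theta hk hkd) hkθ h1θ x

theorem isRootPattersonSullivan_map (hk : 1 ≤ k) (hkd : k < d) {Γ : Subgroup PSL(d, K)}
    (hΓ : IsDivergent (theta d k) Γ) {μ : Measure (Gr K d k)}
    (hμ : IsRootPattersonSullivan k Γ μ) :
    IsRootPattersonSullivan 1 (Γ.map (compoundPSL hk)) (μ.map (plucker hk hkd)) := by
  obtain ⟨hkθ, μ', hμ', rfl⟩ := hμ
  have h1θ := self_mem_theta le_rfl (one_lt_choose hk hkd)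
  exact ⟨h1θ, μ'.map (thetaFlag hk hkd), (isPattersonSullivan_map_iff hk hkd hΓ μ').2 hμ',
    (map_proj_map_thetaFlag hk hkd hkθ h1θ μ').symm⟩

theorem exists_isRootPattersonSullivan (hk : 1 ≤ k) (hkd : k < d) {Γ : Subgroup PSL(d, K)}
    (hΓ : IsDivergent (theta d k) Γ) {ν : Measure (Gr K (d.choose k) 1)}
    (hν : IsRootPattersonSullivan 1 (Γ.map (compoundPSL hk)) ν) :
    ∃ μ : Measure (Gr K d k), IsRootPattersonSullivan k Γ μ ∧ ν = μ.map (plucker hk hkd) := by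
  obtain ⟨h1θ, ν', hν', rfl⟩ := hν
  have hkθ := self_mem_theta hk hkd
  have hemb := measurableEmbedding_thetaFlag (K := K) hk hkd
  -- Nothing is lost by pulling back, because `ν'` is carried by the limit set, which lies in the
  -- image of the embedding.
  have hmap : (ν'.comap (thetaFlag hk hkd)).map (thetaFlag hk hkd) = ν' := by
    rw [hemb.map_comap]
    refine Measure.restrict_eq_self_of_ae_mem ?_
    filter_upwards [hν'.2.2.1] with y hy
    rw [limitSet_theta_map hk hkd hΓ] at hy
    exact Set.image_subset_range _ _ hy
  rw [← hmap] at hν' ⊢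
  exact ⟨_, ⟨hkθ, _, (isPattersonSullivan_map_iff hk hkd hΓ _).1 hν', rfl⟩,
    map_proj_map_thetaFlag hk hkd hkθ h1θ _⟩

/-! ### Smoothness of the Plücker embedding -/

/-- The linear form on `⋀^k K^d` whose value on `v_1 ∧ ⋯ ∧ v_k` is the minor of the matrix with
rows `v_s` given by the columns `f 1, …, f k`. -/
noncomputable def minorForm (K : Type*) [RCLike K] (f : Fin k → Fin d) :
    Vec K (d.choose k) →ₗ[K] K :=
  (exteriorPower.alternatingMapLinearEquiv (Matrix.detRowAlternating.compLinearMap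
    (LinearMap.pi fun s => (EuclideanSpace.projₗ (f s) : Vec K d →ₗ[K] K)))).comp
      (wedgeCoord K d k).symm.toLinearMap

theorem minorForm_wedge (f : Fin k → Fin d) (v : Fin k → Vec K d) :
    minorForm K f (wedge v) = Matrix.det (Matrix.of fun s s' => v s (f s')) := by
  rw [minorForm, LinearMap.comp_apply, wedge, LinearEquiv.coe_coe, LinearEquiv.symm_apply_apply,
    exteriorPower.alternatingMapLinearEquiv_apply_ιMulti]
  rfl

theorem contDiff_wedge : ContDiff K (⊤ : ℕ∞) (wedge : (Fin k → Vec K d) → Vec K (d.choose k)) := by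
  rw [contDiff_piLp]
  intro I
  simp only [wedge_apply, Matrix.det_apply, Matrix.of_apply]
  refine ContDiff.sum fun σ _ => ContDiff.const_smul _ (contDiff_prod fun s _ => ?_)
  fun_prop

theorem wedge_add_first {I : Fin (d.choose k)} (hI : ∀ s, (tuple d k I s : ℕ) = s)
    {r : Fin k → Vec K d} (hr : ∀ s, ∀ a : Fin d, (a : ℕ) < k → r s a = 0) :
    wedge (fun s => EuclideanSpace.single (tuple d k I s) (1 : K) + r s) I = 1 := by
  rw [wedge_apply]
  refine Eq.trans (congrArg Matrix.det ?_) Matrix.det_one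
  ext a b
  rw [Matrix.of_apply, PiLp.add_apply, hr b _ (by rw [hI]; exact a.2), add_zero, PiLp.single_apply,
    Matrix.one_apply]
  simp only [(tuple d k I).injective.eq_iff]

theorem exists_form_wedge_add {I : Fin (d.choose k)} (hI : ∀ s, (tuple d k I s : ℕ) = s)
    (i : Fin k) (a : Fin d) (ha : k ≤ (a : ℕ)) :
    ∃ ℓ : Vec K (d.choose k) →ₗ[K] K, ∀ r : Fin k → Vec K d,
      (∀ s, ∀ a : Fin d, (a : ℕ) < k → r s a = 0) →
      ℓ (wedge (fun s => EuclideanSpace.single (tuple d k I s) (1 : K) + r s)) = r i a := by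
  -- With column `i` replaced by coordinate `a`, the minor is that of an identity matrix with one
  -- column replaced, so it equals `r i a` exactly and not merely to first order.
  refine ⟨minorForm K (Function.update (tuple d k I) i a), fun r hr => ?_⟩
  have h1 : (Matrix.of fun s s' => (EuclideanSpace.single (tuple d k I s) (1 : K) + r s)
      (Function.update (tuple d k I) i a s')) =
      (1 : Matrix (Fin k) (Fin k) K).updateCol i (fun s => r s a) := by
    ext s s'
    rw [Matrix.of_apply, PiLp.add_apply, PiLp.single_apply]
    by_cases hs : s' = i
    · have h2 : a ≠ tuple d k I s := by
        intro h
        have := congrArg Fin.val h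
        rw [hI] at this
        omega
      rw [hs, Function.update_self, if_neg h2, zero_add, Matrix.updateCol_self]
    · rw [Function.update_of_ne hs, Matrix.updateCol_ne hs, hr s _ (by rw [hI]; exact s'.2),
        add_zero, Matrix.one_apply]
      simp only [(tuple d k I).injective.eq_iff, eq_comm]
  rw [minorForm_wedge, h1, ← Matrix.cramer_apply, Matrix.cramer_one]
  rfl

theorem eq_zero_of_span_eq {ι V Y : Type*} [Fintype ι] [AddCommGroup V] [Module K V]
    [AddCommGroup Y] [Module K Y] {W : Submodule K V} (S : W →ₗ[K] Y) {w : ι → W}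
    (hspan : Submodule.span K (Set.range fun i => (w i : V)) = W) (h : ∀ i, S (w i) = 0)
    (x : W) : S x = 0 := by
  have hx : (x : V) ∈ Submodule.span K (Set.range fun i => (w i : V)) := by
    rw [hspan]; exact x.2
  obtain ⟨c, hc⟩ := (Submodule.mem_span_range_iff_exists_fun K).1 hx
  have h1 : x = ∑ i, c i • w i := by
    refine Subtype.ext ?_
    simp [← hc]
  rw [h1, map_sum]
  refine Finset.sum_eq_zero fun i _ => ?_
  rw [map_smul, h, smul_zero]

theorem contDiff_clm_comp {X V Y : Type*} [NormedAddCommGroup X] [NormedSpace K X]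
    [NormedAddCommGroup V] [NormedSpace K V] [NormedAddCommGroup Y] [NormedSpace K Y]
    {Q : X → V} (hQ : ContDiff K (⊤ : ℕ∞) Q) (L : V →L[K] Y) :
    ContDiff K (⊤ : ℕ∞) fun T => L (Q T) :=
  L.contDiff.comp hQ

theorem eq_zero_of_fderiv_eq_zero {X Y : Type*} [NormedAddCommGroup X] [NormedSpace K X]
    [NormedAddCommGroup Y] [NormedSpace K Y] {F : X → Y} (hF : ContDiff K (⊤ : ℕ∞) F)
    (Λ : Y →L[K] K) (R : X →L[K] K) (h : ∀ T, Λ (F T) = R T) {S : X}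
    (hS : fderiv K F 0 S = 0) : R S = 0 := by
  have h3 : HasFDerivAt (fun T => Λ (F T)) (Λ.comp (fderiv K F 0)) 0 :=
    Λ.hasFDerivAt.comp 0 ((hF.differentiable (by simp)).differentiableAt.hasFDerivAt)
  have h4 : HasFDerivAt (fun T => Λ (F T)) R 0 := by
    simp only [h]
    exact R.hasFDerivAt
  have h5 := congrArg (fun f => f S) (h3.unique h4)
  change Λ (fderiv K F 0 S) = R S at h5
  rw [hS, map_zero] at h5
  exact h5.symm

/-- In a unitary frame of `W`, the graph of `T` is spanned by `v T`, whose wedge is polynomial in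
`T`. Its component along `ω` is constantly one, so the chart expression is the polynomial map given
by `wedge (v T) - ω`. Suitable minors of this are the matrix entries of `T` itself, which makes the
derivative injective. -/
theorem isGrSmoothEmbedding_plucker (hk : 1 ≤ k) (hkd : k < d) :
    IsGrSmoothEmbedding (plucker hk hkd : Gr K d k → Gr K (d.choose k) 1) := by
  refine ⟨isEmbedding_plucker hk hkd, fun W => ?_⟩
  obtain ⟨m, hm, hmW⟩ := exists_stdFlag_eq (singleton_le hkd) W.toFlag
  have hW : W.carrier = (stdSpace K d k).map (slEquiv m).toLinearMap := by
    rw [← W.toFlag_proj, ← hmW]; rfl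
  have hD : 0 < d.choose k := Nat.choose_pos hkd.le
  set I : Fin (d.choose k) := ⟨0, hD⟩ with hI
  have hI' := (lt_one_iff_tuple hkd I).1 (by simp [hI])
  set e : Fin k → Vec K d := fun s => EuclideanSpace.single (tuple d k I s) (1 : K) with he
  have hwW : ∀ s, slEquiv m (e s) ∈ W.carrier := by
    intro s
    rw [hW, map_slEquiv_mem_iff]
    exact single_mem_stdSpace (by rw [hI']; exact s.2)
  set w : Fin k → W.carrier := fun s => ⟨slEquiv m (e s), hwW s⟩ with hw
  have hspan : Submodule.span K (Set.range fun s => (w s : Vec K d)) = W.carrier := by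
    refine Eq.trans ?_ hW.symm
    rw [stdSpace_eq_span_tuple hkd (I := I) (by simp [hI]), Submodule.map_span, ← Set.range_comp]
    rfl
  set v : (W.carrier →L[K] W.carrierᗮ) → Fin k → Vec K d := fun T s => w s + (T (w s) : Vec K d)
    with hv
  set r : (W.carrier →L[K] W.carrierᗮ) → Fin k → Vec K d :=
    fun T s => slEquiv m⁻¹ (T (w s) : Vec K d) with hr
  have hr0 : ∀ T s, ∀ a : Fin d, (a : ℕ) < k → r T s a = 0 := by
    intro T s a ha
    have h1 : slEquiv m (EuclideanSpace.single a (1 : K)) ∈ W.carrier := by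
      rw [hW, map_slEquiv_mem_iff]
      exact single_mem_stdSpace ha
    have h2 := (Submodule.mem_orthogonal _ _).1 (T (w s)).2 _ h1
    rw [← slEquiv_apply_inv_self m (T (w s) : Vec K d), inner_slEquiv hm,
      EuclideanSpace.inner_single_left, map_one, one_mul] at h2
    exact h2
  have hvr : ∀ T, v T = fun s => slEquiv m (e s + r T s) := by
    intro T
    funext s
    rw [map_add, hr]
    dsimp only
    rw [slEquiv_apply_inv_self]
  have hwv : ∀ T, wedge (v T) = slEquiv (compoundSL hk m) (wedge fun s => e s + r T s) := by
    intro T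
    rw [hvr, slEquiv_compoundSL_wedge]
  set ω : Vec K (d.choose k) := wedge fun s => (w s : Vec K d) with hω
  have hωe : ω = slEquiv (compoundSL hk m) (EuclideanSpace.single I 1) := by
    rw [hω, ← wedge_single, slEquiv_compoundSL_wedge]
  have hinner : ∀ T, inner K ω (wedge (v T)) = 1 := by
    intro T
    rw [hwv, hωe, inner_slEquiv (isSU_compoundSL hk hm), EuclideanSpace.inner_single_left,
      map_one, one_mul, wedge_add_first hI' (hr0 T)]
  have hωω : inner K ω ω = (1 : K) := by
    rw [hωe, inner_slEquiv (isSU_compoundSL hk hm), EuclideanSpace.inner_single_left]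
    simp
  have hvli : ∀ T, LinearIndependent K (v T) := by
    intro T
    rw [linearIndependent_iff_wedge_ne_zero]
    intro h0
    have h1 := hinner T
    rw [h0, inner_zero_right] at h1
    exact zero_ne_one h1
  have hwli : LinearIndependent K fun s => (w s : Vec K d) := by
    rw [linearIndependent_iff_wedge_ne_zero]
    intro h0
    rw [← hω] at h0
    rw [h0, inner_zero_right] at hωω
    exact zero_ne_one hωω
  have hE : (plucker hk hkd W).carrier = Submodule.span K {ω} :=
    isPluckerMap_plucker hk hkd W _ hwli hspan
  have hωE : ω ∈ (plucker hk hkd W).carrier := by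
    rw [hE]; exact Submodule.mem_span_singleton_self ω
  have hperp : ∀ T, wedge (v T) - ω ∈ ((plucker hk hkd W).carrier)ᗮ := by
    intro T
    rw [hE, Submodule.mem_orthogonal_singleton_iff_inner_right, inner_sub_right, hinner, hωω,
      sub_self]
  let φ : (plucker hk hkd W).carrier →L[K] K :=
    (innerSL K ω).comp (plucker hk hkd W).carrier.subtypeL
  -- A vector is sent to the rank-one map that takes `ω` to its component orthogonal to the line of
  -- `W`.
  let L : Vec K (d.choose k) →L[K]
      ((plucker hk hkd W).carrier →L[K] ((plucker hk hkd W).carrier)ᗮ) :=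
    (ContinuousLinearMap.smulRightL K _ _ φ).comp
      (((plucker hk hkd W).carrier)ᗮ.orthogonalProjectionOnto)
  have hL : ∀ T, ((L (wedge (v T) - ω) ⟨ω, hωE⟩ : ((plucker hk hkd W).carrier)ᗮ) :
      Vec K (d.choose k)) = wedge (v T) - ω := by
    intro T
    change ((inner K ω ω : K) • (((plucker hk hkd W).carrier)ᗮ.orthogonalProjectionOnto
      (wedge (v T) - ω)) : Vec K (d.choose k)) = _
    rw [hωω, one_smul]
    exact Submodule.starProjection_eq_self_iff.2 (hperp T)
  have hFd : ContDiff K (⊤ : ℕ∞) fun T => L (wedge (v T) - ω) := by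
    refine contDiff_clm_comp (K := K) (V := Vec K (d.choose k))
      (Y := (plucker hk hkd W).carrier →L[K] ((plucker hk hkd W).carrier)ᗮ)
      (Q := fun T => wedge (v T) - ω) (ContDiff.sub ?_ contDiff_const) L
    refine contDiff_wedge.comp (contDiff_pi.2 fun s => ?_)
    refine contDiff_const.add ?_
    exact ContinuousLinearMap.contDiff (𝕜 := K) (E := W.carrier →L[K] W.carrierᗮ) (F := Vec K d)
      (W.carrierᗮ.subtypeL.comp (ContinuousLinearMap.apply K _ (w s)))
  refine ⟨fun T => L (wedge (v T) - ω), Eventually.of_forall fun T => Gr.ext ?_,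
    hFd.contDiffAt, ?_⟩
  · have hgraph : Submodule.span K (Set.range (v T)) = (W.graph T).carrier := by
      refine Submodule.eq_of_le_of_finrank_eq ?_ ?_
      · rw [Submodule.span_le]
        rintro - ⟨s, rfl⟩
        exact ⟨w s, rfl⟩
      · rw [finrank_span_eq_card (hvli T), Fintype.card_fin, Gr.finrank_eq]
    have h1 : (plucker hk hkd (W.graph T)).carrier = Submodule.span K {wedge (v T)} :=
      isPluckerMap_plucker hk hkd _ _ (hvli T) hgraph
    refine Submodule.eq_of_le_of_finrank_eq ?_ ?_
    · rw [h1, Submodule.span_singleton_le_iff_mem]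
      refine ⟨⟨ω, hωE⟩, ?_⟩
      change ω + ((L (wedge (v T) - ω) ⟨ω, hωE⟩ : ((plucker hk hkd W).carrier)ᗮ) :
        Vec K (d.choose k)) = _
      rw [hL, add_sub_cancel]
    · rw [Gr.finrank_eq, Gr.finrank_eq]
  · rw [injective_iff_map_eq_zero]
    intro S hS
    -- A continuous linear form of the chart expression equals the linear form `T ↦ r T i a`.
    -- Differentiating, a direction killed by the derivative is killed by that form.
    have hcoord : ∀ i : Fin k, ∀ a : Fin d, k ≤ (a : ℕ) → r S i a = 0 := by
      intro i a ha
      obtain ⟨ℓ, hℓ⟩ := exists_form_wedge_add (K := K) hI' i a ha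
      let Λ : ((plucker hk hkd W).carrier →L[K] ((plucker hk hkd W).carrier)ᗮ) →L[K] K :=
        (ℓ.comp (slEquiv (compoundSL hk m)⁻¹).toLinearMap).toContinuousLinearMap.comp
          ((((plucker hk hkd W).carrier)ᗮ.subtypeL).comp
            (ContinuousLinearMap.apply K _ (⟨ω, hωE⟩ : (plucker hk hkd W).carrier)))
      let R : (W.carrier →L[K] W.carrierᗮ) →L[K] K :=
        ((EuclideanSpace.proj a : Vec K d →L[K] K).comp (slCLM m⁻¹)).comp
          (W.carrierᗮ.subtypeL.comp (ContinuousLinearMap.apply K _ (w i)))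
      have hΛR : ∀ T, Λ (L (wedge (v T) - ω)) = R T := by
        intro T
        change ℓ (slEquiv (compoundSL hk m)⁻¹ ((L (wedge (v T) - ω) ⟨ω, hωE⟩ :
          ((plucker hk hkd W).carrier)ᗮ) : Vec K (d.choose k))) = r T i a
        have h2 := hℓ (fun _ => 0) (fun _ _ _ => rfl)
        simp only [add_zero] at h2
        rw [hL, hwv, hωe, map_sub, slEquiv_inv_apply_self, slEquiv_inv_apply_self, map_sub,
          hℓ _ (hr0 T), ← wedge_single, h2]
        exact sub_zero _
      exact eq_zero_of_fderiv_eq_zero hFd Λ R hΛR hS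
    have hSw : ∀ i, S (w i) = 0 := by
      intro i
      refine Subtype.ext ?_
      have h1 : r S i = 0 := by
        ext a
        rcases lt_or_ge (a : ℕ) k with ha | ha
        · exact hr0 S i a ha
        · exact hcoord i a ha
      exact (LinearEquiv.map_eq_zero_iff _).1 h1
    exact ContinuousLinearMap.ext fun x =>
      eq_zero_of_span_eq (S : W.carrier →ₗ[K] W.carrierᗮ) hspan hSw x

end HyperconvexWedge

theorem mainTheorem7 {K : Type*} [RCLike K] (d k : ℕ) (hk : 1 ≤ k) (hkd : k < d) :
    ∃ (η : PSL(d, K) →* PSL(d.choose k, K)) (E : Gr K d k → Gr K (d.choose k) 1),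
      IsExteriorPowerRep η ∧ Continuous η ∧
      IsPluckerMap E ∧ IsGrSmoothEmbedding E ∧
      (∀ g : PSL(d, K),
        simpleRoot (d.choose k) 1 (cartan (η g)) = simpleRoot d k (cartan g)) ∧
      ∀ Γ : Subgroup PSL(d, K), IsCoHyperconvex k Γ →
        IsCoHyperconvex 1 (Γ.map η) ∧
        limitSetGr 1 (Γ.map η) = E '' limitSetGr k Γ ∧
        critExp (simpleRoot (d.choose k) 1) (Γ.map η) = critExp (simpleRoot d k) Γ ∧
        (∀ μ : Measure (Gr K d k), IsRootPattersonSullivan k Γ μ →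
          IsRootPattersonSullivan 1 (Γ.map η) (μ.map E)) ∧
        (∀ ν : Measure (Gr K (d.choose k) 1), IsRootPattersonSullivan 1 (Γ.map η) ν →
          ∃ μ : Measure (Gr K d k), IsRootPattersonSullivan k Γ μ ∧ ν = μ.map E) :=
  ⟨compoundPSL hk, plucker hk hkd, isExteriorPowerRep_compoundPSL hk, continuous_compoundPSL hk,
    isPluckerMap_plucker hk hkd, isGrSmoothEmbedding_plucker hk hkd,
    simpleRoot_one_compoundPSL hk hkd, fun Γ hΓ =>
      have hdiv := hΓ.1.1.2.1
      ⟨isCoHyperconvex_map hk hkd hΓ, limitSetGr_map hk hkd hdiv, critExp_map hk hkd Γ,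
        fun _ => isRootPattersonSullivan_map hk hkd hdiv,
        fun _ => exists_isRootPattersonSullivan hk hkd hdiv⟩⟩
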